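/- Let $x_l<x_r$ and consider the Sturm–Liouville problem $$-(\beta u')'+qu=f\quad\text{on }(x_l,x_r),$$ where at each endpoint either a Dirichlet condition $u=g$ or a Robin condition $\beta\,\partial_\nu u+\sigma u=g$ with $\sigma\ge 0$ is imposed ($\partial_\nu$ is the outward derivative; $\sigma=0$ is the Neumann condition). Assume $\beta\in C^1(x_l,x_r)\cap H^2(x_l,x_r)$ with $\beta\ge\beta_0>0$ for a constant $\beta_0$, $q\in C(x_l,x_r)\cap H^1(x_l,x_r)$ with $q\ge 0$, and $f\in H^1(x_l,x_r)$. Assume that the problem is definite, that is, that the condition at at least one endpoint is a Dirichlet condition or a Robin condition with $\sigma>0$, or that $q\not\equiv 0$. The weak form is $a(u,v)=L(v)$ for all $v\in H^1(x_l,x_r)$ that vanish at the Dirichlet endpoints, where $$a(u,v)=\int_{x_l}^{x_r}(\beta u'v'+quv)\,dx+\sum_{\text{Robin endpoints }p}\sigma_p\,u(p)v(p),\qquad L(v)=\int_{x_l}^{x_r}fv\,dx+\sum_{\text{Robin endpoints }p}g_p\,v(p),$$ and the energy norm is $\|w\|_e=a(w,w)^{1/2}$. Let $u\in H^3(x_l,x_r)$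 be the solution, that is, $u$ takes the prescribed values at the Dirichlet endpoints and satisfies the weak form. For a mesh $x_l=x_0<x_1<\dots<x_n=x_r$, put $h=\max_{0\le k<n}(x_{k+1}-x_k)$, let $\phi_0,\dots,\phi_n$ be the hat functions of the mesh, and let $B(x)=(x-x_k)(x-x_{k+1})$ for $x_k\le x\le x_{k+1}$. For $v_h=\sum_{j=0}^{n} c_j\phi_j$ put $$Tv_h=v_h-\frac12\frac{\beta'}{\beta}\,B\,v_h'+\frac12\frac{q}{\beta}\,B\,v_h ,\qquad v_h^{new}=Tv_h-\frac12\frac{f}{\beta}\,B .$$ The modified finite element solution $u_h^{new}$ is the Galerkin solution in the affine set of all $v_h^{new}$ for which $v_h$ takes the prescribed values at the Dirichlet endpoints: it is the element of this set with $a(u_h^{new},Tw_h)=L(Tw_h)$ for all piecewise linear $w_h=\sum_{j=0}^n d_j\phi_j$ that vanish at the Dirichlet endpoints. Then $u_h^{new}$ exists for every mesh, has uniquely determined coefficients $c_j$, and lies in $H^1(x_l,x_r)$, and there is a constant $C$, independent of the mesh, such that for every mesh $$\|u-u_h^{new}\|_{L^2}\le Ch^3,\qquad \|u-u_h^{new}\|_{H^1}\le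 Ch^2,\qquad \|u-u_h^{new}\|_{e}\le Ch^2 .$$ -/

import Mathlib

open MeasureTheory Set

noncomputable section

namespace CompactFEM

/-! ## Sobolev spaces on a bounded interval -/

/-- `w` is a weak derivative of `u` on the open interval `(a, b)`. -/
def IsWeakDeriv (a b : ℝ) (u w : ℝ → ℝ) : Prop :=
  LocallyIntegrableOn u (Ioo a b) ∧ LocallyIntegrableOn w (Ioo a b) ∧
    ∀ φ : ℝ → ℝ, ContDiff ℝ (⊤ : ℕ∞) φ → HasCompactSupport φ → tsupport φ ⊆ Ioo a b →
      ∫ x in Ioo a b, u x * deriv φ x = -∫ x in Ioo a b, w x * φ x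

open Classical in
/-- The weak derivative of `u` on `(a, b)` (unique almost everywhere there), and `0` if `u` has
none. -/
def weakDeriv (a b : ℝ) (u : ℝ → ℝ) : ℝ → ℝ :=
  if h : ∃ w, IsWeakDeriv a b u w then h.choose else 0

/-- `u` belongs to the Sobolev space `H^k(a, b)`, where `H^0 = L^2`. -/
def MemH (a b : ℝ) : ℕ → (ℝ → ℝ) → Prop
  | 0, u => MemLp u 2 (volume.restrict (Ioo a b))
  | k + 1, u => MemLp u 2 (volume.restrict (Ioo a b)) ∧
      ∃ w, IsWeakDeriv a b u w ∧ MemH a b k w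

/-- The norm of `L^2(a, b)`. -/
def normL2 (a b : ℝ) (w : ℝ → ℝ) : ℝ :=
  Real.sqrt (∫ x in Ioo a b, w x ^ 2)

/-- The norm of `H^1(a, b)`. -/
def normH1 (a b : ℝ) (w : ℝ → ℝ) : ℝ :=
  Real.sqrt ((∫ x in Ioo a b, w x ^ 2) + ∫ x in Ioo a b, weakDeriv a b w x ^ 2)

/-! ## Boundary conditions and the weak form -/

/-- A linear boundary condition at one endpoint: `dirichlet g` prescribes `u = g`, and
`robin σ g` prescribes `β ∂u/∂ν + σ u = g`, where `ν` is the outward direction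
(Neumann if `σ = 0`). -/
inductive BC : Type
  | dirichlet (g : ℝ) : BC
  | robin (σ g : ℝ) : BC

/-- The constraint that the condition puts on the boundary value of trial functions. -/
def BC.Trial : BC → ℝ → Prop
  | .dirichlet g, s => s = g
  | .robin _ _, _ => True

/-- The constraint that the condition puts on the boundary value of test functions. -/
def BC.Test : BC → ℝ → Prop
  | .dirichlet _, s => s = 0
  | .robin _ _, _ => True

/-- Contribution of the condition to the bilinear form. -/
def BC.bilin : BC → ℝ → ℝ → ℝ
  | .dirichlet _, _, _ => 0
  | .robin σ _, s, t => σ * s * t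

/-- Contribution of the condition to the linear form. -/
def BC.lin : BC → ℝ → ℝ
  | .dirichlet _, _ => 0
  | .robin _ g, t => g * t

/-- The Robin coefficient, if there is one, is nonnegative. -/
def BC.Nonneg : BC → Prop
  | .dirichlet _ => True
  | .robin σ _ => 0 ≤ σ

/-- The condition is a Dirichlet condition, or a Robin condition with positive coefficient. -/
def BC.Definite : BC → Prop
  | .dirichlet _ => True
  | .robin σ _ => 0 < σ

/-- The data of the problem `-(β u')' + q u = f` on `(a, b)` with a linear boundary condition at
each endpoint. -/
structure Problem where
  a : ℝ
  b : ℝ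
  β : ℝ → ℝ
  q : ℝ → ℝ
  f : ℝ → ℝ
  left : BC
  right : BC

namespace Problem

variable (P : Problem)

/-- The bilinear form of the weak formulation. -/
def form (u v : ℝ → ℝ) : ℝ :=
  (∫ x in Ioo P.a P.b,
      (P.β x * weakDeriv P.a P.b u x * weakDeriv P.a P.b v x + P.q x * u x * v x))
    + P.left.bilin (u P.a) (v P.a) + P.right.bilin (u P.b) (v P.b)

/-- The linear form of the weak formulation. -/
def load (v : ℝ → ℝ) : ℝ :=
  (∫ x in Ioo P.a P.b, P.f x * v x) + P.left.lin (v P.a) + P.right.lin (v P.b)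

/-- The energy norm. -/
def normE (w : ℝ → ℝ) : ℝ :=
  Real.sqrt (P.form w w)

/-- `u` is a weak solution. Elements of `H^1(a, b)` enter through their representative that is
continuous on `[a, b]`, so that their boundary values are their values at `a` and `b`. -/
def IsWeakSolution (u : ℝ → ℝ) : Prop :=
  MemH P.a P.b 1 u ∧ ContinuousOn u (Icc P.a P.b) ∧
    P.left.Trial (u P.a) ∧ P.right.Trial (u P.b) ∧
    ∀ v : ℝ → ℝ, MemH P.a P.b 1 v → ContinuousOn v (Icc P.a P.b) →
      P.left.Test (v P.a) → P.right.Test (v P.b) → P.form u v = P.load v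

end Problem

/-! ## Meshes, hat functions and bubbles -/

/-- `a = x 0 < x 1 < ... < x n = b`; the values of `x` beyond `n` play no role. -/
def IsMesh (a b : ℝ) (n : ℕ) (x : ℕ → ℝ) : Prop :=
  x 0 = a ∧ x n = b ∧ ∀ k < n, x k < x (k + 1)

/-- The mesh size, that is the length of the longest element. -/
def meshSize (n : ℕ) (x : ℕ → ℝ) : ℝ :=
  ⨆ k : Fin n, (x (k + 1) - x k)

/-- The hat function of node `i` (a half hat if `i = 0` or `i = n`). -/
def hat (n : ℕ) (x : ℕ → ℝ) (i : ℕ) (t : ℝ) : ℝ :=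
  if 0 < i ∧ x (i - 1) ≤ t ∧ t ≤ x i then (t - x (i - 1)) / (x i - x (i - 1))
  else if i < n ∧ x i ≤ t ∧ t ≤ x (i + 1) then (x (i + 1) - t) / (x (i + 1) - x i)
  else 0

/-- The continuous piecewise linear function with nodal values `c`. -/
def pl (n : ℕ) (x : ℕ → ℝ) (c : Fin (n + 1) → ℝ) (t : ℝ) : ℝ :=
  ∑ j : Fin (n + 1), c j * hat n x j t

/-- The function equal to `(t - x k) (t - x (k + 1))` on each element `(x k, x (k + 1))`, and to
`0` at the nodes and outside the mesh. -/
def bubble (n : ℕ) (x : ℕ → ℝ) (t : ℝ) : ℝ :=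
  ∑ k ∈ Finset.range n,
    (Ioo (x k) (x (k + 1))).indicator (fun s => (s - x k) * (s - x (k + 1))) t

namespace Problem

variable (P : Problem)

/-- The part of the modification that is linear in `v`:
`v - (1/2) (β'/β) (t - x_k) (t - x_{k+1}) v' + (1/2) (q/β) (t - x_k) (t - x_{k+1}) v`. -/
def modify (n : ℕ) (x : ℕ → ℝ) (v : ℝ → ℝ) (t : ℝ) : ℝ :=
  v t - 1 / 2 * (deriv P.β t / P.β t) * bubble n x t * deriv v t
    + 1 / 2 * (P.q t / P.β t) * bubble n x t * v t

/-- The modified finite element function with nodal values `c`. -/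
def newFun (n : ℕ) (x : ℕ → ℝ) (c : Fin (n + 1) → ℝ) (t : ℝ) : ℝ :=
  P.modify n x (pl n x c) t - 1 / 2 * (P.f t / P.β t) * bubble n x t

/-- The nodal values `c` define the Galerkin solution in the set of all modified finite element
functions that satisfy the Dirichlet conditions: the weak form holds for every test function in
the space of directions of this affine set. -/
def IsGalerkin (n : ℕ) (x : ℕ → ℝ) (c : Fin (n + 1) → ℝ) : Prop :=
  P.left.Trial (c 0) ∧ P.right.Trial (c (Fin.last n)) ∧
    ∀ d : Fin (n + 1) → ℝ, P.left.Test (d 0) → P.right.Test (d (Fin.last n)) →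
      P.form (P.newFun n x c) (P.modify n x (pl n x d)) = P.load (P.modify n x (pl n x d))

end Problem

end CompactFEM

end

open CompactFEM

/-! The equation gives `u'' = (q/β) u - (β'/β) u' - f/β`. On an element the error of the linear
interpolant of `u` is `u'' B / 2` to leading order. Replacing `u` and `u'` in `u''` by the
interpolant and its slope produces exactly the correction in `newFun`. Hence the modified function
with the nodal values of `u` has a derivative error of order two in `L^2`, at the cost of one
derivative of the coefficients and of `u''` (`integral_elem_error_sq_le`,
`exists_energy_interpolation`).

Two trial functions differ by some `T w_h` with `w_h` a test function, so the Galerkin error is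
`a`-orthogonal to this space and the Galerkin solution is the best approximation in energy. This
yields `h^2` in the energy norm, and in the derivative because `β ≥ β₀`. The space depends on the
mesh, but `B` vanishes at the nodes, so `T` keeps nodal values. With coercivity (`exists_coercive`)
this makes the Galerkin system definite on every mesh, coarse ones included.

The `L^2` bound is the Aubin–Nitsche argument. The dual problem with the error `w` as data has a
solution `z` bounded in `H^2` by `w` in `L^2` (`exists_dual`). The function `T z_I`, with `z_I` the
linear interpolant of `z`, approximates `z` to first order only (`exists_dual_interpolation`), since
no term with `w` is subtracted, but `h * h^2` is enough. The dual problem is solved by shooting: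
Picard iteration for the first order system in value and flux, then a linear combination that meets
the right boundary condition.

Weak derivatives are handled through absolutely continuous representatives: `H1Pair` for these,
`H1Rep` for functions equal to one almost everywhere and at the endpoints. The du Bois-Reymond lemma
links them to `MemH` and `weakDeriv`. -/

namespace CompactFEM

/-! ## Absolutely continuous functions with square integrable derivative -/

/-- `u` is absolutely continuous on `[a, b]` and `p` is its almost everywhere derivative, which is
square integrable. -/
structure H1Pair (a b : ℝ) (u p : ℝ → ℝ) : Prop where
  ac : AbsolutelyContinuousOnInterval u a b
  hasDeriv : ∀ᵐ x, x ∈ Ioo a b → HasDerivAt u (p x) x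
  memLp : MemLp p 2 (volume.restrict (Ioo a b))

theorem restrict_Ioo_eq_Ioc (a b : ℝ) :
    (volume : Measure ℝ).restrict (Ioo a b) = volume.restrict (Ioc a b) :=
  Measure.restrict_congr_set Ioo_ae_eq_Ioc

theorem setIntegral_Ioo_eq {a b : ℝ} (hab : a ≤ b) (f : ℝ → ℝ) :
    ∫ x in Ioo a b, f x = ∫ x in a..b, f x := by
  rw [intervalIntegral.integral_of_le hab, restrict_Ioo_eq_Ioc]

theorem intervalIntegrable_of_integrable {a b : ℝ} (hab : a ≤ b) {f : ℝ → ℝ}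
    (hf : Integrable f (volume.restrict (Ioo a b))) : IntervalIntegrable f volume a b := by
  rw [intervalIntegrable_iff_integrableOn_Ioc_of_le hab, IntegrableOn, ← restrict_Ioo_eq_Ioc]
  exact hf

theorem memLp_intervalIntegrable {a b : ℝ} (hab : a ≤ b) {f : ℝ → ℝ}
    (hf : MemLp f 2 (volume.restrict (Ioo a b))) : IntervalIntegrable f volume a b :=
  intervalIntegrable_of_integrable hab (hf.integrable (by norm_num))

theorem memLp_mul_intervalIntegrable {a b : ℝ} (hab : a ≤ b) {f g : ℝ → ℝ}
    (hf : MemLp f 2 (volume.restrict (Ioo a b))) (hg : MemLp g 2 (volume.restrict (Ioo a b))) :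
    IntervalIntegrable (fun x => f x * g x) volume a b :=
  intervalIntegrable_of_integrable hab (hf.integrable_mul hg)

theorem memLp_sq_intervalIntegrable {a b : ℝ} (hab : a ≤ b) {f : ℝ → ℝ}
    (hf : MemLp f 2 (volume.restrict (Ioo a b))) :
    IntervalIntegrable (fun x => f x ^ 2) volume a b :=
  intervalIntegrable_of_integrable hab hf.integrable_sq

theorem _root_.ContinuousOn.memLp_Ioo {a b : ℝ} {f : ℝ → ℝ} (hf : ContinuousOn f (Icc a b)) :
    MemLp f 2 (volume.restrict (Ioo a b)) := by
  obtain ⟨C, hC⟩ := isCompact_Icc.exists_bound_of_continuousOn hf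
  refine MemLp.of_bound ((hf.mono Ioo_subset_Icc_self).aestronglyMeasurable measurableSet_Ioo) C ?_
  filter_upwards [ae_restrict_mem measurableSet_Ioo] with x hx
  exact hC x (Ioo_subset_Icc_self hx)

theorem memLp_continuousOn_mul {a b : ℝ} {f g : ℝ → ℝ} (hf : ContinuousOn f (Icc a b))
    (hg : MemLp g 2 (volume.restrict (Ioo a b))) :
    MemLp (fun x => f x * g x) 2 (volume.restrict (Ioo a b)) := by
  obtain ⟨C, hC⟩ := isCompact_Icc.exists_bound_of_continuousOn hf
  refine MemLp.of_le_mul (c := C) hg (((hf.mono Ioo_subset_Icc_self).aestronglyMeasurable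
    measurableSet_Ioo).mul hg.1) ?_
  filter_upwards [ae_restrict_mem measurableSet_Ioo] with x hx
  rw [norm_mul]
  exact mul_le_mul_of_nonneg_right (hC x (Ioo_subset_Icc_self hx)) (norm_nonneg _)

theorem absolutelyContinuousOnInterval_congr {a b : ℝ} {f g : ℝ → ℝ} (h : EqOn f g (uIcc a b))
    (hf : AbsolutelyContinuousOnInterval f a b) : AbsolutelyContinuousOnInterval g a b := by
  rw [absolutelyContinuousOnInterval_iff] at hf ⊢
  intro ε hε
  obtain ⟨δ, hδ, H⟩ := hf ε hε
  refine ⟨δ, hδ, fun E hE hl => ?_⟩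
  have := H E hE hl
  convert this using 1
  refine Finset.sum_congr rfl fun i hi => ?_
  have := hE.1 i hi
  rw [h this.1, h this.2]

theorem ae_Ioo_iff_ae_Ioc {a b : ℝ} {Q : ℝ → Prop} :
    (∀ᵐ x, x ∈ Ioo a b → Q x) ↔ ∀ᵐ x, x ∈ Ioc a b → Q x := by
  rw [← ae_restrict_iff' measurableSet_Ioo, ← ae_restrict_iff' measurableSet_Ioc,
    restrict_Ioo_eq_Ioc]

theorem integral_congr_Ioo {a b : ℝ} (hab : a ≤ b) {f g : ℝ → ℝ}
    (h : ∀ᵐ x, x ∈ Ioo a b → f x = g x) : ∫ x in a..b, f x = ∫ x in a..b, g x := by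
  apply intervalIntegral.integral_congr_ae
  rw [uIoc_of_le hab]
  exact ae_Ioo_iff_ae_Ioc.1 h

namespace H1Pair

variable {a b : ℝ} {u v p r : ℝ → ℝ}

theorem continuousOn (h : H1Pair a b u p) (hab : a ≤ b) : ContinuousOn u (Icc a b) := by
  have := h.ac.continuousOn
  rwa [uIcc_of_le hab] at this

theorem mono (h : H1Pair a b u p) {c d : ℝ} (hac : a ≤ c) (hcd : c ≤ d) (hdb : d ≤ b) :
    H1Pair c d u p := by
  have hs : Ioo c d ⊆ Ioo a b := Ioo_subset_Ioo hac hdb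
  refine ⟨h.ac.mono ?_, ?_, h.memLp.mono_measure (Measure.restrict_mono_set _ hs)⟩
  · rw [uIcc_of_le hcd, uIcc_of_le (hac.trans (hcd.trans hdb))]
    exact Icc_subset_Icc hac hdb
  · filter_upwards [h.hasDeriv] with x hx hx'
    exact hx (hs hx')

theorem intervalIntegrable (h : H1Pair a b u p) (hab : a ≤ b) :
    IntervalIntegrable p volume a b :=
  memLp_intervalIntegrable hab h.memLp

theorem integral_deriv (h : H1Pair a b u p) (hab : a ≤ b) :
    ∫ x in a..b, p x = u b - u a := by
  rw [← h.ac.integral_deriv_eq_sub]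
  refine integral_congr_Ioo hab ?_
  filter_upwards [h.hasDeriv] with x hx hx'
  exact (hx hx').deriv.symm

theorem sub_eq (h : H1Pair a b u p) {x y : ℝ} (hx : a ≤ x) (hxy : x ≤ y) (hy : y ≤ b) :
    u y - u x = ∫ t in x..y, p t :=
  ((h.mono hx hxy hy).integral_deriv hxy).symm

/-- Lebesgue's differentiation theorem: a primitive of an integrable function is absolutely
continuous and has that function as its derivative almost everywhere. Smooth functions and glued
pieces enter `H1Pair` this way. -/
theorem of_integral (hab : a ≤ b) (hp : MemLp p 2 (volume.restrict (Ioo a b)))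
    (h : ∀ x ∈ Icc a b, u x = u a + ∫ t in a..x, p t) : H1Pair a b u p := by
  have hi := memLp_intervalIntegrable hab hp
  refine ⟨?_, ?_, hp⟩
  · have h1 : AbsolutelyContinuousOnInterval (fun x => u a + ∫ t in a..x, p t) a b :=
      ((LipschitzWith.const (u a)).lipschitzOnWith.absolutelyContinuousOnInterval).fun_add
        (hi.absolutelyContinuousOnInterval_intervalIntegral left_mem_uIcc)
    refine absolutelyContinuousOnInterval_congr (fun x hx => ?_) h1
    rw [uIcc_of_le hab] at hx
    exact (h x hx).symm
  · filter_upwards [hi.ae_hasDerivAt_integral] with x hx hx'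
    have h2 := (hx (by rw [uIcc_of_le hab]; exact Ioo_subset_Icc_self hx') a
      left_mem_uIcc).const_add (u a)
    refine h2.congr_of_eventuallyEq ?_
    filter_upwards [Ioo_mem_nhds hx'.1 hx'.2] with y hy
    exact h y (Ioo_subset_Icc_self hy)

theorem congr (h : H1Pair a b u p) (hab : a ≤ b) (hu : EqOn u v (Icc a b))
    (hp : p =ᵐ[volume.restrict (Ioo a b)] r) : H1Pair a b v r := by
  have hp' := (ae_restrict_iff' measurableSet_Ioo).1 hp
  refine ⟨absolutelyContinuousOnInterval_congr (by rwa [uIcc_of_le hab]) h.ac, ?_,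
    (memLp_congr_ae hp).1 h.memLp⟩
  filter_upwards [h.hasDeriv, hp'] with x hx hx2 hx'
  rw [← hx2 hx']
  refine (hx hx').congr_of_eventuallyEq ?_
  filter_upwards [Ioo_mem_nhds hx'.1 hx'.2] with y hy
  exact (hu (Ioo_subset_Icc_self hy)).symm

theorem congr_left (h : H1Pair a b u p) (hab : a ≤ b) (hu : EqOn u v (Icc a b)) :
    H1Pair a b v p :=
  h.congr hab hu (Filter.EventuallyEq.refl _ _)

theorem ae_unique (h : H1Pair a b u p) (h' : H1Pair a b u r) :
    p =ᵐ[volume.restrict (Ioo a b)] r := by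
  rw [Filter.EventuallyEq, ae_restrict_iff' measurableSet_Ioo]
  filter_upwards [h.hasDeriv, h'.hasDeriv] with x h1 h2 hx
  exact (h1 hx).unique (h2 hx)

theorem deriv_pair (h : H1Pair a b u p) (hab : a ≤ b) : H1Pair a b u (deriv u) := by
  refine h.congr hab (fun _ _ => rfl) ?_
  rw [Filter.EventuallyEq, ae_restrict_iff' measurableSet_Ioo]
  filter_upwards [h.hasDeriv] with x hx hx'
  exact (hx hx').deriv.symm

theorem of_contDeriv (hab : a ≤ b) (hu : ContinuousOn u (Icc a b)) (hp : ContinuousOn p (Icc a b))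
    (hd : ∀ x ∈ Ioo a b, HasDerivAt u (p x) x) : H1Pair a b u p := by
  refine of_integral hab hp.memLp_Ioo fun x hx => ?_
  rw [intervalIntegral.integral_eq_sub_of_hasDerivAt_of_le hx.1
    (hu.mono (Icc_subset_Icc_right hx.2))
    (fun y hy => hd y ⟨hy.1, hy.2.trans_le hx.2⟩)]
  · ring
  · exact (hp.mono (Icc_subset_Icc_right hx.2)).intervalIntegrable_of_Icc hx.1

theorem const (hab : a ≤ b) (c : ℝ) : H1Pair a b (fun _ => c) (fun _ => 0) :=
  of_contDeriv hab continuousOn_const continuousOn_const fun x _ => hasDerivAt_const x c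

theorem add (h : H1Pair a b u p) (h' : H1Pair a b v r) :
    H1Pair a b (fun x => u x + v x) (fun x => p x + r x) := by
  refine ⟨h.ac.fun_add h'.ac, ?_, h.memLp.add h'.memLp⟩
  filter_upwards [h.hasDeriv, h'.hasDeriv] with x h1 h2 hx
  exact (h1 hx).add (h2 hx)

theorem sub (h : H1Pair a b u p) (h' : H1Pair a b v r) :
    H1Pair a b (fun x => u x - v x) (fun x => p x - r x) := by
  refine ⟨h.ac.fun_sub h'.ac, ?_, h.memLp.sub h'.memLp⟩
  filter_upwards [h.hasDeriv, h'.hasDeriv] with x h1 h2 hx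
  exact (h1 hx).sub (h2 hx)

theorem const_mul (c : ℝ) (h : H1Pair a b u p) :
    H1Pair a b (fun x => c * u x) (fun x => c * p x) := by
  refine ⟨h.ac.const_mul c, ?_, h.memLp.const_mul c⟩
  filter_upwards [h.hasDeriv] with x h1 hx
  exact (h1 hx).const_mul c

theorem mul (hab : a ≤ b) (h : H1Pair a b u p) (h' : H1Pair a b v r) :
    H1Pair a b (fun x => u x * v x) (fun x => p x * v x + u x * r x) := by
  refine ⟨h.ac.fun_mul h'.ac, ?_, ?_⟩
  · filter_upwards [h.hasDeriv, h'.hasDeriv] with x h1 h2 hx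
    exact (h1 hx).mul (h2 hx)
  · refine MemLp.add ?_ (memLp_continuousOn_mul (h.continuousOn hab) h'.memLp)
    have := memLp_continuousOn_mul (h'.continuousOn hab) h.memLp
    simpa only [mul_comm] using this

/-- With a continuous derivative that exists at every interior point, the classical rule for
reciprocals suffices. The intended function is `β`. -/
theorem inv (hab : a ≤ b) (h : H1Pair a b u p) (h0 : ∀ x ∈ Icc a b, u x ≠ 0)
    (hp : ContinuousOn p (Icc a b)) (hd : ∀ x ∈ Ioo a b, HasDerivAt u (p x) x) :
    H1Pair a b (fun x => (u x)⁻¹) (fun x => -p x / u x ^ 2) := by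
  have hc := h.continuousOn hab
  exact of_contDeriv hab (hc.inv₀ h0) (hp.neg.div (hc.pow 2) fun x hx => pow_ne_zero 2 (h0 x hx))
    fun x hx => (hd x hx).inv (h0 x (Ioo_subset_Icc_self hx))

/-- A function with a continuous almost everywhere derivative is continuously differentiable. -/
theorem hasDerivAt_of_continuousOn (h : H1Pair a b u p) (hp : ContinuousOn p (Icc a b))
    {x : ℝ} (hx : x ∈ Ioo a b) : HasDerivAt u (p x) x := by
  have hab := (hx.1.trans hx.2).le
  have h1 : ∀ y ∈ Icc a b, u y = u a + ∫ t in a..y, p t := fun y hy => by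
    rw [← h.sub_eq le_rfl hy.1 hy.2]; ring
  have hnhds : Icc a b ∈ nhds x := Icc_mem_nhds hx.1 hx.2
  have h2 : HasDerivAt (fun y => u a + ∫ t in a..y, p t) (p x) x := by
    refine (intervalIntegral.integral_hasDerivAt_right ?_ ?_ (hp.continuousAt hnhds)).const_add _
    · exact (hp.mono (Icc_subset_Icc_right hx.2.le)).intervalIntegrable_of_Icc hx.1.le
    · exact (hp.mono Ioo_subset_Icc_self).stronglyMeasurableAtFilter isOpen_Ioo x hx
  refine h2.congr_of_eventuallyEq ?_
  filter_upwards [hnhds] with y hy using h1 y hy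

theorem integral_mul (hab : a ≤ b) (h : H1Pair a b u p) (h' : H1Pair a b v r) :
    ∫ x in a..b, (p x * v x + u x * r x) = u b * v b - u a * v a :=
  (mul hab h h').integral_deriv hab

theorem glue {c : ℝ} (hac : a ≤ c) (hcb : c ≤ b) (h : H1Pair a c u p) (h' : H1Pair c b u p) :
    H1Pair a b u p := by
  have hp : MemLp p 2 (volume.restrict (Ioo a b)) := by
    have h1 := h.memLp
    have h2 := h'.memLp
    rw [restrict_Ioo_eq_Ioc] at h1 h2 ⊢
    rw [← Ioc_union_Ioc_eq_Ioc hac hcb]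
    have hm : MemLp p 2 (volume.restrict (Ioc a c) + volume.restrict (Ioc c b)) := by
      rw [memLp_two_iff_integrable_sq_norm]
      · exact Integrable.add_measure h1.norm.integrable_sq h2.norm.integrable_sq
      · exact aestronglyMeasurable_add_measure_iff.2 ⟨h1.1, h2.1⟩
    -- Square integrability over the union follows from that over the sum of the two restricted
    -- measures, which dominates it.
    exact hm.mono_measure (Measure.restrict_union_le _ _)
  refine of_integral (hac.trans hcb) hp fun x hx => ?_
  rcases le_total x c with hxc | hxc
  · rw [← h.sub_eq le_rfl hx.1 hxc]; ring
  · have e1 := h.sub_eq le_rfl hac le_rfl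
    have e2 := h'.sub_eq le_rfl hxc hx.2
    have h3 := (h'.mono le_rfl hxc hx.2).intervalIntegrable hxc
    rw [← intervalIntegral.integral_add_adjacent_intervals (h.intervalIntegrable hac) h3, ← e1,
      ← e2]
    ring

end H1Pair

/-! ## Inequalities -/

theorem sq_integral_le {a b : ℝ} (hab : a ≤ b) {p : ℝ → ℝ}
    (hp : MemLp p 2 (volume.restrict (Ioo a b))) :
    (∫ x in a..b, p x) ^ 2 ≤ (b - a) * ∫ x in a..b, p x ^ 2 := by
  rcases hab.eq_or_lt with rfl | hlt
  · simp
  have i1 := memLp_intervalIntegrable hab hp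
  have i2 := memLp_sq_intervalIntegrable hab hp
  set I := ∫ x in a..b, p x
  -- Cauchy–Schwarz against a constant: the integral of this square is `b - a` times the difference
  -- of the two sides.
  have h0 : 0 ≤ ∫ x in a..b, ((b - a) * p x - I) ^ 2 :=
    intervalIntegral.integral_nonneg hab fun x _ => sq_nonneg _
  have h1 : ∫ x in a..b, ((b - a) * p x - I) ^ 2
      = (b - a) ^ 2 * (∫ x in a..b, p x ^ 2) - 2 * (b - a) * I * I + (b - a) * I ^ 2 := by
    have : ∀ x, ((b - a) * p x - I) ^ 2
        = (b - a) ^ 2 * p x ^ 2 - 2 * (b - a) * I * p x + I ^ 2 := fun x => by ring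
    simp_rw [this]
    rw [intervalIntegral.integral_add ((i2.const_mul _).sub (i1.const_mul _)) (by simp),
      intervalIntegral.integral_sub (i2.const_mul _) (i1.const_mul _),
      intervalIntegral.integral_const_mul, intervalIntegral.integral_const_mul,
      intervalIntegral.integral_const, smul_eq_mul]
  have h2 : 0 < b - a := by linarith
  rw [h1] at h0
  have : 0 ≤ (b - a) * ((b - a) * (∫ x in a..b, p x ^ 2) - I ^ 2) := by nlinarith
  have := nonneg_of_mul_nonneg_right this h2
  linarith

theorem sq_integral_abs_le {a b : ℝ} (hab : a ≤ b) {p : ℝ → ℝ}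
    (hp : MemLp p 2 (volume.restrict (Ioo a b))) :
    (∫ x in a..b, |p x|) ^ 2 ≤ (b - a) * ∫ x in a..b, p x ^ 2 := by
  have := sq_integral_le hab hp.norm
  simpa only [Real.norm_eq_abs, sq_abs] using this

theorem integral_sub_interval_le {a b c d : ℝ} (hac : a ≤ c) (hcd : c ≤ d) (hdb : d ≤ b)
    {f : ℝ → ℝ} (hf : IntervalIntegrable f volume a b) (h0 : ∀ x, 0 ≤ f x) :
    ∫ x in c..d, f x ≤ ∫ x in a..b, f x :=
  intervalIntegral.integral_mono_interval hac hcd hdb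
    (Filter.Eventually.of_forall h0) hf

theorem H1Pair.abs_sub_le {a b : ℝ} {u p : ℝ → ℝ} (hab : a ≤ b) (h : H1Pair a b u p) {x y : ℝ}
    (hx : x ∈ Icc a b) (hy : y ∈ Icc a b) : |u x - u y| ≤ ∫ t in a..b, |p t| := by
  wlog hyx : y ≤ x generalizing x y
  · rw [abs_sub_comm]
    exact this hy hx (le_of_not_ge hyx)
  rw [h.sub_eq hy.1 hyx hx.2]
  exact (intervalIntegral.abs_integral_le_integral_abs hyx).trans
    (integral_sub_interval_le hy.1 hyx hx.2 (h.intervalIntegrable hab).abs fun _ => abs_nonneg _)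

theorem H1Pair.sq_sub_le {a b : ℝ} {u p : ℝ → ℝ} (hab : a ≤ b) (h : H1Pair a b u p) {x y : ℝ}
    (hx : x ∈ Icc a b) (hy : y ∈ Icc a b) :
    (u x - u y) ^ 2 ≤ (b - a) * ∫ t in a..b, p t ^ 2 := by
  refine le_trans ?_ (sq_integral_abs_le hab h.memLp)
  rw [← sq_abs]
  exact pow_le_pow_left₀ (abs_nonneg _) (h.abs_sub_le hab hx hy) 2

/-- Pointwise bound through the mean value and the variation. -/
theorem H1Pair.mul_abs_le {a b : ℝ} {u p : ℝ → ℝ} (hab : a ≤ b) (h : H1Pair a b u p) {x : ℝ}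
    (hx : x ∈ Icc a b) :
    (b - a) * |u x| ≤ |∫ t in a..b, u t| + (b - a) * ∫ t in a..b, |p t| := by
  have hc := (h.continuousOn hab).intervalIntegrable_of_Icc hab (μ := volume)
  have h1 : (b - a) * u x = (∫ t in a..b, u t) + ∫ t in a..b, (u x - u t) := by
    rw [intervalIntegral.integral_sub (by simp) hc, intervalIntegral.integral_const, smul_eq_mul]
    ring
  have h2 : |∫ t in a..b, (u x - u t)| ≤ (b - a) * ∫ t in a..b, |p t| := by
    have := intervalIntegral.norm_integral_le_of_norm_le_const (a := a) (b := b)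
      (f := fun t => u x - u t) (C := ∫ t in a..b, |p t|) fun t ht => by
        rw [uIoc_of_le hab] at ht
        exact h.abs_sub_le hab hx (Ioc_subset_Icc_self ht)
    rw [abs_of_nonneg (sub_nonneg.2 hab), Real.norm_eq_abs] at this
    linarith
  calc (b - a) * |u x| = |(b - a) * u x| := by rw [abs_mul, abs_of_nonneg (sub_nonneg.2 hab)]
    _ ≤ _ := by
      rw [h1]
      exact (abs_add_le _ _).trans (by gcongr)

/-- Weighted Sobolev inequality in one dimension. -/
theorem H1Pair.weighted_sq_le {a b : ℝ} {u p : ℝ → ℝ} (hab : a ≤ b) (h : H1Pair a b u p)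
    {w : ℝ → ℝ} (hw : ContinuousOn w (Icc a b)) (hw0 : ∀ x ∈ Icc a b, 0 ≤ w x) {x : ℝ}
    (hx : x ∈ Icc a b) :
    (∫ t in a..b, w t) * u x ^ 2 ≤ 2 * (∫ t in a..b, w t * u t ^ 2)
      + 2 * (b - a) * (∫ t in a..b, w t) * ∫ t in a..b, p t ^ 2 := by
  have hu := h.continuousOn hab
  have i1 := hw.intervalIntegrable_of_Icc hab (μ := volume)
  have i2 : IntervalIntegrable (fun t => w t * u t ^ 2) volume a b :=
    (hw.mul (hu.pow 2)).intervalIntegrable_of_Icc hab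
  -- The bound `u x ^ 2 ≤ 2 * u t ^ 2 + 2 * (u x - u t) ^ 2`, integrated in `t` with weight `w`.
  have hm : ∫ t in a..b, w t * u x ^ 2
      ≤ ∫ t in a..b, (2 * (w t * u t ^ 2) + w t * (2 * (b - a) * ∫ t in a..b, p t ^ 2)) := by
    refine intervalIntegral.integral_mono_on hab (i1.mul_const _)
      ((i2.const_mul _).add (i1.mul_const _)) fun t ht => ?_
    have h1 := h.sq_sub_le hab hx ht
    have h2 : u x ^ 2 ≤ 2 * u t ^ 2 + 2 * ((b - a) * ∫ t in a..b, p t ^ 2) := by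
      nlinarith [sq_nonneg (u x - 2 * u t)]
    have := mul_le_mul_of_nonneg_left h2 (hw0 t ht)
    linarith
  rw [intervalIntegral.integral_add (i2.const_mul _) (i1.mul_const _),
    intervalIntegral.integral_const_mul, intervalIntegral.integral_mul_const,
    intervalIntegral.integral_mul_const] at hm
  linarith

/-! ## Weak derivatives -/

theorem MemLp.locallyIntegrableOn_Ioo {a b : ℝ} {f : ℝ → ℝ}
    (hf : MemLp f 2 (volume.restrict (Ioo a b))) : LocallyIntegrableOn f (Ioo a b) :=
  IntegrableOn.locallyIntegrableOn (hf.integrable (by norm_num))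

theorem eqOn_compl_zero_of_tsupport_subset {s : Set ℝ} {φ : ℝ → ℝ} (h : tsupport φ ⊆ s) {x : ℝ}
    (hx : x ∉ s) : φ x = 0 :=
  image_eq_zero_of_notMem_tsupport fun h' => hx (h h')

theorem h1Pair_of_contDiff {a b : ℝ} (hab : a ≤ b) {φ : ℝ → ℝ} (hφ : ContDiff ℝ (⊤ : ℕ∞) φ) :
    H1Pair a b φ (deriv φ) := by
  have hd := contDiff_infty_iff_deriv.1 hφ
  exact H1Pair.of_contDeriv hab hφ.continuous.continuousOn hd.2.continuous.continuousOn
    fun x _ => (hd.1 x).hasDerivAt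

theorem H1Pair.isWeakDeriv {a b : ℝ} (hab : a ≤ b) {u p : ℝ → ℝ} (h : H1Pair a b u p) :
    IsWeakDeriv a b u p := by
  refine ⟨MemLp.locallyIntegrableOn_Ioo (h.continuousOn hab).memLp_Ioo,
    MemLp.locallyIntegrableOn_Ioo h.memLp, fun φ hφ _ hs => ?_⟩
  have hφ' := h1Pair_of_contDiff hab hφ
  have hi := H1Pair.integral_mul hab h hφ'
  rw [eqOn_compl_zero_of_tsupport_subset hs right_notMem_Ioo,
    eqOn_compl_zero_of_tsupport_subset hs left_notMem_Ioo,
    intervalIntegral.integral_add] at hi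
  · rw [setIntegral_Ioo_eq hab, setIntegral_Ioo_eq hab]
    linarith
  · exact memLp_mul_intervalIntegrable hab h.memLp (hφ'.continuousOn hab).memLp_Ioo
  · exact memLp_mul_intervalIntegrable hab (h.continuousOn hab).memLp_Ioo hφ'.memLp

theorem setIntegral_mul_eq_integral {a b : ℝ} {d ψ : ℝ → ℝ} (hs : tsupport ψ ⊆ Ioo a b) :
    ∫ x in Ioo a b, d x * ψ x = ∫ x, d x * ψ x := by
  refine setIntegral_eq_integral_of_forall_compl_eq_zero fun x hx => ?_
  rw [eqOn_compl_zero_of_tsupport_subset hs hx, mul_zero]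

theorem ae_eq_zero_of_forall_test {a b : ℝ} {d : ℝ → ℝ} (hd : LocallyIntegrableOn d (Ioo a b))
    (h : ∀ φ : ℝ → ℝ, ContDiff ℝ (⊤ : ℕ∞) φ → HasCompactSupport φ → tsupport φ ⊆ Ioo a b →
      ∫ x in Ioo a b, d x * φ x = 0) : d =ᵐ[volume.restrict (Ioo a b)] fun _ => 0 := by
  rw [Filter.EventuallyEq, ae_restrict_iff' measurableSet_Ioo]
  refine isOpen_Ioo.ae_eq_zero_of_integral_contDiff_smul_eq_zero hd fun g hg hc hs => ?_
  rw [← h g hg hc hs, setIntegral_mul_eq_integral hs]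
  simp only [smul_eq_mul, mul_comm]

theorem integrable_mul_test {a b : ℝ} {d φ : ℝ → ℝ} (hd : LocallyIntegrableOn d (Ioo a b))
    (hφ : Continuous φ) (hc : HasCompactSupport φ) (hs : tsupport φ ⊆ Ioo a b) :
    Integrable (fun x => d x * φ x) (volume.restrict (Ioo a b)) := by
  have h1 : IntegrableOn d (tsupport φ) := hd.integrableOn_compact_subset hs hc
  have h2 : IntegrableOn (fun x => d x * φ x) (tsupport φ) :=
    h1.mul_continuousOn hφ.continuousOn hc
  have h3 : Integrable (fun x => d x * φ x) := by
    rw [← integrableOn_iff_integrable_of_support_subset (s := tsupport φ)]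
    · exact h2
    · intro x hx
      exact subset_tsupport φ (right_ne_zero_of_mul hx)
  exact h3.integrableOn

theorem test_deriv {a b : ℝ} {φ : ℝ → ℝ} (hφ : ContDiff ℝ (⊤ : ℕ∞) φ) (hc : HasCompactSupport φ)
    (hs : tsupport φ ⊆ Ioo a b) : ContDiff ℝ (⊤ : ℕ∞) (deriv φ) ∧ HasCompactSupport (deriv φ) ∧
      tsupport (deriv φ) ⊆ Ioo a b :=
  ⟨(contDiff_infty_iff_deriv.1 hφ).2, hc.deriv, (tsupport_deriv_subset).trans hs⟩

theorem IsWeakDeriv.ae_unique {a b : ℝ} {u w w' : ℝ → ℝ} (h : IsWeakDeriv a b u w)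
    (h' : IsWeakDeriv a b u w') : w =ᵐ[volume.restrict (Ioo a b)] w' := by
  have : (fun x => w x - w' x) =ᵐ[volume.restrict (Ioo a b)] fun _ => 0 := by
    refine ae_eq_zero_of_forall_test (h.2.1.sub h'.2.1) fun φ hφ hc hs => ?_
    simp_rw [sub_mul]
    rw [integral_sub (integrable_mul_test h.2.1 hφ.continuous hc hs)
      (integrable_mul_test h'.2.1 hφ.continuous hc hs)]
    have h1 := h.2.2 φ hφ hc hs
    have h2 := h'.2.2 φ hφ hc hs
    linarith
  filter_upwards [this] with x hx
  linarith

/-- A test function with integral zero is the derivative of a test function. -/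
theorem exists_test_antideriv {a b : ℝ} {ψ : ℝ → ℝ} (hψ : ContDiff ℝ (⊤ : ℕ∞) ψ)
    (hc : HasCompactSupport ψ) (hs : tsupport ψ ⊆ Ioo a b) (h0 : ∫ x in Ioo a b, ψ x = 0) :
    ∃ φ : ℝ → ℝ, ContDiff ℝ (⊤ : ℕ∞) φ ∧ HasCompactSupport φ ∧ tsupport φ ⊆ Ioo a b ∧
      deriv φ = ψ := by
  rcases (tsupport ψ).eq_empty_or_nonempty with he | hne
  · have : ψ = 0 := by rwa [tsupport_eq_empty_iff] at he
    subst this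
    exact ⟨0, contDiff_const, HasCompactSupport.zero, by simp [tsupport_eq_empty_iff.2], by
      ext x; simp⟩
  have hcomp : IsCompact (tsupport ψ) := hc
  obtain ⟨c, hcm, hcl⟩ := hcomp.exists_isLeast hne
  obtain ⟨d, hdm, hdl⟩ := hcomp.exists_isGreatest hne
  have hac := (hs hcm).1
  have hdb := (hs hdm).2
  have hcd : c ≤ d := hcl hdm
  have hder : ∀ x, HasDerivAt (fun x => ∫ t in a..x, ψ t) (ψ x) x := fun x =>
    intervalIntegral.integral_hasDerivAt_right (hψ.continuous.intervalIntegrable _ _)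
      (hψ.continuous.stronglyMeasurableAtFilter _ _) hψ.continuous.continuousAt
  have hd : deriv (fun x => ∫ t in a..x, ψ t) = ψ := funext fun x => (hder x).deriv
  have hz : ∀ x, x ∉ Icc c d → ψ x = 0 := fun x hx =>
    image_eq_zero_of_notMem_tsupport fun h => hx ⟨hcl h, hdl h⟩
  -- Left of the support of `ψ` the primitive integrates zeros; right of it, the primitive equals
  -- the total integral, which is zero.
  have hsupp : Function.support (fun x => ∫ t in a..x, ψ t) ⊆ Icc c d := by
    intro x hx
    by_contra hxn
    refine hx ?_
    rw [mem_Icc, not_and_or, not_le, not_le] at hxn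
    rcases hxn with hxc | hxd
    · refine (intervalIntegral.integral_congr (g := fun _ => 0) fun t ht => ?_).trans (by simp)
      refine hz t fun h => ?_
      have := ht.2
      exact absurd (le_sup_iff.1 (h.1.trans this)) (by simp [hac, hxc])
    · have e1 : ∫ t in a..b, ψ t = 0 := by
        rw [← setIntegral_Ioo_eq (hac.le.trans (hcd.trans hdb.le)), h0]
      have e2 : ∫ t in x..b, ψ t = 0 := by
        refine (intervalIntegral.integral_congr (g := fun _ => 0) fun t ht => ?_).trans (by simp)
        refine hz t fun h => ?_
        have := ht.1
        exact absurd (inf_le_iff.1 (this.trans h.2)) (by simp [hdb, hxd])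
      have e3 := intervalIntegral.integral_add_adjacent_intervals
        (hψ.continuous.intervalIntegrable a x (μ := volume)) (hψ.continuous.intervalIntegrable x b)
      linarith
  have hts : tsupport (fun x => ∫ t in a..x, ψ t) ⊆ Icc c d :=
    closure_minimal hsupp isClosed_Icc
  refine ⟨fun x => ∫ t in a..x, ψ t, ?_, ?_, hts.trans (Icc_subset_Ioo hac hdb), hd⟩
  · rw [contDiff_infty_iff_deriv, hd]
    exact ⟨fun x => (hder x).differentiableAt, hψ⟩
  · exact isCompact_Icc.of_isClosed_subset (isClosed_tsupport _) hts

theorem exists_test_integral_one {a b : ℝ} (hab : a < b) : ∃ η : ℝ → ℝ, ContDiff ℝ (⊤ : ℕ∞) η ∧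
    HasCompactSupport η ∧ tsupport η ⊆ Ioo a b ∧ ∫ x in Ioo a b, η x = 1 := by
  let f : ContDiffBump ((a + b) / 2) := ⟨(b - a) / 8, (b - a) / 4, by linarith, by linarith⟩
  have hs : tsupport (f.normed volume) ⊆ Ioo a b := by
    rw [f.tsupport_normed_eq, Real.closedBall_eq_Icc]
    exact Icc_subset_Ioo (by change a < (a + b) / 2 - (b - a) / 4; linarith)
      (by change (a + b) / 2 + (b - a) / 4 < b; linarith)
  refine ⟨f.normed volume, f.contDiff_normed, f.hasCompactSupport_normed, hs, ?_⟩
  rw [setIntegral_eq_integral_of_forall_compl_eq_zero, f.integral_normed]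
  exact fun x hx => eqOn_compl_zero_of_tsupport_subset hs hx

/-- The du Bois-Reymond lemma. -/
theorem ae_const_of_forall_deriv_test {a b : ℝ} (hab : a < b) {d : ℝ → ℝ}
    (hd : LocallyIntegrableOn d (Ioo a b))
    (h : ∀ φ : ℝ → ℝ, ContDiff ℝ (⊤ : ℕ∞) φ → HasCompactSupport φ → tsupport φ ⊆ Ioo a b →
      ∫ x in Ioo a b, d x * deriv φ x = 0) :
    ∃ c : ℝ, d =ᵐ[volume.restrict (Ioo a b)] fun _ => c := by
  obtain ⟨η, hη, hηc, hηs, hη1⟩ := exists_test_integral_one hab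
  refine ⟨∫ x in Ioo a b, d x * η x, ?_⟩
  set c := ∫ x in Ioo a b, d x * η x
  -- With `m` the integral of `ψ`, the function `ψ - m η` has integral zero and is the derivative of
  -- a test function. The hypothesis then says that `d` against `ψ` gives `m * c`, the same as the
  -- constant `c`.
  have key : (fun x => d x - c) =ᵐ[volume.restrict (Ioo a b)] fun _ => 0 := by
    refine ae_eq_zero_of_forall_test (hd.sub ((locallyIntegrable_const c).locallyIntegrableOn _))
      fun ψ hψ hψc hψs => ?_
    set m := ∫ x in Ioo a b, ψ x
    have iψ := (hψ.continuous.integrable_of_hasCompactSupport hψc (μ := volume)).integrableOn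
      (s := Ioo a b)
    have iη := (hη.continuous.integrable_of_hasCompactSupport hηc (μ := volume)).integrableOn
      (s := Ioo a b)
    have hψη : ContDiff ℝ (⊤ : ℕ∞) fun x => ψ x - m * η x := hψ.sub (contDiff_const.mul hη)
    have hcs : HasCompactSupport fun x => ψ x - m * η x := hψc.sub hηc.mul_left
    have hts : tsupport (fun x => ψ x - m * η x) ⊆ Ioo a b :=
      (tsupport_sub _ _).trans (union_subset hψs ((tsupport_mul_subset_right).trans hηs))
    have h0 : ∫ x in Ioo a b, (ψ x - m * η x) = 0 := by
      rw [integral_sub iψ (iη.const_mul m), integral_const_mul, hη1]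
      ring
    obtain ⟨φ, hφ, hφc, hφs, hφd⟩ := exists_test_antideriv hψη hcs hts h0
    have h1 := h φ hφ hφc hφs
    rw [hφd] at h1
    have e1 : ∀ x, d x * (ψ x - m * η x) = d x * ψ x - m * (d x * η x) := fun x => by ring
    have e2 : ∀ x, (d x - c) * ψ x = d x * ψ x - c * ψ x := fun x => by ring
    have i1 := integrable_mul_test hd hψ.continuous hψc hψs
    have i2 := integrable_mul_test hd hη.continuous hηc hηs
    simp_rw [e1] at h1
    rw [integral_sub i1 (i2.const_mul m), integral_const_mul] at h1
    simp_rw [e2]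
    rw [integral_sub i1 (iψ.const_mul c), integral_const_mul]
    change _ - c * m = 0
    change _ - m * c = 0 at h1
    linarith
  filter_upwards [key] with x hx
  linarith

/-- A function with a square integrable weak derivative has an absolutely continuous
representative. -/
theorem IsWeakDeriv.exists_h1Pair {a b : ℝ} (hab : a < b) {u w : ℝ → ℝ}
    (h : IsWeakDeriv a b u w) (hw : MemLp w 2 (volume.restrict (Ioo a b))) :
    ∃ v : ℝ → ℝ, H1Pair a b v w ∧ u =ᵐ[volume.restrict (Ioo a b)] v := by
  have h1 : H1Pair a b (fun x => ∫ t in a..x, w t) w :=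
    H1Pair.of_integral hab.le hw fun x _ => by simp
  have h2 := h1.isWeakDeriv hab.le
  -- The difference of `u` and a primitive of `w` has weak derivative zero.
  obtain ⟨c, hc⟩ := ae_const_of_forall_deriv_test hab (h.1.sub h2.1) fun φ hφ hφc hφs => by
    obtain ⟨t1, t2, t3⟩ := test_deriv hφ hφc hφs
    have e1 : ∀ x, (u - fun x => ∫ t in a..x, w t) x * deriv φ x
      = u x * deriv φ x - (∫ t in a..x, w t) * deriv φ x := fun x => by
        simp only [Pi.sub_apply]; ring
    simp_rw [e1]
    rw [integral_sub (integrable_mul_test h.1 t1.continuous t2 t3)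
      (integrable_mul_test h2.1 t1.continuous t2 t3), h.2.2 φ hφ hφc hφs, h2.2.2 φ hφ hφc hφs,
      sub_self]
  refine ⟨_, (H1Pair.const hab.le c).add h1 |>.congr hab.le (fun _ _ => rfl)
    (Filter.Eventually.of_forall fun x => zero_add _), ?_⟩
  filter_upwards [hc] with x hx
  simp only [Pi.sub_apply] at hx
  linarith

theorem MemH.memLp {a b : ℝ} {u : ℝ → ℝ} : ∀ {k : ℕ}, MemH a b k u →
    MemLp u 2 (volume.restrict (Ioo a b))
  | 0, h => h
  | _ + 1, h => h.1

theorem MemH.exists_h1Pair {a b : ℝ} (hab : a < b) {u : ℝ → ℝ} {k : ℕ} (h : MemH a b (k + 1) u) :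
    ∃ v w : ℝ → ℝ, H1Pair a b v w ∧ u =ᵐ[volume.restrict (Ioo a b)] v ∧ MemH a b k w := by
  obtain ⟨_, w, hw, hk⟩ := h
  obtain ⟨v, hv, huv⟩ := hw.exists_h1Pair hab hk.memLp
  exact ⟨v, w, hv, huv, hk⟩

theorem IsWeakDeriv.congr_left {a b : ℝ} {u v w : ℝ → ℝ} (h : IsWeakDeriv a b v w)
    (hu : MemLp u 2 (volume.restrict (Ioo a b)))
    (huv : u =ᵐ[volume.restrict (Ioo a b)] v) : IsWeakDeriv a b u w := by
  refine ⟨MemLp.locallyIntegrableOn_Ioo hu, h.2.1, fun φ hφ hc hs => ?_⟩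
  rw [← h.2.2 φ hφ hc hs]
  refine integral_congr_ae ?_
  filter_upwards [huv] with x hx
  rw [hx]

/-- `u` is equal almost everywhere on `(a, b)` and at the endpoints to an absolutely continuous
function whose derivative is `p`. -/
def H1Rep (a b : ℝ) (u p : ℝ → ℝ) : Prop :=
  ∃ v, H1Pair a b v p ∧ u =ᵐ[volume.restrict (Ioo a b)] v ∧ u a = v a ∧ u b = v b

theorem H1Pair.rep {a b : ℝ} {u p : ℝ → ℝ} (h : H1Pair a b u p) : H1Rep a b u p :=
  ⟨u, h, Filter.EventuallyEq.refl _ _, rfl, rfl⟩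

namespace H1Rep

variable {a b : ℝ} {u v p r : ℝ → ℝ}

theorem memLp_left (hab : a ≤ b) (h : H1Rep a b u p) : MemLp u 2 (volume.restrict (Ioo a b)) := by
  obtain ⟨v, hv, huv, _⟩ := h
  exact (memLp_congr_ae huv).2 (hv.continuousOn hab).memLp_Ioo

theorem memLp_right (h : H1Rep a b u p) : MemLp p 2 (volume.restrict (Ioo a b)) := by
  obtain ⟨v, hv, _⟩ := h
  exact hv.memLp

theorem isWeakDeriv (hab : a ≤ b) (h : H1Rep a b u p) : IsWeakDeriv a b u p := by
  have hu := h.memLp_left hab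
  obtain ⟨v, hv, huv, _⟩ := h
  exact (hv.isWeakDeriv hab).congr_left hu huv

theorem memH (hab : a ≤ b) (h : H1Rep a b u p) : MemH a b 1 u :=
  ⟨h.memLp_left hab, p, h.isWeakDeriv hab, h.memLp_right⟩

theorem weakDeriv_ae_eq (hab : a ≤ b) (h : H1Rep a b u p) :
    weakDeriv a b u =ᵐ[volume.restrict (Ioo a b)] p := by
  have hex : ∃ w, IsWeakDeriv a b u w := ⟨p, h.isWeakDeriv hab⟩
  rw [weakDeriv, dif_pos hex]
  exact hex.choose_spec.ae_unique (h.isWeakDeriv hab)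

theorem add (h : H1Rep a b u p) (h' : H1Rep a b v r) :
    H1Rep a b (fun x => u x + v x) (fun x => p x + r x) := by
  obtain ⟨U, hU, e1, e2, e3⟩ := h
  obtain ⟨V, hV, e1', e2', e3'⟩ := h'
  exact ⟨_, hU.add hV, e1.add e1', by simp only [e2, e2'], by simp only [e3, e3']⟩

theorem sub (h : H1Rep a b u p) (h' : H1Rep a b v r) :
    H1Rep a b (fun x => u x - v x) (fun x => p x - r x) := by
  obtain ⟨U, hU, e1, e2, e3⟩ := h
  obtain ⟨V, hV, e1', e2', e3'⟩ := h'
  exact ⟨_, hU.sub hV, e1.sub e1', by simp only [e2, e2'], by simp only [e3, e3']⟩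

theorem const_mul (c : ℝ) (h : H1Rep a b u p) :
    H1Rep a b (fun x => c * u x) (fun x => c * p x) := by
  obtain ⟨U, hU, e1, e2, e3⟩ := h
  refine ⟨_, hU.const_mul c, ?_, by simp only [e2], by simp only [e3]⟩
  filter_upwards [e1] with x hx
  rw [hx]

end H1Rep

/-- Two continuous functions that agree almost everywhere on a nondegenerate interval agree
everywhere, so `u` is its own absolutely continuous representative and its boundary values are
genuine. -/
theorem MemH.h1Pair_of_continuousOn {a b : ℝ} (hab : a < b) {u : ℝ → ℝ} {k : ℕ}
    (h : MemH a b (k + 1) u) (hc : ContinuousOn u (Icc a b)) :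
    ∃ w : ℝ → ℝ, H1Pair a b u w ∧ MemH a b k w := by
  obtain ⟨v, w, hv, huv, hw⟩ := h.exists_h1Pair hab
  have : EqOn u v (Icc a b) := by
    refine Measure.eqOn_Icc_of_ae_eq volume hab.ne ?_ hc (hv.continuousOn hab.le)
    rwa [← Measure.restrict_congr_set (Ioo_ae_eq_Icc (μ := volume))]
  exact ⟨w, hv.congr_left hab.le this.symm, hw⟩

/-! ## Regular data, the bilinear form and coercivity -/

/-- Representatives of the coefficients of a problem that are absolutely continuous on the closed
interval, together with the quotients `β' / β`, `q / β` and `f / β`. -/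
structure RegularData (P : Problem) where
  (β ρ q f κ κ' lam lam' φ φ' : ℝ → ℝ)
  β₀ : ℝ
  lt : P.a < P.b
  β₀_pos : 0 < β₀
  β_ge : ∀ x ∈ Icc P.a P.b, β₀ ≤ β x
  β_pair : H1Pair P.a P.b β ρ
  ρ_cont : ContinuousOn ρ (Icc P.a P.b)
  q_cont : ContinuousOn q (Icc P.a P.b)
  f_cont : ContinuousOn f (Icc P.a P.b)
  q_nonneg : ∀ x ∈ Icc P.a P.b, 0 ≤ q x
  β_eq : ∀ x ∈ Ioo P.a P.b, P.β x = β x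
  q_eq : ∀ x ∈ Ioo P.a P.b, P.q x = q x
  f_eq : P.f =ᵐ[volume.restrict (Ioo P.a P.b)] f
  κ_eq : ∀ x, κ x = ρ x / β x
  lam_eq : ∀ x, lam x = q x / β x
  φ_eq : ∀ x, φ x = f x / β x
  κ_pair : H1Pair P.a P.b κ κ'
  lam_pair : H1Pair P.a P.b lam lam'
  φ_pair : H1Pair P.a P.b φ φ'
  left_nonneg : P.left.Nonneg
  right_nonneg : P.right.Nonneg
  definite : P.left.Definite ∨ P.right.Definite ∨ 0 < ∫ x in P.a..P.b, q x

theorem BC.bilin_comm (B : BC) (s t : ℝ) : B.bilin s t = B.bilin t s := by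
  cases B <;> simp [BC.bilin]; ring

theorem BC.bilin_add_left (B : BC) (s s' t : ℝ) :
    B.bilin (s + s') t = B.bilin s t + B.bilin s' t := by
  cases B <;> simp [BC.bilin]; ring

theorem BC.bilin_mul_left (B : BC) (c s t : ℝ) : B.bilin (c * s) t = c * B.bilin s t := by
  cases B <;> simp [BC.bilin]; ring

theorem BC.lin_add (B : BC) (s t : ℝ) : B.lin (s + t) = B.lin s + B.lin t := by
  cases B <;> simp [BC.lin]; ring

theorem BC.lin_mul (B : BC) (c t : ℝ) : B.lin (c * t) = c * B.lin t := by
  cases B <;> simp [BC.lin]; ring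

theorem BC.bilin_self_nonneg {B : BC} (h : B.Nonneg) (s : ℝ) : 0 ≤ B.bilin s s := by
  cases B with
  | dirichlet g => exact le_rfl
  | robin σ g => simpa [BC.bilin, mul_assoc] using mul_nonneg (show 0 ≤ σ from h) (mul_self_nonneg s)

theorem BC.test_zero (B : BC) : B.Test 0 := by
  cases B <;> simp [BC.Test]

theorem BC.test_add {B : BC} {s t : ℝ} (hs : B.Test s) (ht : B.Test t) : B.Test (s + t) := by
  cases B <;> simp_all [BC.Test]

theorem BC.test_mul {B : BC} (c : ℝ) {t : ℝ} (ht : B.Test t) : B.Test (c * t) := by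
  cases B <;> simp_all [BC.Test]

theorem BC.test_sub_of_trial {B : BC} {s t : ℝ} (hs : B.Trial s) (ht : B.Trial t) :
    B.Test (s - t) := by
  cases B <;> simp_all [BC.Test, BC.Trial]

theorem BC.trial_add_test {B : BC} {s t : ℝ} (hs : B.Trial s) (ht : B.Test t) :
    B.Trial (s + t) := by
  cases B <;> simp_all [BC.Test, BC.Trial]

theorem BC.exists_trial (B : BC) : ∃ s, B.Trial s := by
  cases B <;> simp [BC.Trial]

theorem BC.Definite.exists_sq_le {B : BC} (h : B.Definite) :
    ∃ K : ℝ, 0 ≤ K ∧ ∀ s, B.Test s → s ^ 2 ≤ K * B.bilin s s := by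
  cases B with
  | dirichlet g => exact ⟨0, le_rfl, fun s hs => by simp [show s = 0 from hs]⟩
  | robin σ g =>
    have hσ : 0 < σ := h
    refine ⟨σ⁻¹, (inv_pos.2 hσ).le, fun s _ => le_of_eq ?_⟩
    simp only [BC.bilin]
    field_simp

theorem Problem.form_comm (P : Problem) (u v : ℝ → ℝ) : P.form u v = P.form v u := by
  have h : ∀ x, P.β x * weakDeriv P.a P.b u x * weakDeriv P.a P.b v x + P.q x * u x * v x
      = P.β x * weakDeriv P.a P.b v x * weakDeriv P.a P.b u x + P.q x * v x * u x :=
    fun x => by ring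
  rw [Problem.form, Problem.form, P.left.bilin_comm, P.right.bilin_comm,
    integral_congr_ae (Filter.Eventually.of_forall h)]

namespace RegularData

variable {P : Problem} (R : RegularData P) {u v w p r : ℝ → ℝ}
include R

theorem le : P.a ≤ P.b := R.lt.le

theorem β_cont : ContinuousOn R.β (Icc P.a P.b) := R.β_pair.continuousOn R.le

theorem β_pos {x : ℝ} (hx : x ∈ Icc P.a P.b) : 0 < R.β x := R.β₀_pos.trans_le (R.β_ge x hx)

theorem form_integrable (hu : MemLp u 2 (volume.restrict (Ioo P.a P.b)))
    (hv : MemLp v 2 (volume.restrict (Ioo P.a P.b)))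
    (hp : MemLp p 2 (volume.restrict (Ioo P.a P.b)))
    (hr : MemLp r 2 (volume.restrict (Ioo P.a P.b))) :
    IntervalIntegrable (fun x => R.β x * p x * r x + R.q x * u x * v x) volume P.a P.b :=
  (memLp_mul_intervalIntegrable R.le (memLp_continuousOn_mul R.β_cont hp) hr).add
    (memLp_mul_intervalIntegrable R.le (memLp_continuousOn_mul R.q_cont hu) hv)

theorem form_eq (hu : H1Rep P.a P.b u p) (hv : H1Rep P.a P.b v r) :
    P.form u v = (∫ x in P.a..P.b, (R.β x * p x * r x + R.q x * u x * v x))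
      + P.left.bilin (u P.a) (v P.a) + P.right.bilin (u P.b) (v P.b) := by
  rw [Problem.form, ← setIntegral_Ioo_eq R.le]
  congr 2
  refine integral_congr_ae ?_
  filter_upwards [hu.weakDeriv_ae_eq R.le, hv.weakDeriv_ae_eq R.le,
    ae_restrict_mem measurableSet_Ioo] with x h1 h2 hx
  simp only [h1, h2, R.β_eq x hx, R.q_eq x hx]

theorem form_add_left {s : ℝ → ℝ} (hu : H1Rep P.a P.b u p) (hv : H1Rep P.a P.b v r)
    (hw : H1Rep P.a P.b w s) :
    P.form (fun x => u x + v x) w = P.form u w + P.form v w := by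
  rw [R.form_eq (hu.add hv) hw, R.form_eq hu hw, R.form_eq hv hw, BC.bilin_add_left,
    BC.bilin_add_left]
  have e : ∀ x, R.β x * (p x + r x) * s x + R.q x * (u x + v x) * w x
      = (R.β x * p x * s x + R.q x * u x * w x) + (R.β x * r x * s x + R.q x * v x * w x) :=
    fun x => by ring
  simp_rw [e]
  rw [intervalIntegral.integral_add
    (R.form_integrable (hu.memLp_left R.le) (hw.memLp_left R.le) hu.memLp_right hw.memLp_right)
    (R.form_integrable (hv.memLp_left R.le) (hw.memLp_left R.le) hv.memLp_right hw.memLp_right)]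
  ring

theorem form_mul_left (c : ℝ) (hu : H1Rep P.a P.b u p) (hv : H1Rep P.a P.b v r) :
    P.form (fun x => c * u x) v = c * P.form u v := by
  rw [R.form_eq (hu.const_mul c) hv, R.form_eq hu hv, BC.bilin_mul_left, BC.bilin_mul_left]
  have e : ∀ x, R.β x * (c * p x) * r x + R.q x * (c * u x) * v x
      = c * (R.β x * p x * r x + R.q x * u x * v x) := fun x => by ring
  simp_rw [e, intervalIntegral.integral_const_mul]
  ring

theorem form_sub_left {s : ℝ → ℝ} (hu : H1Rep P.a P.b u p) (hv : H1Rep P.a P.b v r)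
    (hw : H1Rep P.a P.b w s) :
    P.form (fun x => u x - v x) w = P.form u w - P.form v w := by
  have h := R.form_add_left hu (hv.const_mul (-1)) hw
  rw [R.form_mul_left _ hv hw] at h
  have e : (fun x => u x - v x) = fun x => u x + -1 * v x := funext fun x => by ring
  rw [e, h]
  ring

/-- The form sees only the class of a function up to null sets and its two boundary values. This
allows `newFun` to be traded for `smoothFun`. -/
theorem form_congr_left (hu : H1Rep P.a P.b u p) (hv : H1Rep P.a P.b v p)
    (huv : u =ᵐ[volume.restrict (Ioo P.a P.b)] v) (ha : u P.a = v P.a) (hb : u P.b = v P.b)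
    (hw : H1Rep P.a P.b w r) : P.form u w = P.form v w := by
  rw [R.form_eq hu hw, R.form_eq hv hw, ha, hb]
  congr 2
  refine integral_congr_Ioo R.le ?_
  filter_upwards [(ae_restrict_iff' measurableSet_Ioo).1 huv] with x hx hx'
  rw [hx hx']

theorem load_integrable (hv : MemLp v 2 (volume.restrict (Ioo P.a P.b))) :
    Integrable (fun x => P.f x * v x) (volume.restrict (Ioo P.a P.b)) :=
  ((memLp_congr_ae R.f_eq).2 R.f_cont.memLp_Ioo).integrable_mul hv

theorem load_add (hu : H1Rep P.a P.b u p) (hv : H1Rep P.a P.b v r) :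
    P.load (fun x => u x + v x) = P.load u + P.load v := by
  simp only [Problem.load, mul_add, BC.lin_add]
  rw [integral_add (R.load_integrable (hu.memLp_left R.le))
    (R.load_integrable (hv.memLp_left R.le))]
  ring

omit R in
theorem load_mul (c : ℝ) (u : ℝ → ℝ) : P.load (fun x => c * u x) = c * P.load u := by
  simp only [Problem.load, BC.lin_mul, mul_left_comm _ c, integral_const_mul]
  ring

/-- The `q` term and both boundary terms are kept because `exists_coercive` draws on a different one
of them in each definite case. -/
theorem form_self_ge (hu : H1Rep P.a P.b u p) :
    R.β₀ * (∫ x in P.a..P.b, p x ^ 2) + (∫ x in P.a..P.b, R.q x * u x ^ 2)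
      + P.left.bilin (u P.a) (u P.a) + P.right.bilin (u P.b) (u P.b) ≤ P.form u u := by
  rw [R.form_eq hu hu, ← intervalIntegral.integral_const_mul]
  have hq : IntervalIntegrable (fun x => R.q x * u x ^ 2) volume P.a P.b := by
    simpa only [pow_two, mul_assoc] using memLp_mul_intervalIntegrable R.le
      (memLp_continuousOn_mul R.q_cont (hu.memLp_left R.le)) (hu.memLp_left R.le)
  have hp := (memLp_sq_intervalIntegrable R.le hu.memLp_right).const_mul R.β₀
  rw [← intervalIntegral.integral_add hp hq]
  have := intervalIntegral.integral_mono_on R.le (hp.add hq)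
    (R.form_integrable (hu.memLp_left R.le) (hu.memLp_left R.le) hu.memLp_right hu.memLp_right)
    fun x hx => by
      have := mul_le_mul_of_nonneg_right (R.β_ge x hx) (sq_nonneg (p x))
      change R.β₀ * p x ^ 2 + R.q x * u x ^ 2 ≤ _
      nlinarith
  linarith

theorem integral_q_mul_sq_nonneg : 0 ≤ ∫ x in P.a..P.b, R.q x * u x ^ 2 :=
  intervalIntegral.integral_nonneg R.le fun x hx => mul_nonneg (R.q_nonneg x hx) (sq_nonneg _)

theorem integral_deriv_sq_le (hu : H1Rep P.a P.b u p) :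
    R.β₀ * (∫ x in P.a..P.b, p x ^ 2) ≤ P.form u u := by
  have h1 := R.form_self_ge hu
  have h2 := R.integral_q_mul_sq_nonneg (u := u)
  have h3 := BC.bilin_self_nonneg R.left_nonneg (u P.a)
  have h4 := BC.bilin_self_nonneg R.right_nonneg (u P.b)
  linarith

theorem form_self_nonneg (hu : H1Rep P.a P.b u p) : 0 ≤ P.form u u :=
  le_trans (mul_nonneg R.β₀_pos.le (intervalIntegral.integral_nonneg R.le fun _ _ => sq_nonneg _))
    (R.integral_deriv_sq_le hu)

/-- The energy controls the supremum norm on the space of test functions. -/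
theorem exists_coercive : ∃ K : ℝ, 0 < K ∧ ∀ u p : ℝ → ℝ, H1Pair P.a P.b u p →
    P.left.Test (u P.a) → P.right.Test (u P.b) →
    ∀ x ∈ Icc P.a P.b, u x ^ 2 ≤ K * P.form u u := by
  have hL : 0 < P.b - P.a := sub_pos.2 R.lt
  set D := (P.b - P.a) / R.β₀ with hD
  have hDpos : 0 < D := div_pos hL R.β₀_pos
  -- The energy controls the derivative through `β₀`, which accounts for the extra `2 * D`. It
  -- remains to control `u` at one endpoint or, when `q` has positive integral, in the mean with
  -- weight `q`.
  suffices ∃ K : ℝ, 0 ≤ K ∧ ∀ u p : ℝ → ℝ, H1Pair P.a P.b u p →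
      P.left.Test (u P.a) → P.right.Test (u P.b) →
      ∀ x ∈ Icc P.a P.b, u x ^ 2 ≤ K * P.form u u
        + 2 * ((P.b - P.a) * ∫ x in P.a..P.b, p x ^ 2) by
    obtain ⟨K, hK, H⟩ := this
    refine ⟨K + 2 * D, by positivity, fun u p hu hl hr x hx => ?_⟩
    have h1 := H u p hu hl hr x hx
    have h2 : (P.b - P.a) * ∫ x in P.a..P.b, p x ^ 2 ≤ D * P.form u u := by
      have := R.integral_deriv_sq_le hu.rep
      rw [hD, div_mul_eq_mul_div, le_div_iff₀ R.β₀_pos]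
      nlinarith
    linarith
  have main : ∀ u p : ℝ → ℝ, H1Pair P.a P.b u p → ∀ y ∈ Icc P.a P.b, ∀ x ∈ Icc P.a P.b,
      u x ^ 2 ≤ 2 * u y ^ 2 + 2 * ((P.b - P.a) * ∫ x in P.a..P.b, p x ^ 2) :=
    fun u p hu y hy x hx => by
      have := hu.sq_sub_le R.le hx hy
      nlinarith [sq_nonneg (u x - 2 * u y)]
  have hdd : ∀ u p : ℝ → ℝ, H1Pair P.a P.b u p → 0 ≤ R.β₀ * (∫ x in P.a..P.b, p x ^ 2) :=
    fun u p hu => mul_nonneg R.β₀_pos.le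
      (intervalIntegral.integral_nonneg R.le fun x _ => sq_nonneg _)
  rcases R.definite with h | h | h
  · obtain ⟨K, hK, H⟩ := h.exists_sq_le
    refine ⟨2 * K, by positivity, fun u p hu hl hr x hx => ?_⟩
    have h1 := main u p hu P.a (left_mem_Icc.2 R.le) x hx
    have h2 := H _ hl
    have h3 := R.form_self_ge hu.rep
    have h4 := R.integral_q_mul_sq_nonneg (u := u)
    have h5 := BC.bilin_self_nonneg R.right_nonneg (u P.b)
    have h6 := hdd u p hu
    have : K * P.left.bilin (u P.a) (u P.a) ≤ K * P.form u u :=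
      mul_le_mul_of_nonneg_left (by linarith) hK
    linarith
  · obtain ⟨K, hK, H⟩ := h.exists_sq_le
    refine ⟨2 * K, by positivity, fun u p hu hl hr x hx => ?_⟩
    have h1 := main u p hu P.b (right_mem_Icc.2 R.le) x hx
    have h2 := H _ hr
    have h3 := R.form_self_ge hu.rep
    have h4 := R.integral_q_mul_sq_nonneg (u := u)
    have h5 := BC.bilin_self_nonneg R.left_nonneg (u P.a)
    have h6 := hdd u p hu
    have : K * P.right.bilin (u P.b) (u P.b) ≤ K * P.form u u :=
      mul_le_mul_of_nonneg_left (by linarith) hK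
    linarith
  · set Q := ∫ x in P.a..P.b, R.q x
    refine ⟨2 / Q, by positivity, fun u p hu hl hr x hx => ?_⟩
    have h1 := hu.weighted_sq_le R.le R.q_cont R.q_nonneg hx
    have h3 := R.form_self_ge hu.rep
    have h4 := BC.bilin_self_nonneg R.left_nonneg (u P.a)
    have h5 := BC.bilin_self_nonneg R.right_nonneg (u P.b)
    have h6 := hdd u p hu
    have e : 2 / Q * P.form u u + 2 * ((P.b - P.a) * ∫ x in P.a..P.b, p x ^ 2)
        = (2 * P.form u u + 2 * (P.b - P.a) * Q * ∫ x in P.a..P.b, p x ^ 2) / Q := by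
      field_simp
    rw [e, le_div_iff₀ h]
    change Q * u x ^ 2 ≤ _ + 2 * (P.b - P.a) * Q * _ at h1
    linarith

end RegularData

/-! ## Linear second order initial value problems -/

/-- Each integration against the exponential weight gains a factor `1 / l`, which makes the Picard
map a contraction for large `l`. -/
theorem abs_integral_le_of_exp_bound {a x l C : ℝ} (hl : 0 < l) (hx : a ≤ x) (hC : 0 ≤ C)
    {g : ℝ → ℝ} (hg : ∀ s ∈ Icc a x, |g s| ≤ C * Real.exp (l * (s - a))) :
    |∫ s in a..x, g s| ≤ C / l * Real.exp (l * (x - a)) := by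
  have hcont : Continuous fun s => C * Real.exp (l * (s - a)) := by fun_prop
  have h1 := intervalIntegral.norm_integral_le_of_norm_le hx (μ := volume) (f := g)
    (Filter.Eventually.of_forall fun s hs => hg s (Ioc_subset_Icc_self hs))
    (hcont.intervalIntegrable _ _)
  have h2 : ∫ s in a..x, C * Real.exp (l * (s - a))
      = C / l * Real.exp (l * (x - a)) - C / l * Real.exp (l * (a - a)) := by
    refine intervalIntegral.integral_eq_sub_of_hasDerivAt
      (f := fun s => C / l * Real.exp (l * (s - a))) (fun s _ => ?_)
      (hcont.intervalIntegrable _ _)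
    have hd : HasDerivAt (fun s => l * (s - a)) l s := by
      simpa using ((hasDerivAt_id s).sub_const a).const_mul l
    have he : C / l * (Real.exp (l * (s - a)) * l) = C * Real.exp (l * (s - a)) := by
      field_simp
    exact he ▸ hd.exp.const_mul (C / l)
  have h3 : 0 ≤ C / l * Real.exp (l * (a - a)) := by positivity
  rw [h2] at h1
  exact h1.trans (by linarith)

theorem hasDerivAt_add_integral {g : ℝ → ℝ} (hg : Continuous g) (c a x : ℝ) :
    HasDerivAt (fun x => c + ∫ t in a..x, g t) (g x) x :=
  (intervalIntegral.integral_hasDerivAt_right (hg.intervalIntegrable _ _)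
    (hg.stronglyMeasurableAtFilter _ _) hg.continuousAt).const_add c

theorem continuous_add_integral {g : ℝ → ℝ} (hg : Continuous g) (c a : ℝ) :
    Continuous fun x => c + ∫ t in a..x, g t :=
  continuous_iff_continuousAt.2 fun x => (hasDerivAt_add_integral hg c a x).continuousAt

/-- Picard iteration in an exponentially weighted norm, so that one fixed point argument covers the
whole interval. The unknown is `ζ = z / E`; `Y` computes the flux from it and `Z` the new value. -/
theorem exists_linear_ode_of_continuous {a b : ℝ} (hab : a ≤ b) {k q w : ℝ → ℝ}
    (hk : Continuous k) (hq : Continuous q) (hw : Continuous w) (z₀ y₀ : ℝ) :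
    ∃ z y : ℝ → ℝ, Continuous z ∧ Continuous y ∧ z a = z₀ ∧ y a = y₀ ∧
      (∀ x ∈ Icc a b, HasDerivAt z (k x * y x) x) ∧
      ∀ x ∈ Icc a b, HasDerivAt y (q x * z x - w x) x := by
  obtain ⟨M₁, hM₁⟩ := isCompact_Icc.exists_bound_of_continuousOn (hk.continuousOn (s := Icc a b))
  obtain ⟨M₂, hM₂⟩ := isCompact_Icc.exists_bound_of_continuousOn (hq.continuousOn (s := Icc a b))
  have ha := left_mem_Icc.2 hab
  have hM₁0 : 0 ≤ M₁ := (norm_nonneg _).trans (hM₁ a ha)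
  have hM₂0 : 0 ≤ M₂ := (norm_nonneg _).trans (hM₂ a ha)
  -- This makes `M₁ * M₂ / l ^ 2 ≤ 1 / 2`; the summand `1` keeps `l` positive when both bounds
  -- vanish.
  set l := M₁ + M₂ + 1 with hl
  have hlpos : 0 < l := by positivity
  let E : ℝ → ℝ := fun s => Real.exp (l * (s - a))
  have hE : Continuous E := by fun_prop
  have hEpos : ∀ s, 0 < E s := fun s => Real.exp_pos _
  let Y : C(Icc a b, ℝ) → ℝ → ℝ := fun ζ t =>
    y₀ + ∫ s in a..t, (q s * (E s * IccExtend hab ζ s) - w s)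
  let Z : C(Icc a b, ℝ) → ℝ → ℝ := fun ζ x => z₀ + ∫ t in a..x, k t * Y ζ t
  have hext : ∀ ζ : C(Icc a b, ℝ), Continuous (IccExtend hab ζ) := fun ζ => ζ.continuous.Icc_extend'
  have hYi : ∀ ζ : C(Icc a b, ℝ), Continuous fun s => q s * (E s * IccExtend hab ζ s) - w s :=
    fun ζ => (hq.mul (hE.mul (hext ζ))).sub hw
  have hY : ∀ ζ, Continuous (Y ζ) := fun ζ => continuous_add_integral (hYi ζ) _ _
  have hZi : ∀ ζ, Continuous fun t => k t * Y ζ t := fun ζ => hk.mul (hY ζ)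
  have hZ : ∀ ζ, Continuous (Z ζ) := fun ζ => continuous_add_integral (hZi ζ) _ _
  let Φ : C(Icc a b, ℝ) → C(Icc a b, ℝ) := fun ζ =>
    ⟨fun x => (E x)⁻¹ * Z ζ x, ((hE.inv₀ fun s => (hEpos s).ne').mul (hZ ζ)).comp
      continuous_subtype_val⟩
  have hcontr : ContractingWith (1 / 2) Φ := by
    refine ⟨by norm_num, LipschitzWith.of_dist_le_mul fun ζ₁ ζ₂ => ?_⟩
    set d := dist ζ₁ ζ₂ with hd
    have hd0 : 0 ≤ d := dist_nonneg
    have hYd : ∀ t ∈ Icc a b, |Y ζ₁ t - Y ζ₂ t| ≤ M₂ * d / l * E t := by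
      intro t ht
      have e : Y ζ₁ t - Y ζ₂ t
          = ∫ s in a..t, q s * E s * (IccExtend hab ζ₁ s - IccExtend hab ζ₂ s) := by
        simp only [Y]
        rw [add_sub_add_left_eq_sub, ← intervalIntegral.integral_sub
          ((hYi ζ₁).intervalIntegrable _ _) ((hYi ζ₂).intervalIntegrable _ _)]
        congr 1
        ext s
        ring
      rw [e]
      refine abs_integral_le_of_exp_bound hlpos ht.1 (by positivity) fun s hs => ?_
      have h1 : |IccExtend hab ζ₁ s - IccExtend hab ζ₂ s| ≤ d :=
        ContinuousMap.dist_apply_le_dist (f := ζ₁) (g := ζ₂) (projIcc a b hab s)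
      have h2 : |q s| ≤ M₂ := hM₂ s ⟨hs.1, hs.2.trans ht.2⟩
      rw [abs_mul, abs_mul, abs_of_pos (hEpos s)]
      calc |q s| * E s * |IccExtend hab ζ₁ s - IccExtend hab ζ₂ s| ≤ M₂ * E s * d := by
            have := (hEpos s).le
            gcongr
        _ = _ := by ring
    refine (ContinuousMap.dist_le (by positivity)).2 fun x => ?_
    have e : Z ζ₁ x - Z ζ₂ x = ∫ t in a..x, k t * (Y ζ₁ t - Y ζ₂ t) := by
      simp only [Z]
      rw [add_sub_add_left_eq_sub, ← intervalIntegral.integral_sub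
        ((hZi ζ₁).intervalIntegrable _ _) ((hZi ζ₂).intervalIntegrable _ _)]
      congr 1
      ext s
      ring
    have hb : |Z ζ₁ x - Z ζ₂ x| ≤ M₁ * (M₂ * d / l) / l * E x := by
      rw [e]
      refine abs_integral_le_of_exp_bound hlpos x.2.1 (by positivity) fun s hs => ?_
      have hs' : s ∈ Icc a b := ⟨hs.1, hs.2.trans x.2.2⟩
      have h2 : |k s| ≤ M₁ := hM₁ s hs'
      rw [abs_mul, mul_assoc]
      exact mul_le_mul h2 (hYd s hs') (abs_nonneg _) hM₁0
    have e2 : dist (Φ ζ₁ x) (Φ ζ₂ x) = (E x)⁻¹ * |Z ζ₁ x - Z ζ₂ x| := by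
      rw [Real.dist_eq]
      change |(E x)⁻¹ * Z ζ₁ x - (E x)⁻¹ * Z ζ₂ x| = _
      rw [← mul_sub, abs_mul, abs_of_pos (inv_pos.2 (hEpos x))]
    rw [e2]
    calc (E x)⁻¹ * |Z ζ₁ x - Z ζ₂ x| ≤ (E x)⁻¹ * (M₁ * (M₂ * d / l) / l * E x) :=
          mul_le_mul_of_nonneg_left hb (inv_pos.2 (hEpos x)).le
      _ = (M₁ * M₂ / l ^ 2) * d := by
          have := (hEpos x).ne'
          field_simp
      _ ≤ 1 / 2 * d := by
          refine mul_le_mul_of_nonneg_right ?_ hd0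
          rw [div_le_iff₀ (by positivity), hl]
          nlinarith [sq_nonneg M₁, sq_nonneg M₂, mul_nonneg hM₁0 hM₂0]
      _ = _ := by simp
  have : Nonempty (Icc a b) := ⟨⟨a, ha⟩⟩
  set ζ := ContractingWith.fixedPoint Φ hcontr
  have hfix : Φ ζ = ζ := hcontr.fixedPoint_isFixedPt
  have hζ : ∀ x ∈ Icc a b, E x * IccExtend hab ζ x = Z ζ x := fun x hx => by
    have h1 : ζ ⟨x, hx⟩ = (E x)⁻¹ * Z ζ x := by
      conv_lhs => rw [← hfix]
      rfl
    rw [IccExtend_of_mem hab _ hx, h1, mul_inv_cancel_left₀ (hEpos x).ne']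
  refine ⟨Z ζ, Y ζ, hZ ζ, hY ζ, by simp [Z], by simp [Y],
    fun x _ => hasDerivAt_add_integral (hZi ζ) z₀ a x, fun x hx => ?_⟩
  rw [← hζ x hx]
  exact hasDerivAt_add_integral (hYi ζ) y₀ a x

theorem exists_linear_ode {a b : ℝ} (hab : a ≤ b) {k q w : ℝ → ℝ}
    (hk : ContinuousOn k (Icc a b)) (hq : ContinuousOn q (Icc a b)) (hw : ContinuousOn w (Icc a b))
    (z₀ y₀ : ℝ) :
    ∃ z y : ℝ → ℝ, z a = z₀ ∧ y a = y₀ ∧ H1Pair a b z (fun x => k x * y x) ∧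
      H1Pair a b y fun x => q x * z x - w x := by
  have ext : ∀ {g : ℝ → ℝ}, ContinuousOn g (Icc a b) →
      ∃ G : ℝ → ℝ, Continuous G ∧ EqOn G g (Icc a b) := fun {g} hg =>
    ⟨IccExtend hab ((Icc a b).domRestrict g), hg.domRestrict.Icc_extend', fun x hx => by
      rw [IccExtend_of_mem hab _ hx]; rfl⟩
  obtain ⟨k', hk', ek⟩ := ext hk
  obtain ⟨q', hq', eq⟩ := ext hq
  obtain ⟨w', hw', ew⟩ := ext hw
  obtain ⟨z, y, hz, hy, hz0, hy0, dz, dy⟩ := exists_linear_ode_of_continuous hab hk' hq' hw' z₀ y₀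
  refine ⟨z, y, hz0, hy0, H1Pair.of_contDeriv hab hz.continuousOn (hk.mul hy.continuousOn)
    fun x hx => ?_, H1Pair.of_contDeriv hab hy.continuousOn ((hq.mul hz.continuousOn).sub hw)
    fun x hx => ?_⟩
  · rw [← ek (Ioo_subset_Icc_self hx)]
    exact dz x (Ioo_subset_Icc_self hx)
  · rw [← eq (Ioo_subset_Icc_self hx), ← ew (Ioo_subset_Icc_self hx)]
    exact dy x (Ioo_subset_Icc_self hx)

/-! ## The dual problem -/

/-- The homogeneous boundary condition at a right endpoint, for the value `z` and the flux `y`. -/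
def BC.HomogeneousRight (B : BC) (z y : ℝ) : Prop :=
  B.Test z ∧ ∀ t, B.Test t → B.bilin t z = -(t * y)

/-- With flux `y = β z'`, the outward flux at the left end is `-y`, so the homogeneous Robin
condition reads `y = σ z`. The implication `z₀ = 0 → y₀ = 1` keeps the initial data nontrivial. -/
theorem BC.exists_left_data (B : BC) : ∃ z₀ y₀ : ℝ, B.Test z₀ ∧ (z₀ = 0 → y₀ = 1) ∧
    ∀ t, B.Test t → B.bilin t z₀ = t * y₀ := by
  cases B with
  | dirichlet g => exact ⟨0, 1, rfl, fun _ => rfl, fun t ht => by simp [BC.bilin, show t = 0 from ht]⟩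
  | robin σ g => exact ⟨1, σ, trivial, fun h => absurd h one_ne_zero, fun t _ => by
      simp [BC.bilin, mul_comm]⟩

/-- The right condition is the vanishing of one linear functional, `z` or `y + σ z`. Either it
annihilates the second pair, or a multiple of that pair cancels its value on the first. -/
theorem BC.homogeneousRight_shooting (B : BC) (z₁ y₁ z₂ y₂ : ℝ) :
    B.HomogeneousRight z₂ y₂ ∨ ∃ s, B.HomogeneousRight (z₁ + s * z₂) (y₁ + s * y₂) := by
  cases B with
  | dirichlet g =>
    by_cases h : z₂ = 0
    · exact Or.inl ⟨h, fun t ht => by simp [BC.bilin, show t = 0 from ht]⟩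
    · refine Or.inr ⟨-z₁ / z₂, ?_, fun t ht => by simp [BC.bilin, show t = 0 from ht]⟩
      simp only [BC.Test]
      field_simp
      ring
  | robin σ g =>
    by_cases h : y₂ + σ * z₂ = 0
    · refine Or.inl ⟨trivial, fun t _ => ?_⟩
      simp only [BC.bilin]
      linear_combination t * h
    · refine Or.inr ⟨-(y₁ + σ * z₁) / (y₂ + σ * z₂), trivial, fun t _ => ?_⟩
      simp only [BC.bilin]
      field_simp
      ring

namespace RegularData

variable {P : Problem} (R : RegularData P)
include R

theorem inv_β_cont : ContinuousOn (fun x => (R.β x)⁻¹) (Icc P.a P.b) :=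
  R.β_cont.inv₀ fun _ hx => (R.β_pos hx).ne'

/-- Integration by parts for the system `β z' = y`, `y' = q z - w`. The boundary terms left over are
those that homogeneous boundary conditions cancel. -/
theorem form_eq_boundary {z y w v r : ℝ → ℝ} (hw : ContinuousOn w (Icc P.a P.b))
    (hz : H1Pair P.a P.b z fun x => (R.β x)⁻¹ * y x)
    (hy : H1Pair P.a P.b y fun x => R.q x * z x - w x) (hv : H1Pair P.a P.b v r) :
    P.form v z = (∫ x in P.a..P.b, v x * w x) + (v P.b * y P.b + P.right.bilin (v P.b) (z P.b))
      - (v P.a * y P.a - P.left.bilin (v P.a) (z P.a)) := by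
  have h1 := H1Pair.integral_mul R.le hv hy
  rw [R.form_eq hv.rep hz.rep]
  have hvw : IntervalIntegrable (fun x => v x * w x) volume P.a P.b :=
    ((hv.continuousOn R.le).mul hw).intervalIntegrable_of_Icc R.le
  have h2 : ∫ x in P.a..P.b, (R.β x * r x * ((R.β x)⁻¹ * y x) + R.q x * v x * z x)
      = (∫ x in P.a..P.b, (r x * y x + v x * (R.q x * z x - w x)))
        + ∫ x in P.a..P.b, v x * w x := by
    rw [← intervalIntegral.integral_add _ hvw]
    · refine integral_congr_Ioo R.le (Filter.Eventually.of_forall fun x hx => ?_)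
      have := (R.β_pos (Ioo_subset_Icc_self hx)).ne'
      field_simp
      ring
    · exact (memLp_mul_intervalIntegrable R.le hv.memLp (hy.continuousOn R.le).memLp_Ioo).add
        (memLp_mul_intervalIntegrable R.le (hv.continuousOn R.le).memLp_Ioo hy.memLp)
  rw [h2, h1]
  ring

theorem exists_dual_solution {w : ℝ → ℝ} (hw : ContinuousOn w (Icc P.a P.b)) :
    ∃ z y : ℝ → ℝ, H1Pair P.a P.b z (fun x => (R.β x)⁻¹ * y x) ∧
      H1Pair P.a P.b y (fun x => R.q x * z x - w x) ∧
      P.left.Test (z P.a) ∧ P.right.Test (z P.b) ∧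
      ∀ v r : ℝ → ℝ, H1Pair P.a P.b v r → P.left.Test (v P.a) → P.right.Test (v P.b) →
        P.form v z = ∫ x in P.a..P.b, v x * w x := by
  obtain ⟨z₀, y₀, hz₀, hne, hbl⟩ := P.left.exists_left_data
  obtain ⟨z₁, y₁, hza₁, hya₁, hz₁, hy₁⟩ := exists_linear_ode R.le R.inv_β_cont R.q_cont hw 0 0
  obtain ⟨z₂, y₂, hza₂, hya₂, hz₂, hy₂⟩ :=
    exists_linear_ode R.le R.inv_β_cont R.q_cont (continuousOn_const (c := (0 : ℝ))) z₀ y₀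
  rcases P.right.homogeneousRight_shooting (z₁ P.b) (y₁ P.b) (z₂ P.b) (y₂ P.b) with h | ⟨s, h⟩
  -- Here a nontrivial solution with zero data meets both boundary conditions, so its energy
  -- vanishes and `z₂ = 0` by coercivity. Its flux then starts at `1` and stays constant, so `z₂' =
  -- 1 / β > 0`, against the equal values of `z₂` at the two ends.
  · exfalso
    have h0 : P.form z₂ z₂ = 0 := by
      have hl : P.left.Test (z₂ P.a) := by rw [hza₂]; exact hz₀
      have e1 := h.2 _ h.1
      have e2 := hbl _ hl
      rw [hza₂] at e2
      rw [R.form_eq_boundary continuousOn_const hz₂ hy₂ hz₂, e1, hza₂, hya₂, e2]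
      simp
    obtain ⟨K, -, hK⟩ := R.exists_coercive
    have hzero : ∀ x ∈ Icc P.a P.b, z₂ x = 0 := fun x hx => by
      have := hK z₂ _ hz₂ (by rw [hza₂]; exact hz₀) h.1 x hx
      rw [h0, mul_zero] at this
      exact pow_eq_zero_iff two_ne_zero |>.1 (le_antisymm this (sq_nonneg _))
    have hy1 : ∀ x ∈ Icc P.a P.b, y₂ x = 1 := fun x hx => by
      have h1 := hy₂.sub_eq le_rfl hx.1 hx.2
      have h2 : ∫ t in P.a..x, (R.q t * z₂ t - 0) = ∫ t in P.a..x, (0 : ℝ) :=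
        integral_congr_Ioo hx.1 (Filter.Eventually.of_forall fun t ht => by
          rw [hzero t ⟨ht.1.le, ht.2.le.trans hx.2⟩]; ring)
      rw [h2, intervalIntegral.integral_zero, hya₂,
        hne (by rw [← hza₂]; exact hzero _ (left_mem_Icc.2 R.le))] at h1
      linarith
    have h1 := hz₂.integral_deriv R.le
    rw [hzero _ (left_mem_Icc.2 R.le), hzero _ (right_mem_Icc.2 R.le)] at h1
    have h2 := intervalIntegral.intervalIntegral_pos_of_pos_on
      (hz₂.intervalIntegrable R.le) (fun x hx => ?_) R.lt
    · linarith
    · rw [hy1 x (Ioo_subset_Icc_self hx), mul_one]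
      exact inv_pos.2 (R.β_pos (Ioo_subset_Icc_self hx))
  · have hz := hz₁.add (hz₂.const_mul s)
    have hy := hy₁.add (hy₂.const_mul s)
    have hz' : H1Pair P.a P.b (fun x => z₁ x + s * z₂ x)
        fun x => (R.β x)⁻¹ * (y₁ x + s * y₂ x) :=
      hz.congr R.le (fun _ _ => rfl) (Filter.Eventually.of_forall fun x => by ring)
    have hy' : H1Pair P.a P.b (fun x => y₁ x + s * y₂ x)
        fun x => R.q x * (z₁ x + s * z₂ x) - w x :=
      hy.congr R.le (fun _ _ => rfl) (Filter.Eventually.of_forall fun x => by ring)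
    refine ⟨_, _, hz', hy', ?_, h.1, fun v r hv hvl hvr => ?_⟩
    · simp only [hza₁, hza₂, zero_add]
      exact BC.test_mul s hz₀
    · rw [R.form_eq_boundary hw hz' hy' hv]
      have e1 := h.2 _ hvr
      have e2 := hbl _ hvl
      simp only [hza₁, hza₂, hya₁, hya₂, zero_add]
      rw [e1, BC.bilin_comm, BC.bilin_mul_left, BC.bilin_comm, e2]
      ring

theorem exists_bound {g : ℝ → ℝ} (hg : ContinuousOn g (Icc P.a P.b)) :
    ∃ M : ℝ, 0 ≤ M ∧ ∀ x ∈ Icc P.a P.b, |g x| ≤ M := by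
  obtain ⟨M, hM⟩ := isCompact_Icc.exists_bound_of_continuousOn hg
  exact ⟨M, (norm_nonneg _).trans (hM _ (left_mem_Icc.2 R.le)), hM⟩

theorem κ_cont : ContinuousOn R.κ (Icc P.a P.b) := R.κ_pair.continuousOn R.le

theorem lam_cont : ContinuousOn R.lam (Icc P.a P.b) := R.lam_pair.continuousOn R.le

omit R in
theorem sq_le_of_abs_le {c M t : ℝ} (h : |c| ≤ M) : (c * t) ^ 2 ≤ M ^ 2 * t ^ 2 := by
  rw [mul_pow]
  exact mul_le_mul_of_nonneg_right (sq_le_sq' (by linarith [neg_abs_le c]) ((le_abs_self c).trans h))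
    (sq_nonneg t)

omit R in
theorem integral_sq_le_of_sq_le {v : ℝ → ℝ} (hab : P.a ≤ P.b)
    (hv : ContinuousOn v (Icc P.a P.b)) {A : ℝ} (h : ∀ x ∈ Icc P.a P.b, v x ^ 2 ≤ A) :
    ∫ x in P.a..P.b, v x ^ 2 ≤ (P.b - P.a) * A := by
  have := intervalIntegral.integral_mono_on hab ((hv.pow 2).intervalIntegrable_of_Icc hab)
    (intervalIntegrable_const (μ := volume) (c := A)) h
  rwa [intervalIntegral.integral_const, smul_eq_mul] at this

/-- The dual problem is solvable, and its solution is bounded in `H^2` by the data in `L^2`. -/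
theorem exists_dual : ∃ K : ℝ, 0 < K ∧ ∀ w : ℝ → ℝ, ContinuousOn w (Icc P.a P.b) →
    ∃ z z' z'' : ℝ → ℝ, H1Pair P.a P.b z z' ∧ H1Pair P.a P.b z' z'' ∧
      P.left.Test (z P.a) ∧ P.right.Test (z P.b) ∧
      (∀ v r : ℝ → ℝ, H1Pair P.a P.b v r → P.left.Test (v P.a) → P.right.Test (v P.b) →
        P.form v z = ∫ x in P.a..P.b, v x * w x) ∧
      (∀ x ∈ Icc P.a P.b, z x ^ 2 ≤ K * ∫ x in P.a..P.b, w x ^ 2) ∧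
      (∀ x ∈ Icc P.a P.b, z' x ^ 2 ≤ K * ∫ x in P.a..P.b, w x ^ 2) ∧
      ∫ x in P.a..P.b, z'' x ^ 2 ≤ K * ∫ x in P.a..P.b, w x ^ 2 := by
  obtain ⟨K, hK0, hK⟩ := R.exists_coercive
  obtain ⟨M₁, hM₁0, hM₁⟩ := R.exists_bound R.inv_β_cont
  obtain ⟨M₂, hM₂0, hM₂⟩ := R.exists_bound R.κ_cont
  obtain ⟨M₃, hM₃0, hM₃⟩ := R.exists_bound R.lam_cont
  set L := P.b - P.a with hLdef
  have hL : 0 < L := sub_pos.2 R.lt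
  have hβ := R.β₀_pos
  set K₁ := K * (L * K) with hK₁
  set K₂ := 3 * (M₃ ^ 2 * (L * K₁) + M₁ ^ 2 + M₂ ^ 2 * (L * K / R.β₀)) with hK₂
  set K₃ := (2 * (L * K / R.β₀) + 2 * L * L * K₂) / L with hK₃
  have hK₁0 : 0 < K₁ := by positivity
  have hK₂0 : 0 ≤ K₂ := by positivity
  have hK₃0 : 0 ≤ K₃ := by positivity
  refine ⟨K₁ + K₂ + K₃, by positivity, fun w hw => ?_⟩
  obtain ⟨z, y, hz, hy, hl, hr, hdual⟩ := R.exists_dual_solution hw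
  set N := ∫ x in P.a..P.b, w x ^ 2 with hN
  have hN0 : 0 ≤ N := intervalIntegral.integral_nonneg R.le fun x _ => sq_nonneg _
  have hzc := hz.continuousOn R.le
  have hβd : H1Pair P.a P.b (fun x => (R.β x)⁻¹) fun x => -R.ρ x / R.β x ^ 2 :=
    R.β_pair.inv R.le (fun x hx => (R.β_pos hx).ne') R.ρ_cont
      fun x hx => R.β_pair.hasDerivAt_of_continuousOn R.ρ_cont hx
  have hz' := H1Pair.mul R.le hβd hy
  have hzc' := hz'.continuousOn R.le
  have iw : IntervalIntegrable (fun x => w x ^ 2) volume P.a P.b :=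
    (hw.pow 2).intervalIntegrable_of_Icc R.le
  have iz : IntervalIntegrable (fun x => z x ^ 2) volume P.a P.b :=
    (hzc.pow 2).intervalIntegrable_of_Icc R.le
  have hform := hdual z _ hz hl hr
  have hzK := hK z _ hz hl hr
  -- Young's inequality for the integral of `z w`, with weights chosen so that coercivity turns the
  -- `z` part into `P.form z z / 2`, which is absorbed on the left.
  have hS : P.form z z ≤ L * K * N := by
    have h1 : ∫ x in P.a..P.b, z x * w x
        ≤ ∫ x in P.a..P.b, (1 / (2 * (L * K)) * z x ^ 2 + L * K / 2 * w x ^ 2) := by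
      refine intervalIntegral.integral_mono_on R.le
        ((hzc.mul hw).intervalIntegrable_of_Icc R.le) ((iz.const_mul _).add (iw.const_mul _))
        fun x _ => ?_
      have hLK : 0 < L * K := by positivity
      have : 0 ≤ (z x - L * K * w x) ^ 2 / (2 * (L * K)) := by positivity
      have e : (z x - L * K * w x) ^ 2 / (2 * (L * K))
          = 1 / (2 * (L * K)) * z x ^ 2 + L * K / 2 * w x ^ 2 - z x * w x := by
        field_simp
        ring
      linarith
    rw [intervalIntegral.integral_add (iz.const_mul _) (iw.const_mul _),
      intervalIntegral.integral_const_mul, intervalIntegral.integral_const_mul, ← hform,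
      ← hN] at h1
    have h2 := integral_sq_le_of_sq_le R.le hzc hzK
    have h3 : 1 / (2 * (L * K)) * ∫ x in P.a..P.b, z x ^ 2
        ≤ 1 / (2 * (L * K)) * (L * (K * P.form z z)) :=
      mul_le_mul_of_nonneg_left h2 (by positivity)
    have e : 1 / (2 * (L * K)) * (L * (K * P.form z z)) = P.form z z / 2 := by
      field_simp
    linarith
  have hz2 : ∀ x ∈ Icc P.a P.b, z x ^ 2 ≤ K₁ * N := fun x hx => by
    have := mul_le_mul_of_nonneg_left hS hK0.le
    calc z x ^ 2 ≤ K * P.form z z := hzK x hx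
      _ ≤ K * (L * K * N) := this
      _ = K₁ * N := by rw [hK₁]; ring
  have hz'2 : ∫ x in P.a..P.b, ((R.β x)⁻¹ * y x) ^ 2 ≤ L * K / R.β₀ * N := by
    have := R.integral_deriv_sq_le hz.rep
    rw [div_mul_eq_mul_div, le_div_iff₀ hβ]
    linarith
  have hzz := integral_sq_le_of_sq_le R.le hzc hz2
  have iz' : IntervalIntegrable (fun x => ((R.β x)⁻¹ * y x) ^ 2) volume P.a P.b :=
    (hzc'.pow 2).intervalIntegrable_of_Icc R.le
  -- The equation expresses `z''` as `lam z - w / β - κ z'`.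
  have hz'' : ∫ x in P.a..P.b, (-R.ρ x / R.β x ^ 2 * y x + (R.β x)⁻¹ * (R.q x * z x - w x)) ^ 2
      ≤ K₂ * N := by
    have h1 := intervalIntegral.integral_mono_on R.le (memLp_sq_intervalIntegrable R.le hz'.memLp)
      ((((iz.const_mul (M₃ ^ 2)).add (iw.const_mul (M₁ ^ 2))).add
        (iz'.const_mul (M₂ ^ 2))).const_mul 3) fun x hx => by
      have e : -R.ρ x / R.β x ^ 2 * y x + (R.β x)⁻¹ * (R.q x * z x - w x)
          = R.lam x * z x - (R.β x)⁻¹ * w x - R.κ x * ((R.β x)⁻¹ * y x) := by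
        have := (R.β_pos hx).ne'
        rw [R.lam_eq, R.κ_eq]
        field_simp
        ring
      have b1 := sq_le_of_abs_le (t := z x) (hM₃ x hx)
      have b2 := sq_le_of_abs_le (t := w x) (hM₁ x hx)
      have b3 := sq_le_of_abs_le (t := (R.β x)⁻¹ * y x) (hM₂ x hx)
      rw [e]
      change _ ≤ 3 * (M₃ ^ 2 * z x ^ 2 + M₁ ^ 2 * w x ^ 2 + M₂ ^ 2 * ((R.β x)⁻¹ * y x) ^ 2)
      generalize R.lam x * z x = A at *
      generalize (R.β x)⁻¹ * w x = B at *
      generalize R.κ x * ((R.β x)⁻¹ * y x) = C at *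
      nlinarith [sq_nonneg (A + B), sq_nonneg (A + C), sq_nonneg (B - C)]
    refine h1.trans ?_
    rw [intervalIntegral.integral_const_mul, intervalIntegral.integral_add
      ((iz.const_mul _).add (iw.const_mul _)) (iz'.const_mul _),
      intervalIntegral.integral_add (iz.const_mul _) (iw.const_mul _),
      intervalIntegral.integral_const_mul, intervalIntegral.integral_const_mul,
      intervalIntegral.integral_const_mul, ← hN, hK₂]
    have c1 := mul_le_mul_of_nonneg_left hzz (sq_nonneg M₃)
    have c2 := mul_le_mul_of_nonneg_left hz'2 (sq_nonneg M₂)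
    linarith
  -- The Sobolev inequality with weight `1`, applied to `z'`.
  have hz's : ∀ x ∈ Icc P.a P.b, ((R.β x)⁻¹ * y x) ^ 2 ≤ K₃ * N := fun x hx => by
    have h1 := hz'.weighted_sq_le R.le (continuousOn_const (c := (1 : ℝ))) (fun _ _ => zero_le_one)
      hx
    simp only [one_mul, intervalIntegral.integral_const, smul_eq_mul, mul_one] at h1
    have c1 := mul_le_mul_of_nonneg_left hz'' (show 0 ≤ 2 * L * L by positivity)
    have e : K₃ * N = (2 * (L * K / R.β₀ * N) + 2 * L * L * (K₂ * N)) / L := by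
      rw [hK₃]; field_simp
    rw [e, le_div_iff₀ hL]
    linarith
  have m1 : K₁ * N ≤ (K₁ + K₂ + K₃) * N := mul_le_mul_of_nonneg_right (by linarith) hN0
  have m2 : K₂ * N ≤ (K₁ + K₂ + K₃) * N := mul_le_mul_of_nonneg_right (by linarith) hN0
  have m3 : K₃ * N ≤ (K₁ + K₂ + K₃) * N := mul_le_mul_of_nonneg_right (by linarith) hN0
  exact ⟨z, _, _, hz, hz', hl, hr, hdual, fun x hx => (hz2 x hx).trans m1,
    fun x hx => (hz's x hx).trans m3, hz''.trans m2⟩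

end RegularData

/-! ## Piecewise linear functions and bubbles on one element -/

/-- The slope of the affine function with values `A` at `s` and `B` at `t`. -/
noncomputable def affSlope (s t A B : ℝ) : ℝ := (B - A) / (t - s)

/-- The affine function with values `A` at `s` and `B` at `t`. -/
noncomputable def aff (s t A B y : ℝ) : ℝ := A + affSlope s t A B * (y - s)

/-- The quadratic polynomial vanishing at `s` and `t`. -/
def quad (s t y : ℝ) : ℝ := (y - s) * (y - t)

theorem aff_left (s t A B : ℝ) : aff s t A B s = A := by simp [aff]

theorem aff_right {s t : ℝ} (h : s < t) (A B : ℝ) : aff s t A B t = B := by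
  have := (sub_pos.2 h).ne'
  simp only [aff, affSlope]
  field_simp
  ring

theorem quad_left (s t : ℝ) : quad s t s = 0 := by simp [quad]

theorem quad_right (s t : ℝ) : quad s t t = 0 := by simp [quad]

theorem hasDerivAt_aff (s t A B y : ℝ) : HasDerivAt (aff s t A B) (affSlope s t A B) y := by
  have h := (((hasDerivAt_id y).sub_const s).const_mul (affSlope s t A B)).const_add A
  rw [mul_one] at h
  exact h

theorem hasDerivAt_quad (s t y : ℝ) : HasDerivAt (quad s t) (2 * y - s - t) y := by
  have h := ((hasDerivAt_id y).sub_const s).mul ((hasDerivAt_id y).sub_const t)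
  have e : 1 * (id y - t) + (id y - s) * 1 = 2 * y - s - t := by simp only [id]; ring
  exact e ▸ h

theorem aff_pair {s t : ℝ} (h : s ≤ t) (A B : ℝ) :
    H1Pair s t (aff s t A B) fun _ => affSlope s t A B :=
  H1Pair.of_contDeriv h (fun y _ => (hasDerivAt_aff s t A B y).continuousAt.continuousWithinAt)
    continuousOn_const fun y _ => hasDerivAt_aff s t A B y

theorem quad_pair {s t : ℝ} (h : s ≤ t) : H1Pair s t (quad s t) fun y => 2 * y - s - t :=
  H1Pair.of_contDeriv h (fun y _ => (hasDerivAt_quad s t y).continuousAt.continuousWithinAt)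
    (by fun_prop) fun y _ => hasDerivAt_quad s t y

theorem abs_quad_le {s t y : ℝ} (hy : y ∈ Icc s t) : |quad s t y| ≤ (t - s) ^ 2 := by
  have h1 : 0 ≤ y - s := sub_nonneg.2 hy.1
  have h2 : 0 ≤ t - y := sub_nonneg.2 hy.2
  rw [abs_le, quad]
  constructor <;> nlinarith [mul_nonneg h1 h2]

theorem abs_quad_deriv_le {s t y : ℝ} (hy : y ∈ Icc s t) : |2 * y - s - t| ≤ t - s := by
  rw [abs_le]
  constructor <;> linarith [hy.1, hy.2]

theorem abs_aff_le {s t A B M y : ℝ} (hst : s < t) (hA : |A| ≤ M) (hB : |B| ≤ M)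
    (hy : y ∈ Icc s t) : |aff s t A B y| ≤ M := by
  have h := sub_pos.2 hst
  have e : aff s t A B y = ((t - y) * A + (y - s) * B) / (t - s) := by
    simp only [aff, affSlope]
    field_simp
    ring
  have h1 : 0 ≤ y - s := sub_nonneg.2 hy.1
  have h2 : 0 ≤ t - y := sub_nonneg.2 hy.2
  rw [abs_le] at hA hB
  rw [e, abs_le, le_div_iff₀ h, div_le_iff₀ h]
  constructor <;> nlinarith

/-- The modified finite element function on one element. -/
noncomputable def elem (κ lam φ : ℝ → ℝ) (s t A B y : ℝ) : ℝ :=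
  aff s t A B y + 1 / 2 * (quad s t y * (lam y * aff s t A B y - κ y * affSlope s t A B - φ y))

theorem elem_pair {κ κ' lam lam' φ φ' : ℝ → ℝ} {s t : ℝ} (h : s ≤ t) (hκ : H1Pair s t κ κ')
    (hlam : H1Pair s t lam lam') (hφ : H1Pair s t φ φ') (A B : ℝ) :
    H1Pair s t (elem κ lam φ s t A B) fun y => affSlope s t A B
      + 1 / 2 * ((2 * y - s - t) * (lam y * aff s t A B y - κ y * affSlope s t A B - φ y)
        + quad s t y * (lam' y * aff s t A B y + lam y * affSlope s t A B
          - κ' y * affSlope s t A B - φ' y)) := by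
  have h1 := (aff_pair h A B).add ((H1Pair.mul h (quad_pair h)
    (((H1Pair.mul h hlam (aff_pair h A B)).sub (hκ.const_mul (affSlope s t A B))).sub
      hφ)).const_mul (1 / 2))
  refine h1.congr h (fun y _ => ?_) (Filter.Eventually.of_forall fun y => ?_)
  · simp only [elem]; ring
  · simp only; ring

/-! ## Interpolation error on one element -/

section Element

variable {κ κ' lam lam' φ φ' u u' u'' u''' : ℝ → ℝ} {s t L M : ℝ}

theorem integral_sub_affSlope (hst : s < t) (hu : H1Pair s t u u') :
    ∫ y in s..t, (u' y - affSlope s t (u s) (u t)) = 0 := by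
  rw [intervalIntegral.integral_sub (hu.intervalIntegrable hst.le) (by simp),
    hu.integral_deriv hst.le, intervalIntegral.integral_const, smul_eq_mul, affSlope,
    mul_div_cancel₀ _ (sub_pos.2 hst).ne', sub_self]

theorem abs_affSlope_le (hst : s < t) (hu : H1Pair s t u u') (hM : ∀ y ∈ Icc s t, |u' y| ≤ M) :
    |affSlope s t (u s) (u t)| ≤ M := by
  have h := intervalIntegral.norm_integral_le_of_norm_le_const (a := s) (b := t) (f := u') (C := M)
    fun y hy => hM y (by rw [uIoc_of_le hst.le] at hy; exact Ioc_subset_Icc_self hy)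
  rw [hu.integral_deriv hst.le, Real.norm_eq_abs, abs_of_pos (sub_pos.2 hst)] at h
  rw [affSlope, abs_div, abs_of_pos (sub_pos.2 hst), div_le_iff₀ (sub_pos.2 hst)]
  exact h

theorem abs_deriv_sub_affSlope_le (hst : s < t) (hu : H1Pair s t u u') (hu' : H1Pair s t u' u'')
    {y : ℝ} (hy : y ∈ Icc s t) :
    |u' y - affSlope s t (u s) (u t)| ≤ ∫ x in s..t, |u'' x| := by
  have h0 := integral_sub_affSlope hst hu
  have h1 := (hu'.sub (H1Pair.const hst.le (affSlope s t (u s) (u t)))).mul_abs_le hst.le hy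
  simp only [h0, abs_zero, zero_add, sub_zero] at h1
  exact le_of_mul_le_mul_left h1 (sub_pos.2 hst)

theorem integral_abs_le_of_abs_le (hst : s < t) (hu : IntervalIntegrable u volume s t)
    (hM : ∀ y ∈ Icc s t, |u y| ≤ M) : ∫ y in s..t, |u y| ≤ (t - s) * M := by
  have := intervalIntegral.integral_mono_on hst.le hu.abs
    (intervalIntegrable_const (μ := volume) (c := M)) hM
  rwa [intervalIntegral.integral_const, smul_eq_mul] at this

theorem abs_sub_aff_le (hst : s < t) (hu : H1Pair s t u u') (hu' : H1Pair s t u' u'')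
    (hM : ∀ y ∈ Icc s t, |u'' y| ≤ M) {y : ℝ} (hy : y ∈ Icc s t) :
    |u y - aff s t (u s) (u t) y| ≤ (t - s) * ((t - s) * M) := by
  have hr := hu.sub (aff_pair hst.le (u s) (u t))
  have h1 := hr.abs_sub_le hst.le hy (left_mem_Icc.2 hst.le)
  simp only [aff_left, sub_self, sub_zero] at h1
  refine h1.trans (integral_abs_le_of_abs_le hst (hr.intervalIntegrable hst.le) fun x hx => ?_)
  exact (abs_deriv_sub_affSlope_le hst hu hu' hx).trans
    (integral_abs_le_of_abs_le hst (hu'.intervalIntegrable hst.le) hM)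

/-- The two `u''` terms in the derivative of the left expression cancel, leaving `-(2 y - s - t)
u''' / 2`. Integration by parts turns its integral into half that of `quad * u'''`. The bound by
mean and variation then takes half of the result from each. -/
theorem abs_deriv_sub_quadratic_le (hst : s < t) (hu : H1Pair s t u u') (hu' : H1Pair s t u' u'')
    (hu'' : H1Pair s t u'' u''') {y : ℝ} (hy : y ∈ Icc s t) :
    |u' y - affSlope s t (u s) (u t) - 1 / 2 * ((2 * y - s - t) * u'' y)|
      ≤ (t - s) * ∫ x in s..t, |u''' x| := by
  set J := ∫ x in s..t, |u''' x|
  have hpos := sub_pos.2 hst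
  have h3 := (hu''.intervalIntegrable hst.le).abs
  have hlin : H1Pair s t (fun y => 2 * y - s - t) fun _ => 2 :=
    H1Pair.of_contDeriv hst.le (by fun_prop) continuousOn_const fun y _ => by
      simpa using (((hasDerivAt_id y).const_mul 2).sub_const s).sub_const t
  have hg : H1Pair s t (fun y => u' y - affSlope s t (u s) (u t)
      - 1 / 2 * ((2 * y - s - t) * u'' y)) fun y => -(1 / 2) * ((2 * y - s - t) * u''' y) :=
    ((hu'.sub (H1Pair.const hst.le (affSlope s t (u s) (u t)))).sub
      ((H1Pair.mul hst.le hlin hu'').const_mul (1 / 2))).congr hst.le (fun _ _ => rfl)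
      (Filter.Eventually.of_forall fun y => by simp only; ring)
  have i1 := memLp_mul_intervalIntegrable hst.le (hlin.continuousOn hst.le).memLp_Ioo
    (hu''.continuousOn hst.le).memLp_Ioo
  have i2 := memLp_mul_intervalIntegrable hst.le ((quad_pair hst.le).continuousOn hst.le).memLp_Ioo
    hu''.memLp
  have hb := H1Pair.integral_mul hst.le (quad_pair hst.le) hu''
  rw [quad_left, quad_right, intervalIntegral.integral_add i1 i2] at hb
  have hI : ∫ y in s..t, (u' y - affSlope s t (u s) (u t) - 1 / 2 * ((2 * y - s - t) * u'' y))
      = 1 / 2 * ∫ y in s..t, quad s t y * u''' y := by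
    have i0 : IntervalIntegrable (fun y => u' y - affSlope s t (u s) (u t)) volume s t :=
      ((hu'.continuousOn hst.le).sub continuousOn_const).intervalIntegrable_of_Icc hst.le
    rw [intervalIntegral.integral_sub i0 (i1.const_mul _),
      integral_sub_affSlope hst hu, intervalIntegral.integral_const_mul]
    linarith
  have hq : |∫ y in s..t, quad s t y * u''' y| ≤ (t - s) ^ 2 * J := by
    rw [← intervalIntegral.integral_const_mul]
    refine (intervalIntegral.abs_integral_le_integral_abs hst.le).trans
      (intervalIntegral.integral_mono_on hst.le i2.abs (h3.const_mul _) fun x hx => ?_)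
    rw [abs_mul]
    exact mul_le_mul_of_nonneg_right (abs_quad_le hx) (abs_nonneg _)
  have hd : ∫ y in s..t, |-(1 / 2) * ((2 * y - s - t) * u''' y)| ≤ (t - s) / 2 * J := by
    rw [← intervalIntegral.integral_const_mul]
    refine intervalIntegral.integral_mono_on hst.le (hg.intervalIntegrable hst.le).abs
      (h3.const_mul _) fun x hx => ?_
    rw [abs_mul, abs_mul, abs_neg, abs_of_pos (by norm_num : (0 : ℝ) < 1 / 2)]
    have := mul_le_mul_of_nonneg_right (abs_quad_deriv_le hx) (abs_nonneg (u''' x))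
    linarith
  have key := hg.mul_abs_le hst.le hy
  rw [hI, abs_mul, abs_of_pos (by norm_num : (0 : ℝ) < 1 / 2)] at key
  refine le_of_mul_le_mul_left (key.trans ?_) hpos
  have := mul_le_mul_of_nonneg_left hd hpos.le
  nlinarith

theorem sq_le_three_mul {A B C X Y Z : ℝ} (hA : |A| ≤ X) (hB : |B| ≤ Y) (hC : |C| ≤ Z) :
    (A - B - C) ^ 2 ≤ 3 * (X ^ 2 + Y ^ 2 + Z ^ 2) := by
  have h1 := sq_le_sq' (by linarith [neg_abs_le A]) ((le_abs_self A).trans hA)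
  have h2 := sq_le_sq' (by linarith [neg_abs_le B]) ((le_abs_self B).trans hB)
  have h3 := sq_le_sq' (by linarith [neg_abs_le C]) ((le_abs_self C).trans hC)
  nlinarith [sq_nonneg (A + B), sq_nonneg (A + C), sq_nonneg (B - C)]

theorem memLp_abs_affine (hlam : MemLp lam' 2 (volume.restrict (Ioo s t)))
    (hκ : MemLp κ' 2 (volume.restrict (Ioo s t))) (hφ : MemLp φ' 2 (volume.restrict (Ioo s t)))
    (c d : ℝ) : MemLp (fun y => |lam' y| * c + d + |κ' y| * c + |φ' y|) 2
      (volume.restrict (Ioo s t)) := by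
  have h1 : MemLp (fun y => |lam' y| * c) 2 (volume.restrict (Ioo s t)) := hlam.norm.mul_const c
  have h2 : MemLp (fun y => |κ' y| * c) 2 (volume.restrict (Ioo s t)) := hκ.norm.mul_const c
  have h3 : MemLp (fun y => |φ' y|) 2 (volume.restrict (Ioo s t)) := hφ.norm
  exact ((h1.add (memLp_const d)).add h2).add h3

/-- The derivative of the error of the modified interpolant of a solution of the differential
equation is of second order on every element. -/
theorem integral_elem_error_sq_le (hst : s < t) (hL : t - s ≤ L)
    (hκ : H1Pair s t κ κ') (hlam : H1Pair s t lam lam') (hφ : H1Pair s t φ φ')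
    (hu : H1Pair s t u u') (hu' : H1Pair s t u' u'') (hu'' : H1Pair s t u'' u''')
    (heq : ∀ y ∈ Icc s t, u'' y = lam y * u y - κ y * u' y - φ y)
    (Mκ : ∀ y ∈ Icc s t, |κ y| ≤ M) (Mlam : ∀ y ∈ Icc s t, |lam y| ≤ M)
    (Mu : ∀ y ∈ Icc s t, |u y| ≤ M) (Mu' : ∀ y ∈ Icc s t, |u' y| ≤ M)
    (Mu'' : ∀ y ∈ Icc s t, |u'' y| ≤ M) {e' : ℝ → ℝ}
    (he : H1Pair s t (fun y => u y - elem κ lam φ s t (u s) (u t) y) e') :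
    ∫ y in s..t, e' y ^ 2 ≤ (t - s) ^ 4 * ∫ y in s..t, 3 * (u''' y ^ 2 + (M ^ 2 * (L + 1)) ^ 2
      + (|lam' y| * M + M ^ 2 + |κ' y| * M + |φ' y|) ^ 2) := by
  have hle := hst.le
  have hpos := sub_pos.2 hst
  set h := t - s
  have hs := left_mem_Icc.2 hle
  have ht := right_mem_Icc.2 hle
  have hM : 0 ≤ M := (abs_nonneg _).trans (Mu s hs)
  set S := affSlope s t (u s) (u t) with hS
  have hSM : |S| ≤ M := abs_affSlope_le hst hu Mu'
  set J := ∫ x in s..t, |u''' x| with hJ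
  have hJ2 : J ^ 2 ≤ h * ∫ y in s..t, u''' y ^ 2 := sq_integral_abs_le hle hu''.memLp
  set ψ := fun y => |lam' y| * M + M ^ 2 + |κ' y| * M + |φ' y| with hψ
  have i3 := memLp_sq_intervalIntegrable hle hu''.memLp
  have iψ := memLp_sq_intervalIntegrable hle
    (memLp_abs_affine hlam.memLp hκ.memLp hφ.memLp M (M ^ 2))
  have hee := (he.ae_unique (hu.sub (elem_pair hle hκ hlam hφ (u s) (u t))))
  rw [Filter.EventuallyEq, ae_restrict_iff' measurableSet_Ioo] at hee
  have hbound : ∀ᵐ y, y ∈ Ioo s t → e' y ^ 2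
      ≤ 3 * ((h * J) ^ 2 + (h * (M ^ 2 * (L + 1) * h)) ^ 2 + (h ^ 2 * ψ y) ^ 2) := by
    filter_upwards [hee] with y hy hy'
    have hyc := Ioo_subset_Icc_self hy'
    set ℓ := aff s t (u s) (u t) y with hℓ
    have hℓM : |ℓ| ≤ M := abs_aff_le hst (Mu s hs) (Mu t ht) hyc
    -- The error derivative is a difference of three terms: the remainder of quadratic
    -- interpolation, the effect of putting the linear interpolant instead of `u` into the right
    -- side of the equation, and the part of the bubble correction in which the derivative falls on
    -- the other factor. Only `b2` gains its second power of `h` from the interpolation errors of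
    -- `u` and `u'`.
    have b1 := abs_deriv_sub_quadratic_le hst hu hu' hu'' hyc
    have b2 : |1 / 2 * ((2 * y - s - t) * (κ y * (u' y - S) - lam y * (u y - ℓ)))|
        ≤ h * (M ^ 2 * (L + 1) * h) := by
      have c1 : |u' y - S| ≤ h * M := (abs_deriv_sub_affSlope_le hst hu hu' hyc).trans
        (integral_abs_le_of_abs_le hst (hu'.intervalIntegrable hle) Mu'')
      have c2 : |u y - ℓ| ≤ h * (h * M) := abs_sub_aff_le hst hu hu' Mu'' hyc
      have c3 : |κ y * (u' y - S) - lam y * (u y - ℓ)| ≤ M ^ 2 * (L + 1) * h := by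
        refine (abs_sub _ _).trans ?_
        rw [abs_mul, abs_mul]
        have d1 := mul_le_mul (Mκ y hyc) c1 (abs_nonneg _) hM
        have d2 := mul_le_mul (Mlam y hyc) c2 (abs_nonneg _) hM
        have d3 : h * (h * M) ≤ L * (h * M) := mul_le_mul_of_nonneg_right hL (by positivity)
        have d4 := mul_le_mul_of_nonneg_left d3 hM
        linarith
      rw [abs_mul, abs_mul, abs_of_pos (by norm_num : (0 : ℝ) < 1 / 2)]
      have d := mul_le_mul (abs_quad_deriv_le hyc) c3 (abs_nonneg _) hpos.le
      have : 0 ≤ |2 * y - s - t| * |κ y * (u' y - S) - lam y * (u y - ℓ)| := by positivity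
      linarith
    have b3 : |1 / 2 * (quad s t y * (lam' y * ℓ + lam y * S - κ' y * S - φ' y))|
        ≤ h ^ 2 * ψ y := by
      have c3 : |lam' y * ℓ + lam y * S - κ' y * S - φ' y| ≤ ψ y := by
        have d1 : |lam' y * ℓ| ≤ |lam' y| * M := by
          rw [abs_mul]; exact mul_le_mul_of_nonneg_left hℓM (abs_nonneg _)
        have d2 : |lam y * S| ≤ M * M := by
          rw [abs_mul]; exact mul_le_mul (Mlam y hyc) hSM (abs_nonneg _) hM
        have d3 : |κ' y * S| ≤ |κ' y| * M := by
          rw [abs_mul]; exact mul_le_mul_of_nonneg_left hSM (abs_nonneg _)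
        have f1 := abs_sub (lam' y * ℓ + lam y * S - κ' y * S) (φ' y)
        have f2 := abs_sub (lam' y * ℓ + lam y * S) (κ' y * S)
        have f3 := abs_add_le (lam' y * ℓ) (lam y * S)
        simp only [hψ]
        linarith
      rw [abs_mul, abs_mul, abs_of_pos (by norm_num : (0 : ℝ) < 1 / 2)]
      have d := mul_le_mul (abs_quad_le hyc) c3 (abs_nonneg _) (sq_nonneg _)
      have : 0 ≤ |quad s t y| * |lam' y * ℓ + lam y * S - κ' y * S - φ' y| := by positivity
      linarith
    rw [hy hy']
    refine le_trans (le_of_eq ?_) (sq_le_three_mul b1 b2 b3)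
    congr 1
    rw [heq y hyc]
    ring
  have hmono : ∫ y in s..t, e' y ^ 2 ≤ ∫ y in s..t,
      (3 * (h * J) ^ 2 + h ^ 4 * (3 * ((M ^ 2 * (L + 1)) ^ 2 + ψ y ^ 2))) := by
    refine intervalIntegral.integral_mono_ae_restrict hle (memLp_sq_intervalIntegrable hle he.memLp)
      ((intervalIntegrable_const).add
        (((intervalIntegrable_const.add iψ).const_mul 3).const_mul (h ^ 4))) ?_
    rw [← Measure.restrict_congr_set (Ioo_ae_eq_Icc (μ := volume)), Filter.EventuallyLE,
      ae_restrict_iff' measurableSet_Ioo]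
    filter_upwards [hbound] with y hy hy'
    refine (hy hy').trans (le_of_eq ?_)
    ring
  refine hmono.trans ?_
  rw [intervalIntegral.integral_add intervalIntegrable_const
      (((intervalIntegrable_const.add iψ).const_mul 3).const_mul (h ^ 4)),
    intervalIntegral.integral_const, smul_eq_mul, intervalIntegral.integral_const_mul]
  have e1 : ∀ y, 3 * (u''' y ^ 2 + (M ^ 2 * (L + 1)) ^ 2 + ψ y ^ 2)
      = 3 * u''' y ^ 2 + 3 * ((M ^ 2 * (L + 1)) ^ 2 + ψ y ^ 2) := fun y => by ring
  change _ ≤ h ^ 4 * ∫ y in s..t, 3 * (u''' y ^ 2 + (M ^ 2 * (L + 1)) ^ 2 + ψ y ^ 2)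
  simp_rw [e1]
  rw [intervalIntegral.integral_add (i3.const_mul 3) ((intervalIntegrable_const.add iψ).const_mul 3),
    intervalIntegral.integral_const_mul (3 : ℝ) (fun y => u''' y ^ 2)]
  -- Integrating the constant over the element gives `h ^ 3`; the Cauchy–Schwarz bound for `J ^ 2`
  -- supplies the fourth power.
  have : h * (3 * (h * J) ^ 2) ≤ h ^ 4 * (3 * ∫ y in s..t, u''' y ^ 2) := by
    have := mul_le_mul_of_nonneg_left hJ2 (show 0 ≤ 3 * h ^ 3 by positivity)
    linarith
  linarith

/-- The derivative of the error of the modified interpolant of an arbitrary function is of first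
order on every element. -/
theorem integral_elem_error_sq_le_of_bound {D : ℝ} (hst : s < t) (hL : t - s ≤ L)
    (hκ : H1Pair s t κ κ') (hlam : H1Pair s t lam lam')
    (hu : H1Pair s t u u') (hu' : H1Pair s t u' u'')
    (Mκ : ∀ y ∈ Icc s t, |κ y| ≤ M) (Mlam : ∀ y ∈ Icc s t, |lam y| ≤ M)
    (Du : ∀ y ∈ Icc s t, |u y| ≤ D) (Du' : ∀ y ∈ Icc s t, |u' y| ≤ D) {e' : ℝ → ℝ}
    (he : H1Pair s t (fun y => u y - elem κ lam (fun _ => 0) s t (u s) (u t) y) e') :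
    ∫ y in s..t, e' y ^ 2 ≤ (t - s) ^ 2 * ∫ y in s..t, 3 * (u'' y ^ 2
      + D ^ 2 * (M ^ 2 + L ^ 2 * (|lam' y| + M + |κ' y|) ^ 2)) := by
  have hle := hst.le
  have hpos := sub_pos.2 hst
  set h := t - s
  have hs := left_mem_Icc.2 hle
  have ht := right_mem_Icc.2 hle
  have hM : 0 ≤ M := (abs_nonneg _).trans (Mκ s hs)
  set S := affSlope s t (u s) (u t) with hS
  have hSD : |S| ≤ D := abs_affSlope_le hst hu Du'
  set J := ∫ x in s..t, |u'' x| with hJ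
  have hJ2 : J ^ 2 ≤ h * ∫ y in s..t, u'' y ^ 2 := sq_integral_abs_le hle hu'.memLp
  set χ := fun y => |lam' y| + M + |κ' y| with hχ
  have i2 := memLp_sq_intervalIntegrable hle hu'.memLp
  have mχ : MemLp χ 2 (volume.restrict (Ioo s t)) := by
    have h1 : MemLp (fun y => |lam' y|) 2 (volume.restrict (Ioo s t)) := hlam.memLp.norm
    have h2 : MemLp (fun y => |κ' y|) 2 (volume.restrict (Ioo s t)) := hκ.memLp.norm
    exact (h1.add (memLp_const M)).add h2
  have iχ := memLp_sq_intervalIntegrable hle mχ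
  have hee := (he.ae_unique
    (hu.sub (elem_pair hle hκ hlam (H1Pair.const hle 0) (u s) (u t))))
  rw [Filter.EventuallyEq, ae_restrict_iff' measurableSet_Ioo] at hee
  have hbound : ∀ᵐ y, y ∈ Ioo s t → e' y ^ 2
      ≤ 3 * (J ^ 2 + (h * (M * D)) ^ 2 + (h * L * (D * χ y)) ^ 2) := by
    filter_upwards [hee] with y hy hy'
    have hyc := Ioo_subset_Icc_self hy'
    set ℓ := aff s t (u s) (u t) y with hℓ
    have hℓD : |ℓ| ≤ D := abs_aff_le hst (Du s hs) (Du t ht) hyc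
    -- Without a differential equation nothing cancels against the corrections; they are bounded by
    -- their size. In `b3` one of the two factors `h` is given up for `L`, and every bound remains
    -- linear in `D` or `J`.
    have b1 : |u' y - S| ≤ J := abs_deriv_sub_affSlope_le hst hu hu' hyc
    have b2 : |1 / 2 * ((2 * y - s - t) * (lam y * ℓ - κ y * S))| ≤ h * (M * D) := by
      have c3 : |lam y * ℓ - κ y * S| ≤ 2 * (M * D) := by
        refine (abs_sub _ _).trans ?_
        rw [abs_mul, abs_mul]
        have d1 := mul_le_mul (Mκ y hyc) hSD (abs_nonneg _) hM
        have d2 := mul_le_mul (Mlam y hyc) hℓD (abs_nonneg _) hM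
        linarith
      rw [abs_mul, abs_mul, abs_of_pos (by norm_num : (0 : ℝ) < 1 / 2)]
      have d := mul_le_mul (abs_quad_deriv_le hyc) c3 (abs_nonneg _) hpos.le
      linarith
    have b3 : |1 / 2 * (quad s t y * (lam' y * ℓ + lam y * S - κ' y * S))|
        ≤ h * L * (D * χ y) := by
      have c3 : |lam' y * ℓ + lam y * S - κ' y * S| ≤ D * χ y := by
        have d1 : |lam' y * ℓ| ≤ |lam' y| * D := by
          rw [abs_mul]; exact mul_le_mul_of_nonneg_left hℓD (abs_nonneg _)
        have d2 : |lam y * S| ≤ M * D := by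
          rw [abs_mul]; exact mul_le_mul (Mlam y hyc) hSD (abs_nonneg _) hM
        have d3 : |κ' y * S| ≤ |κ' y| * D := by
          rw [abs_mul]; exact mul_le_mul_of_nonneg_left hSD (abs_nonneg _)
        have f2 := abs_sub (lam' y * ℓ + lam y * S) (κ' y * S)
        have f3 := abs_add_le (lam' y * ℓ) (lam y * S)
        simp only [hχ]
        linarith
      have c4 : |quad s t y| ≤ h * L := (abs_quad_le hyc).trans (by
        rw [pow_two]; exact mul_le_mul_of_nonneg_left hL hpos.le)
      rw [abs_mul, abs_mul, abs_of_pos (by norm_num : (0 : ℝ) < 1 / 2)]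
      have d := mul_le_mul c4 c3 (abs_nonneg _) ((abs_nonneg _).trans c4)
      have : 0 ≤ |quad s t y| * |lam' y * ℓ + lam y * S - κ' y * S| := by positivity
      linarith
    rw [hy hy']
    refine le_trans (le_of_eq ?_) (sq_le_three_mul b1 b2 b3)
    congr 1
    ring
  have hmono : ∫ y in s..t, e' y ^ 2 ≤ ∫ y in s..t,
      (3 * J ^ 2 + h ^ 2 * (3 * (D ^ 2 * (M ^ 2 + L ^ 2 * χ y ^ 2)))) := by
    refine intervalIntegral.integral_mono_ae_restrict hle (memLp_sq_intervalIntegrable hle he.memLp)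
      ((intervalIntegrable_const).add ((((intervalIntegrable_const.add
        (iχ.const_mul _)).const_mul _).const_mul 3).const_mul (h ^ 2))) ?_
    rw [← Measure.restrict_congr_set (Ioo_ae_eq_Icc (μ := volume)), Filter.EventuallyLE,
      ae_restrict_iff' measurableSet_Ioo]
    filter_upwards [hbound] with y hy hy'
    refine (hy hy').trans (le_of_eq ?_)
    ring
  refine hmono.trans ?_
  rw [intervalIntegral.integral_add intervalIntegrable_const ((((intervalIntegrable_const.add
        (iχ.const_mul _)).const_mul _).const_mul 3).const_mul (h ^ 2)),
    intervalIntegral.integral_const, smul_eq_mul, intervalIntegral.integral_const_mul]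
  have e1 : ∀ y, 3 * (u'' y ^ 2 + D ^ 2 * (M ^ 2 + L ^ 2 * χ y ^ 2))
      = 3 * u'' y ^ 2 + 3 * (D ^ 2 * (M ^ 2 + L ^ 2 * χ y ^ 2)) := fun y => by ring
  change _ ≤ h ^ 2 * ∫ y in s..t, 3 * (u'' y ^ 2 + D ^ 2 * (M ^ 2 + L ^ 2 * χ y ^ 2))
  simp_rw [e1]
  rw [intervalIntegral.integral_add (i2.const_mul 3) (((intervalIntegrable_const.add
      (iχ.const_mul _)).const_mul _).const_mul 3),
    intervalIntegral.integral_const_mul (3 : ℝ) (fun y => u'' y ^ 2)]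
  have : h * (3 * J ^ 2) ≤ h ^ 2 * (3 * ∫ y in s..t, u'' y ^ 2) := by
    have := mul_le_mul_of_nonneg_left hJ2 (show 0 ≤ 3 * h by positivity)
    linarith
  linarith

end Element

/-! ## Meshes -/

namespace IsMesh

variable {a b : ℝ} {n : ℕ} {x : ℕ → ℝ}

theorem lt_of_lt (h : IsMesh a b n x) {i j : ℕ} (hij : i < j) (hj : j ≤ n) : x i < x j := by
  induction j with
  | zero => omega
  | succ j ih =>
    rcases (Nat.lt_succ_iff.1 hij).eq_or_lt with rfl | hlt
    · exact h.2.2 i (by omega)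
    · exact (ih hlt (by omega)).trans (h.2.2 j (by omega))

theorem le_of_le (h : IsMesh a b n x) {i j : ℕ} (hij : i ≤ j) (hj : j ≤ n) : x i ≤ x j := by
  rcases hij.eq_or_lt with rfl | hlt
  · exact le_rfl
  · exact (h.lt_of_lt hlt hj).le

theorem left_le (h : IsMesh a b n x) {k : ℕ} (hk : k ≤ n) : a ≤ x k :=
  h.1 ▸ h.le_of_le (Nat.zero_le k) hk

theorem le_right (h : IsMesh a b n x) {k : ℕ} (hk : k ≤ n) : x k ≤ b :=
  h.2.1 ▸ h.le_of_le hk le_rfl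

theorem pos (h : IsMesh a b n x) (hab : a < b) : 0 < n := by
  rcases Nat.eq_zero_or_pos n with rfl | hn
  · exact absurd (h.1.symm.trans h.2.1) hab.ne
  · exact hn

theorem sub_le_meshSize {n : ℕ} {x : ℕ → ℝ} {k : ℕ} (hk : k < n) :
    x (k + 1) - x k ≤ meshSize n x :=
  le_ciSup (f := fun k : Fin n => x (k + 1) - x k) (Set.finite_range _).bddAbove ⟨k, hk⟩

theorem meshSize_pos (h : IsMesh a b n x) (hab : a < b) : 0 < meshSize n x :=
  (sub_pos.2 (h.2.2 0 (h.pos hab))).trans_le (sub_le_meshSize (h.pos hab))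

theorem hat_left (h : IsMesh a b n x) {k : ℕ} (hk : k < n) {t : ℝ}
    (ht : t ∈ Icc (x k) (x (k + 1))) : hat n x k t = (x (k + 1) - t) / (x (k + 1) - x k) := by
  have hne := (sub_pos.2 (h.2.2 k hk)).ne'
  -- At the node itself `hat` takes its first branch when `0 < k`; both formulas give `1` there.
  by_cases h1 : 0 < k ∧ x (k - 1) ≤ t ∧ t ≤ x k
  · have htk : t = x k := le_antisymm h1.2.2 ht.1
    have hlt := h.lt_of_lt (Nat.sub_lt h1.1 one_pos) hk.le
    rw [hat, if_pos h1, htk, div_self (sub_pos.2 hlt).ne', div_self hne]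
  · rw [hat, if_neg h1, if_pos ⟨hk, ht⟩]

theorem hat_right {n : ℕ} {x : ℕ → ℝ} {k : ℕ} {t : ℝ}
    (ht : t ∈ Icc (x k) (x (k + 1))) : hat n x (k + 1) t = (t - x k) / (x (k + 1) - x k) := by
  rw [hat, if_pos ⟨Nat.succ_pos k, by simpa using ht⟩]
  simp

theorem hat_eq_zero (h : IsMesh a b n x) {k i : ℕ} (hk : k < n) (hi : i ≤ n) (h1 : i ≠ k)
    (h2 : i ≠ k + 1) {t : ℝ} (ht : t ∈ Icc (x k) (x (k + 1))) : hat n x i t = 0 := by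
  rcases lt_or_gt_of_ne h1 with hik | hik
  · have hlt := (h.lt_of_lt hik hk.le).trans_le ht.1
    rw [hat, if_neg fun hh => not_lt.2 hh.2.2 hlt]
    split_ifs with hh
    · have : x (i + 1) = t := le_antisymm ((h.le_of_le hik hk.le).trans ht.1) hh.2.2
      rw [this, sub_self, zero_div]
    · rfl
  · have hle : k + 1 ≤ i - 1 := by omega
    have hlt := ht.2.trans_lt (h.lt_of_lt (show k + 1 < i by omega) hi)
    rw [hat]
    split_ifs with hh hh'
    · have : x (i - 1) = t := le_antisymm hh.2.1 (ht.2.trans (h.le_of_le hle (by omega)))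
      rw [this, sub_self, zero_div]
    · exact absurd hh'.2.1 (not_le.2 hlt)
    · rfl

theorem pl_eq (h : IsMesh a b n x) {k : ℕ} (hk : k < n) (c : Fin (n + 1) → ℝ) {t : ℝ}
    (ht : t ∈ Icc (x k) (x (k + 1))) :
    pl n x c t = aff (x k) (x (k + 1)) (c ⟨k, by omega⟩) (c ⟨k + 1, by omega⟩) t := by
  have hne := (sub_pos.2 (h.2.2 k hk)).ne'
  rw [pl, Finset.sum_eq_add_of_mem (⟨k, by omega⟩ : Fin (n + 1)) ⟨k + 1, by omega⟩
    (Finset.mem_univ _) (Finset.mem_univ _) (by simp) fun i _ hi => ?_]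
  · simp only
    rw [h.hat_left hk ht, hat_right ht, aff, affSlope]
    field_simp
    ring
  · rw [h.hat_eq_zero hk (Nat.lt_succ_iff.1 i.2) (fun e => hi.1 (Fin.ext e))
      (fun e => hi.2 (Fin.ext e)) ht, mul_zero]

theorem pl_hasDerivAt (h : IsMesh a b n x) {k : ℕ} (hk : k < n) (c : Fin (n + 1) → ℝ) {t : ℝ}
    (ht : t ∈ Ioo (x k) (x (k + 1))) :
    HasDerivAt (pl n x c)
      (affSlope (x k) (x (k + 1)) (c ⟨k, by omega⟩) (c ⟨k + 1, by omega⟩)) t := by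
  refine (hasDerivAt_aff _ _ _ _ t).congr_of_eventuallyEq ?_
  filter_upwards [Ioo_mem_nhds ht.1 ht.2] with y hy
  exact h.pl_eq hk c (Ioo_subset_Icc_self hy)

theorem exists_of_bubble_ne_zero {t : ℝ} (hb : bubble n x t ≠ 0) :
    ∃ k < n, t ∈ Ioo (x k) (x (k + 1)) := by
  obtain ⟨k, hk, hk'⟩ := Finset.exists_ne_zero_of_sum_ne_zero hb
  exact ⟨k, Finset.mem_range.1 hk, mem_of_indicator_ne_zero hk'⟩

theorem bubble_eq (h : IsMesh a b n x) {k : ℕ} (hk : k < n) {t : ℝ}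
    (ht : t ∈ Icc (x k) (x (k + 1))) : bubble n x t = quad (x k) (x (k + 1)) t := by
  rw [bubble, Finset.sum_eq_single_of_mem k (Finset.mem_range.2 hk) fun j hj hjk => ?_]
  · by_cases hm : t ∈ Ioo (x k) (x (k + 1))
    · rw [indicator_of_mem hm, quad]
    · rw [indicator_of_notMem hm]
      rcases ht.1.eq_or_lt with e | h1
      · rw [← e, quad_left]
      · rcases ht.2.eq_or_lt with e | h2
        · rw [e, quad_right]
        · exact absurd ⟨h1, h2⟩ hm
  · refine indicator_of_notMem (fun hm => ?_) _
    have hjn := Finset.mem_range.1 hj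
    rcases lt_or_gt_of_ne hjk with hlt | hlt
    · exact absurd (hm.2.trans_le ((h.le_of_le hlt hk.le).trans ht.1)) (lt_irrefl t)
    · exact absurd (hm.1.trans_le (ht.2.trans (h.le_of_le hlt hjn.le))) (lt_irrefl _)

theorem bubble_eq_zero_of_notMem (h : IsMesh a b n x) {t : ℝ} (ht : t ∉ Ioo a b) :
    bubble n x t = 0 := by
  by_contra hb
  obtain ⟨k, hk, hkt⟩ := exists_of_bubble_ne_zero hb
  exact ht ⟨(h.left_le hk.le).trans_lt hkt.1, hkt.2.trans_le (h.le_right hk)⟩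

theorem bubble_node (h : IsMesh a b n x) {k : ℕ} (hk : k ≤ n) :
    bubble n x (x k) = 0 := by
  rcases hk.lt_or_eq with hlt | rfl
  · rw [h.bubble_eq hlt (left_mem_Icc.2 (h.2.2 k hlt).le), quad_left]
  · rw [h.2.1, h.bubble_eq_zero_of_notMem right_notMem_Ioo]

theorem pl_node (h : IsMesh a b n x) (hab : a < b) (c : Fin (n + 1) → ℝ) (j : Fin (n + 1)) :
    pl n x c (x j) = c j := by
  rcases (Nat.lt_succ_iff.1 j.2).lt_or_eq with hlt | he
  · rw [h.pl_eq hlt c (left_mem_Icc.2 (h.2.2 j hlt).le), aff_left]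
  · have hn := h.pos hab
    have hk : n - 1 < n := by omega
    have e : n - 1 + 1 = j := by omega
    have hlt := h.2.2 (n - 1) hk
    have hm := right_mem_Icc.2 hlt.le
    have := h.pl_eq hk c hm
    rw [aff_right hlt] at this
    simp only [e] at this
    exact this

theorem h1Pair_of_elem (h : IsMesh a b n x) {u p : ℝ → ℝ}
    (hu : ∀ k < n, H1Pair (x k) (x (k + 1)) u p) : H1Pair a b u p := by
  have key : ∀ m ≤ n, H1Pair a (x m) u p := by
    intro m
    induction m with
    | zero =>
      intro _
      rw [h.1]
      refine H1Pair.of_integral le_rfl (by simp) fun y hy => ?_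
      rw [Icc_self, mem_singleton_iff] at hy
      simp [hy]
    | succ m ih =>
      intro hm
      exact H1Pair.glue (h.left_le (by omega)) (h.2.2 m (by omega)).le (ih (by omega))
        (hu m (by omega))
  exact h.2.1 ▸ key n le_rfl

theorem integral_le_of_elem (h : IsMesh a b n x) (hab : a ≤ b) {g Φ : ℝ → ℝ}
    (hg : IntervalIntegrable g volume a b) (hΦ : IntervalIntegrable Φ volume a b) {C : ℝ}
    (hle : ∀ k < n, ∫ y in x k..x (k + 1), g y ≤ C * ∫ y in x k..x (k + 1), Φ y) :
    ∫ y in a..b, g y ≤ C * ∫ y in a..b, Φ y := by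
  have hsub : ∀ {f : ℝ → ℝ}, IntervalIntegrable f volume a b → ∀ k < n,
      IntervalIntegrable f volume (x k) (x (k + 1)) := fun hf k hk => hf.mono_set (by
    rw [uIcc_of_le (h.2.2 k hk).le, uIcc_of_le hab]
    exact Icc_subset_Icc (h.left_le hk.le) (h.le_right hk))
  have e : ∀ {f : ℝ → ℝ}, IntervalIntegrable f volume a b →
      ∫ y in a..b, f y = ∑ k ∈ Finset.range n, ∫ y in x k..x (k + 1), f y := fun hf => by
    rw [intervalIntegral.sum_integral_adjacent_intervals (hsub hf), h.1, h.2.1]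
  rw [e hg, e hΦ, Finset.mul_sum]
  exact Finset.sum_le_sum fun k hk => hle k (Finset.mem_range.1 hk)

theorem bubble_pair (h : IsMesh a b n x) : H1Pair a b (bubble n x) (deriv (bubble n x)) := by
  refine h.h1Pair_of_elem fun k hk => ?_
  have hle := (h.2.2 k hk).le
  exact ((quad_pair hle).congr_left hle fun t ht => (h.bubble_eq hk ht).symm).deriv_pair hle

end IsMesh

/-! ## The modified finite element functions -/

namespace RegularData

variable {P : Problem} (R : RegularData P) {n : ℕ} {x : ℕ → ℝ}
include R

theorem deriv_β_eq {t : ℝ} (ht : t ∈ Ioo P.a P.b) : deriv P.β t = R.ρ t := by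
  refine HasDerivAt.deriv ?_
  refine (R.β_pair.hasDerivAt_of_continuousOn R.ρ_cont ht).congr_of_eventuallyEq ?_
  filter_upwards [Ioo_mem_nhds ht.1 ht.2] with y hy using R.β_eq y hy

/-- At a node `deriv` of the piecewise linear function or of `P.β` may be a meaningless default
value, but the factor `bubble` is zero there. Elsewhere on the element the data coincide with their
regular representatives. -/
theorem modify_pl_eq (h : IsMesh P.a P.b n x) {k : ℕ} (hk : k < n) (c : Fin (n + 1) → ℝ) {t : ℝ}
    (ht : t ∈ Icc (x k) (x (k + 1))) :
    P.modify n x (pl n x c) t = elem R.κ R.lam (fun _ => 0) (x k) (x (k + 1))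
      (c ⟨k, by omega⟩) (c ⟨k + 1, by omega⟩) t := by
  have hb := h.bubble_eq hk ht
  by_cases hm : t ∈ Ioo (x k) (x (k + 1))
  · have hm' : t ∈ Ioo P.a P.b :=
      ⟨(h.left_le hk.le).trans_lt hm.1, hm.2.trans_le (h.le_right hk)⟩
    rw [Problem.modify, (h.pl_hasDerivAt hk c hm).deriv, h.pl_eq hk c ht, hb, R.deriv_β_eq hm',
      R.β_eq t hm', R.q_eq t hm', elem, R.κ_eq, R.lam_eq]
    ring
  · have h0 : quad (x k) (x (k + 1)) t = 0 := by
      rcases ht.1.eq_or_lt with e | h1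
      · rw [← e, quad_left]
      · rcases ht.2.eq_or_lt with e | h2
        · rw [e, quad_right]
        · exact absurd ⟨h1, h2⟩ hm
    rw [Problem.modify, hb, h0, h.pl_eq hk c ht, elem, h0]
    ring

theorem modify_pair (h : IsMesh P.a P.b n x) (c : Fin (n + 1) → ℝ) :
    H1Pair P.a P.b (P.modify n x (pl n x c)) (deriv (P.modify n x (pl n x c))) := by
  refine h.h1Pair_of_elem fun k hk => ?_
  have hle := (h.2.2 k hk).le
  have h1 := h.left_le hk.le
  have h2 := h.le_right (k := k + 1) hk
  exact ((elem_pair hle (R.κ_pair.mono h1 hle h2) (R.lam_pair.mono h1 hle h2)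
    (H1Pair.const hle 0) _ _).congr_left hle
      fun t ht => (R.modify_pl_eq h hk c ht).symm).deriv_pair hle

/-- The representative of a modified finite element function. -/
noncomputable def smoothFun (n : ℕ) (x : ℕ → ℝ) (c : Fin (n + 1) → ℝ) (t : ℝ) : ℝ :=
  P.modify n x (pl n x c) t - 1 / 2 * (R.φ t * bubble n x t)

theorem smoothFun_eq (h : IsMesh P.a P.b n x) {k : ℕ} (hk : k < n) (c : Fin (n + 1) → ℝ) {t : ℝ}
    (ht : t ∈ Icc (x k) (x (k + 1))) :
    R.smoothFun n x c t = elem R.κ R.lam R.φ (x k) (x (k + 1))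
      (c ⟨k, by omega⟩) (c ⟨k + 1, by omega⟩) t := by
  rw [smoothFun, R.modify_pl_eq h hk c ht, h.bubble_eq hk ht, elem, elem]
  ring

theorem exists_smoothFun_pair (h : IsMesh P.a P.b n x) (c : Fin (n + 1) → ℝ) :
    ∃ p, H1Pair P.a P.b (R.smoothFun n x c) p :=
  ⟨_, (R.modify_pair h c).sub ((H1Pair.mul R.le R.φ_pair h.bubble_pair).const_mul (1 / 2))⟩

theorem newFun_ae_eq (n : ℕ) (x : ℕ → ℝ) (c : Fin (n + 1) → ℝ) :
    P.newFun n x c =ᵐ[volume.restrict (Ioo P.a P.b)] R.smoothFun n x c := by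
  filter_upwards [R.f_eq, ae_restrict_mem measurableSet_Ioo] with t h1 h2
  rw [Problem.newFun, smoothFun, h1, R.β_eq t h2, R.φ_eq]
  ring

theorem newFun_eq_of_bubble (c : Fin (n + 1) → ℝ) {t : ℝ} (ht : bubble n x t = 0) :
    P.newFun n x c t = pl n x c t ∧ R.smoothFun n x c t = pl n x c t ∧
      P.modify n x (pl n x c) t = pl n x c t := by
  refine ⟨?_, ?_, ?_⟩ <;> simp [Problem.newFun, smoothFun, Problem.modify, ht]

theorem node_values (h : IsMesh P.a P.b n x) (c : Fin (n + 1) → ℝ) (j : Fin (n + 1)) :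
    P.newFun n x c (x j) = c j ∧ R.smoothFun n x c (x j) = c j ∧
      P.modify n x (pl n x c) (x j) = c j := by
  have := R.newFun_eq_of_bubble c (h.bubble_node (Nat.lt_succ_iff.1 j.2))
  rwa [h.pl_node R.lt c j] at this

theorem left_values (h : IsMesh P.a P.b n x) (c : Fin (n + 1) → ℝ) :
    P.newFun n x c P.a = c 0 ∧ R.smoothFun n x c P.a = c 0 ∧
      P.modify n x (pl n x c) P.a = c 0 := by
  have := R.node_values h c 0
  rwa [Fin.val_zero, h.1] at this

theorem right_values (h : IsMesh P.a P.b n x) (c : Fin (n + 1) → ℝ) :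
    P.newFun n x c P.b = c (Fin.last n) ∧ R.smoothFun n x c P.b = c (Fin.last n) ∧
      P.modify n x (pl n x c) P.b = c (Fin.last n) := by
  have := R.node_values h c (Fin.last n)
  rwa [Fin.val_last, h.2.1] at this

/-- The given `f` is known only up to null sets, so `newFun` itself need not be continuous. Its
boundary values are still right, because the bubble that multiplies `f` vanishes at the endpoints.
-/
theorem newFun_rep (h : IsMesh P.a P.b n x) (c : Fin (n + 1) → ℝ) {p : ℝ → ℝ}
    (hp : H1Pair P.a P.b (R.smoothFun n x c) p) : H1Rep P.a P.b (P.newFun n x c) p :=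
  ⟨_, hp, R.newFun_ae_eq n x c,
    (R.left_values h c).1.trans (R.left_values h c).2.1.symm,
    (R.right_values h c).1.trans (R.right_values h c).2.1.symm⟩

omit R in
theorem pl_add (n : ℕ) (x : ℕ → ℝ) (c d : Fin (n + 1) → ℝ) :
    pl n x (c + d) = fun t => pl n x c t + pl n x d t := by
  ext t
  simp only [pl, Pi.add_apply, add_mul, Finset.sum_add_distrib]

omit R in
theorem pl_smul (n : ℕ) (x : ℕ → ℝ) (s : ℝ) (c : Fin (n + 1) → ℝ) :
    pl n x (s • c) = fun t => s * pl n x c t := by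
  ext t
  simp only [pl, Pi.smul_apply, smul_eq_mul, mul_assoc, Finset.mul_sum]

omit R in
theorem modify_add (h : IsMesh P.a P.b n x) (c d : Fin (n + 1) → ℝ) :
    P.modify n x (pl n x (c + d))
      = fun t => P.modify n x (pl n x c) t + P.modify n x (pl n x d) t := by
  ext t
  -- `deriv` need not be additive at a node, where the summands may fail to be differentiable; its
  -- coefficient vanishes there.
  by_cases hb : bubble n x t = 0
  · simp [Problem.modify, hb, pl_add]
  · obtain ⟨k, hk, ht⟩ := IsMesh.exists_of_bubble_ne_zero hb
    have h1 := h.pl_hasDerivAt hk c ht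
    have h2 := h.pl_hasDerivAt hk d ht
    have h3 := h1.add h2
    simp only [Problem.modify, pl_add]
    have e : deriv (fun t => pl n x c t + pl n x d t) t = deriv (pl n x c) t + deriv (pl n x d) t := by
      rw [h1.deriv, h2.deriv]
      exact h3.deriv
    rw [e]
    ring

omit R in
theorem modify_smul (h : IsMesh P.a P.b n x) (s : ℝ) (c : Fin (n + 1) → ℝ) :
    P.modify n x (pl n x (s • c)) = fun t => s * P.modify n x (pl n x c) t := by
  ext t
  by_cases hb : bubble n x t = 0
  · simp [Problem.modify, hb, pl_smul]
  · obtain ⟨k, hk, ht⟩ := IsMesh.exists_of_bubble_ne_zero hb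
    have h1 := h.pl_hasDerivAt hk c ht
    simp only [Problem.modify, pl_smul]
    have e : deriv (fun t => s * pl n x c t) t = s * deriv (pl n x c) t := by
      rw [h1.deriv]
      exact (h1.const_mul s).deriv
    rw [e]
    ring

omit R in
theorem newFun_add (h : IsMesh P.a P.b n x) (c d : Fin (n + 1) → ℝ) :
    P.newFun n x (c + d) = fun t => P.newFun n x c t + P.modify n x (pl n x d) t := by
  ext t
  simp only [Problem.newFun, modify_add h]
  ring

end RegularData

namespace RegularData

variable {P : Problem} (R : RegularData P) {n : ℕ} {x : ℕ → ℝ}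
include R

/-! ## Existence and uniqueness of the Galerkin solution -/

/-- Coercivity bounds all point values by the energy, and at the nodes the modified function still
has the values `d`. No smallness of the mesh is needed. -/
theorem eq_zero_of_form_modify_eq_zero (h : IsMesh P.a P.b n x) {d : Fin (n + 1) → ℝ}
    (hl : P.left.Test (d 0)) (hr : P.right.Test (d (Fin.last n)))
    (h0 : P.form (P.modify n x (pl n x d)) (P.modify n x (pl n x d)) = 0) : d = 0 := by
  obtain ⟨K, -, hK⟩ := R.exists_coercive
  ext j
  have hj : (j : ℕ) ≤ n := Nat.lt_succ_iff.1 j.2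
  have := hK _ _ (R.modify_pair h d) (by rw [(R.left_values h d).2.2]; exact hl)
    (by rw [(R.right_values h d).2.2]; exact hr) (x j) ⟨h.left_le hj, h.le_right hj⟩
  rw [h0, mul_zero, (R.node_values h d j).2.2] at this
  exact pow_eq_zero_iff two_ne_zero |>.1 (le_antisymm this (sq_nonneg _))

theorem newFun_rep' (h : IsMesh P.a P.b n x) (c : Fin (n + 1) → ℝ) :
    ∃ p, H1Rep P.a P.b (P.newFun n x c) p := by
  obtain ⟨p, hp⟩ := R.exists_smoothFun_pair h c
  exact ⟨p, R.newFun_rep h c hp⟩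

theorem form_newFun_add (h : IsMesh P.a P.b n x) (c d e : Fin (n + 1) → ℝ) :
    P.form (P.newFun n x (c + d)) (P.modify n x (pl n x e))
      = P.form (P.newFun n x c) (P.modify n x (pl n x e))
        + P.form (P.modify n x (pl n x d)) (P.modify n x (pl n x e)) := by
  obtain ⟨p, hp⟩ := R.newFun_rep' h c
  rw [newFun_add h, R.form_add_left hp (R.modify_pair h d).rep (R.modify_pair h e).rep]

omit R in
/-- The nodal values of the directions of the affine set of trial functions. -/
def testSpace (P : Problem) (n : ℕ) : Submodule ℝ (Fin (n + 1) → ℝ) where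
  carrier := {d | P.left.Test (d 0) ∧ P.right.Test (d (Fin.last n))}
  add_mem' hc hd := ⟨BC.test_add hc.1 hd.1, BC.test_add hc.2 hd.2⟩
  zero_mem' := ⟨BC.test_zero _, BC.test_zero _⟩
  smul_mem' s _ hd := ⟨BC.test_mul s hd.1, BC.test_mul s hd.2⟩

/-- Definiteness makes the map from the finite-dimensional test space to its dual injective, hence
surjective. -/
theorem exists_solution (h : IsMesh P.a P.b n x) (ℓ : testSpace P n →ₗ[ℝ] ℝ) :
    ∃ c : testSpace P n, ∀ d : testSpace P n,
      P.form (P.modify n x (pl n x c)) (P.modify n x (pl n x d)) = ℓ d := by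
  have rep := fun c => (R.modify_pair h c).rep
  let S : testSpace P n →ₗ[ℝ] testSpace P n →ₗ[ℝ] ℝ := LinearMap.mk₂ ℝ
    (fun c d => P.form (P.modify n x (pl n x c)) (P.modify n x (pl n x d)))
    (fun c c' d => by
      rw [Submodule.coe_add, modify_add h, R.form_add_left (rep _) (rep _) (rep _)])
    (fun s c d => by
      rw [Submodule.coe_smul, modify_smul h, R.form_mul_left s (rep _) (rep _), smul_eq_mul])
    (fun c d d' => by
      rw [Submodule.coe_add, modify_add h, P.form_comm,
        R.form_add_left (rep _) (rep _) (rep _), P.form_comm, P.form_comm _ (P.modify n x (pl n x c))])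
    (fun s c d => by
      rw [Submodule.coe_smul, modify_smul h, P.form_comm, R.form_mul_left s (rep _) (rep _),
        smul_eq_mul, P.form_comm])
  have hinj : Function.Injective S := by
    rw [← LinearMap.ker_eq_bot, LinearMap.ker_eq_bot']
    intro c hc
    have h0 : S c c = 0 := by rw [hc]; rfl
    exact Subtype.ext (R.eq_zero_of_form_modify_eq_zero h c.2.1 c.2.2 h0)
  have hsurj : Function.Surjective S :=
    (LinearMap.injective_iff_surjective_of_finrank_eq_finrank
      (Subspace.dual_finrank_eq (K := ℝ) (V := testSpace P n)).symm).1 hinj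
  obtain ⟨c, hc⟩ := hsurj ℓ
  exact ⟨c, fun d => by rw [← hc]; rfl⟩

theorem existsUnique_isGalerkin (h : IsMesh P.a P.b n x) :
    ∃! c : Fin (n + 1) → ℝ, P.IsGalerkin n x c := by
  have rep := fun c => (R.modify_pair h c).rep
  obtain ⟨gl, hgl⟩ := P.left.exists_trial
  obtain ⟨gr, hgr⟩ := P.right.exists_trial
  have hn := h.pos R.lt
  -- An offset with admissible end values. The first and last index are distinct because `0 < n`.
  set c₀ : Fin (n + 1) → ℝ := fun j => if j = 0 then gl else gr with hc₀
  have hlast : Fin.last n ≠ 0 := fun he => by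
    have := congrArg Fin.val he
    simp at this
    omega
  obtain ⟨p₀, hp₀⟩ := R.newFun_rep' h c₀
  let ℓ : testSpace P n →ₗ[ℝ] ℝ :=
    { toFun := fun d => P.load (P.modify n x (pl n x d))
        - P.form (P.newFun n x c₀) (P.modify n x (pl n x d))
      map_add' := fun d d' => by
        rw [Submodule.coe_add, modify_add h, R.load_add (rep _) (rep _), P.form_comm,
          R.form_add_left (rep _) (rep _) hp₀, P.form_comm, P.form_comm _ (P.newFun n x c₀)]
        ring
      map_smul' := fun s d => by
        rw [Submodule.coe_smul, modify_smul h, load_mul, P.form_comm,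
          R.form_mul_left s (rep _) hp₀, P.form_comm, RingHom.id_apply, smul_eq_mul]
        ring }
  obtain ⟨d, hd⟩ := R.exists_solution h ℓ
  have hd' : ∀ e : Fin (n + 1) → ℝ, P.left.Test (e 0) → P.right.Test (e (Fin.last n)) →
      P.form (P.modify n x (pl n x d)) (P.modify n x (pl n x e))
        = P.load (P.modify n x (pl n x e))
          - P.form (P.newFun n x c₀) (P.modify n x (pl n x e)) :=
    fun e hl hr => hd ⟨e, hl, hr⟩
  refine ⟨c₀ + d, ⟨?_, ?_, fun e hl hr => ?_⟩, fun c hc => ?_⟩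
  · exact BC.trial_add_test (by simpa [hc₀] using hgl) d.2.1
  · exact BC.trial_add_test (by simpa [hc₀, hlast] using hgr) d.2.2
  · rw [R.form_newFun_add h, hd' e hl hr]
    ring
  -- The difference of two Galerkin solutions is a test direction that is orthogonal to itself.
  · have hl : P.left.Test ((c - (c₀ + d)) 0) :=
      BC.test_sub_of_trial hc.1 (BC.trial_add_test (by simpa [hc₀] using hgl) d.2.1)
    have hr : P.right.Test ((c - (c₀ + d)) (Fin.last n)) :=
      BC.test_sub_of_trial hc.2.1 (BC.trial_add_test (by simpa [hc₀, hlast] using hgr) d.2.2)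
    have h1 := hc.2.2 _ hl hr
    have h2 := R.form_newFun_add h c₀ d (c - (c₀ + d))
    rw [hd' _ hl hr] at h2
    have h3 := R.form_newFun_add h (c₀ + d) (c - (c₀ + d)) (c - (c₀ + d))
    rw [add_sub_cancel] at h3
    exact sub_eq_zero.1 (R.eq_zero_of_form_modify_eq_zero h hl hr (by linarith))

/-! ## Error estimates -/

theorem form_sub_self {u v p r : ℝ → ℝ} (hu : H1Rep P.a P.b u p) (hv : H1Rep P.a P.b v r) :
    P.form (fun t => u t - v t) (fun t => u t - v t)
      = P.form u u - 2 * P.form u v + P.form v v := by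
  rw [R.form_sub_left hu hv (hu.sub hv), P.form_comm u, P.form_comm v,
    R.form_sub_left hu hv hu, R.form_sub_left hu hv hv, P.form_comm v u]
  ring

/-- The energy of a function that vanishes at the endpoints is controlled by its derivative. -/
theorem exists_form_le : ∃ C : ℝ, 0 < C ∧ ∀ e p : ℝ → ℝ, H1Pair P.a P.b e p → e P.a = 0 →
    e P.b = 0 → P.form e e ≤ C * ∫ t in P.a..P.b, p t ^ 2 := by
  obtain ⟨M₁, h₁, hM₁⟩ := R.exists_bound R.β_cont
  obtain ⟨M₂, h₂, hM₂⟩ := R.exists_bound R.q_cont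
  set L := P.b - P.a with hL
  have hL0 : 0 < L := sub_pos.2 R.lt
  refine ⟨M₁ + M₂ * (L * L) + 1, by positivity, fun e p he ha hb => ?_⟩
  have hp := memLp_sq_intervalIntegrable R.le he.memLp
  set I := ∫ t in P.a..P.b, p t ^ 2 with hI
  have hI0 : 0 ≤ I := intervalIntegral.integral_nonneg R.le fun _ _ => sq_nonneg _
  have hz : ∀ B : BC, B.bilin 0 0 = 0 := fun B => by cases B <;> simp [BC.bilin]
  rw [R.form_eq he.rep he.rep, ha, hb, hz, hz, add_zero, add_zero]
  have h1 := intervalIntegral.integral_mono_on R.le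
    (R.form_integrable (he.continuousOn R.le).memLp_Ioo (he.continuousOn R.le).memLp_Ioo
      he.memLp he.memLp)
    ((hp.const_mul M₁).add (intervalIntegrable_const (c := M₂ * (L * I)))) fun t ht => by
      have b1 := mul_le_mul_of_nonneg_right ((le_abs_self _).trans (hM₁ t ht)) (sq_nonneg (p t))
      have b2 := mul_le_mul_of_nonneg_right ((le_abs_self _).trans (hM₂ t ht)) (sq_nonneg (e t))
      have b3 := he.sq_sub_le R.le ht (left_mem_Icc.2 R.le)
      rw [ha, sub_zero] at b3
      have b4 := mul_le_mul_of_nonneg_left b3 h₂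
      change _ ≤ M₁ * p t ^ 2 + M₂ * (L * I)
      calc R.β t * p t * p t + R.q t * e t * e t = R.β t * p t ^ 2 + R.q t * e t ^ 2 := by ring
        _ ≤ _ := by linarith
  rw [intervalIntegral.integral_add (hp.const_mul M₁) intervalIntegrable_const,
    intervalIntegral.integral_const_mul, intervalIntegral.integral_const, smul_eq_mul] at h1
  refine h1.trans ?_
  change M₁ * I + L * (M₂ * (L * I)) ≤ _
  linarith

/-- A common bound for the coefficients `β' / β` and `q / β`. -/
theorem exists_coeff_bound : ∃ M : ℝ, 0 ≤ M ∧ (∀ t ∈ Icc P.a P.b, |R.κ t| ≤ M) ∧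
    ∀ t ∈ Icc P.a P.b, |R.lam t| ≤ M := by
  obtain ⟨M₁, h₁, hM₁⟩ := R.exists_bound R.κ_cont
  obtain ⟨M₂, h₂, hM₂⟩ := R.exists_bound R.lam_cont
  exact ⟨M₁ + M₂, by positivity, fun t ht => (hM₁ t ht).trans (by linarith),
    fun t ht => (hM₂ t ht).trans (by linarith)⟩

/-- The modified interpolant of the solution of the differential equation. -/
theorem exists_energy_interpolation {u u' u'' u''' : ℝ → ℝ} (hu : H1Pair P.a P.b u u')
    (hu' : H1Pair P.a P.b u' u'') (hu'' : H1Pair P.a P.b u'' u''')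
    (heq : ∀ t ∈ Icc P.a P.b, u'' t = R.lam t * u t - R.κ t * u' t - R.φ t) :
    ∃ C : ℝ, 0 ≤ C ∧ ∀ (n : ℕ) (x : ℕ → ℝ), IsMesh P.a P.b n x → ∀ e : ℝ → ℝ,
      (e = fun t => u t - R.smoothFun n x (fun j => u (x j)) t) →
      P.form e e ≤ C * meshSize n x ^ 4 := by
  obtain ⟨CE, hCE, hE⟩ := R.exists_form_le
  obtain ⟨M₀, h₀, hκ, hlam⟩ := R.exists_coeff_bound
  obtain ⟨M₁, h₁, hM₁⟩ := R.exists_bound (hu.continuousOn R.le)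
  obtain ⟨M₂, h₂, hM₂⟩ := R.exists_bound (hu'.continuousOn R.le)
  obtain ⟨M₃, h₃, hM₃⟩ := R.exists_bound (hu''.continuousOn R.le)
  set M := M₀ + M₁ + M₂ + M₃ with hM
  set L := P.b - P.a with hL
  set Φ : ℝ → ℝ := fun y => 3 * (u''' y ^ 2 + (M ^ 2 * (L + 1)) ^ 2
      + (|R.lam' y| * M + M ^ 2 + |R.κ' y| * M + |R.φ' y|) ^ 2) with hΦ
  have iΦ : IntervalIntegrable Φ volume P.a P.b :=
    (((memLp_sq_intervalIntegrable R.le hu''.memLp).add intervalIntegrable_const).add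
      (memLp_sq_intervalIntegrable R.le (memLp_abs_affine R.lam_pair.memLp R.κ_pair.memLp
        R.φ_pair.memLp M (M ^ 2)))).const_mul 3
  have hΦ0 : ∀ y, 0 ≤ Φ y := fun y => by positivity
  have hI0 : 0 ≤ ∫ y in P.a..P.b, Φ y := intervalIntegral.integral_nonneg R.le fun y _ => hΦ0 y
  refine ⟨CE * ∫ y in P.a..P.b, Φ y, by positivity, fun n x h e hdef => ?_⟩
  obtain ⟨p, hp⟩ := R.exists_smoothFun_pair h fun j => u (x j)
  have he := hu.sub hp
  rw [← hdef] at he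
  have ha : e P.a = 0 := by
    simp only [hdef, (R.left_values h _).2.1, Fin.val_zero, h.1, sub_self]
  have hb : e P.b = 0 := by
    simp only [hdef, (R.right_values h _).2.1, Fin.val_last, h.2.1, sub_self]
  have key := h.integral_le_of_elem R.le (memLp_sq_intervalIntegrable R.le he.memLp) iΦ
    (C := meshSize n x ^ 4) fun k hk => by
      have hlt := h.2.2 k hk
      have h1 := h.left_le hk.le
      have h2 := h.le_right (k := k + 1) hk
      have hsub : Icc (x k) (x (k + 1)) ⊆ Icc P.a P.b := Icc_subset_Icc h1 h2
      have hek := (he.mono h1 hlt.le h2).congr_left hlt.le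
        (v := fun y => u y - elem R.κ R.lam R.φ (x k) (x (k + 1)) (u (x k)) (u (x (k + 1))) y)
        fun t ht => by simp only [hdef, R.smoothFun_eq h hk _ ht]
      refine (integral_elem_error_sq_le (L := L) (M := M) hlt (by linarith)
        (R.κ_pair.mono h1 hlt.le h2) (R.lam_pair.mono h1 hlt.le h2) (R.φ_pair.mono h1 hlt.le h2)
        (hu.mono h1 hlt.le h2) (hu'.mono h1 hlt.le h2) (hu''.mono h1 hlt.le h2)
        (fun y hy => heq y (hsub hy)) (fun y hy => (hκ y (hsub hy)).trans (by linarith))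
        (fun y hy => (hlam y (hsub hy)).trans (by linarith))
        (fun y hy => (hM₁ y (hsub hy)).trans (by linarith))
        (fun y hy => (hM₂ y (hsub hy)).trans (by linarith))
        (fun y hy => (hM₃ y (hsub hy)).trans (by linarith)) hek).trans ?_
      exact mul_le_mul_of_nonneg_right
        (pow_le_pow_left₀ (sub_pos.2 hlt).le (IsMesh.sub_le_meshSize hk) 4)
        (intervalIntegral.integral_nonneg hlt.le fun y _ => hΦ0 y)
  calc P.form e e ≤ CE * _ := hE e _ he ha hb
    _ ≤ CE * (meshSize n x ^ 4 * ∫ y in P.a..P.b, Φ y) := mul_le_mul_of_nonneg_left key hCE.le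
    _ = _ := by ring

/-- The modified interpolant of the solution of a dual problem. -/
theorem exists_dual_interpolation : ∃ C : ℝ, 0 < C ∧ ∀ w : ℝ → ℝ, ContinuousOn w (Icc P.a P.b) →
    ∃ z z' : ℝ → ℝ, H1Pair P.a P.b z z' ∧ P.left.Test (z P.a) ∧ P.right.Test (z P.b) ∧
      (∀ v r : ℝ → ℝ, H1Pair P.a P.b v r → P.left.Test (v P.a) → P.right.Test (v P.b) →
        P.form v z = ∫ t in P.a..P.b, v t * w t) ∧
      ∀ (n : ℕ) (x : ℕ → ℝ), IsMesh P.a P.b n x → ∀ e : ℝ → ℝ,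
        (e = fun t => z t - P.modify n x (pl n x fun j => z (x j)) t) →
        P.form e e ≤ C * meshSize n x ^ 2 * ∫ t in P.a..P.b, w t ^ 2 := by
  obtain ⟨CE, hCE, hE⟩ := R.exists_form_le
  obtain ⟨M, hM, hκ, hlam⟩ := R.exists_coeff_bound
  obtain ⟨K, hK, hdual⟩ := R.exists_dual
  set L := P.b - P.a with hL
  set X : ℝ → ℝ := fun y => M ^ 2 + L ^ 2 * (|R.lam' y| + M + |R.κ' y|) ^ 2 with hX
  have mχ : MemLp (fun y => |R.lam' y| + M + |R.κ' y|) 2 (volume.restrict (Ioo P.a P.b)) := by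
    have h1 : MemLp (fun y => |R.lam' y|) 2 (volume.restrict (Ioo P.a P.b)) :=
      R.lam_pair.memLp.norm
    have h2 : MemLp (fun y => |R.κ' y|) 2 (volume.restrict (Ioo P.a P.b)) := R.κ_pair.memLp.norm
    exact (h1.add (memLp_const M)).add h2
  have iX : IntervalIntegrable X volume P.a P.b :=
    intervalIntegrable_const.add ((memLp_sq_intervalIntegrable R.le mχ).const_mul _)
  have hX0 : ∀ y, 0 ≤ X y := fun y => by positivity
  have hIX : 0 ≤ ∫ y in P.a..P.b, X y := intervalIntegral.integral_nonneg R.le fun y _ => hX0 y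
  refine ⟨CE * (3 * K * (1 + ∫ y in P.a..P.b, X y)), by positivity, fun w hw => ?_⟩
  obtain ⟨z, z', z'', hz, hz', hl, hr, hform, hz2, hz'2, hz''2⟩ := hdual w hw
  refine ⟨z, z', hz, hl, hr, hform, fun n x h e hdef => ?_⟩
  set N := ∫ t in P.a..P.b, w t ^ 2 with hN
  have hN0 : 0 ≤ N := intervalIntegral.integral_nonneg R.le fun _ _ => sq_nonneg _
  -- `D` bounds both `z` and `z'` and is proportional to the `L^2` norm of `w`, so the final
  -- estimate is homogeneous in `w`.
  set D := Real.sqrt (K * N) with hD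
  have hD2 : D ^ 2 = K * N := Real.sq_sqrt (by positivity)
  set Φ : ℝ → ℝ := fun y => 3 * (z'' y ^ 2 + D ^ 2 * X y) with hΦ
  have iz := memLp_sq_intervalIntegrable R.le hz'.memLp
  have iΦ : IntervalIntegrable Φ volume P.a P.b := (iz.add (iX.const_mul _)).const_mul 3
  have hΦ0 : ∀ y, 0 ≤ Φ y := fun y => by have := hX0 y; positivity
  have he := hz.sub (R.modify_pair h fun j => z (x j))
  rw [← hdef] at he
  have ha : e P.a = 0 := by
    simp only [hdef, (R.left_values h _).2.2, Fin.val_zero, h.1, sub_self]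
  have hb : e P.b = 0 := by
    simp only [hdef, (R.right_values h _).2.2, Fin.val_last, h.2.1, sub_self]
  have key := h.integral_le_of_elem R.le (memLp_sq_intervalIntegrable R.le he.memLp) iΦ
    (C := meshSize n x ^ 2) fun k hk => by
      have hlt := h.2.2 k hk
      have h1 := h.left_le hk.le
      have h2 := h.le_right (k := k + 1) hk
      have hsub : Icc (x k) (x (k + 1)) ⊆ Icc P.a P.b := Icc_subset_Icc h1 h2
      have hek := (he.mono h1 hlt.le h2).congr_left hlt.le
        (v := fun y => z y - elem R.κ R.lam (fun _ => 0) (x k) (x (k + 1)) (z (x k))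
          (z (x (k + 1))) y)
        fun t ht => by simp only [hdef, R.modify_pl_eq h hk _ ht]
      refine (integral_elem_error_sq_le_of_bound (L := L) (M := M) (D := D) hlt (by linarith)
        (R.κ_pair.mono h1 hlt.le h2) (R.lam_pair.mono h1 hlt.le h2)
        (hz.mono h1 hlt.le h2) (hz'.mono h1 hlt.le h2)
        (fun y hy => hκ y (hsub hy)) (fun y hy => hlam y (hsub hy))
        (fun y hy => Real.abs_le_sqrt (hz2 y (hsub hy)))
        (fun y hy => Real.abs_le_sqrt (hz'2 y (hsub hy))) hek).trans ?_
      exact mul_le_mul_of_nonneg_right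
        (pow_le_pow_left₀ (sub_pos.2 hlt).le (IsMesh.sub_le_meshSize hk) 2)
        (intervalIntegral.integral_nonneg hlt.le fun y _ => hΦ0 y)
  have hIΦ : ∫ y in P.a..P.b, Φ y ≤ 3 * K * (1 + ∫ y in P.a..P.b, X y) * N := by
    rw [hΦ, intervalIntegral.integral_const_mul, intervalIntegral.integral_add iz
      (iX.const_mul _), intervalIntegral.integral_const_mul, hD2]
    linarith
  calc P.form e e ≤ CE * _ := hE e _ he ha hb
    _ ≤ CE * (meshSize n x ^ 2 * (3 * K * (1 + ∫ y in P.a..P.b, X y) * N)) :=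
      mul_le_mul_of_nonneg_left (key.trans (mul_le_mul_of_nonneg_left hIΦ (sq_nonneg _))) hCE.le
    _ = _ := by ring

theorem smoothFun_add (h : IsMesh P.a P.b n x) (c d : Fin (n + 1) → ℝ) :
    R.smoothFun n x (c + d) = fun t => R.smoothFun n x c t + P.modify n x (pl n x d) t := by
  ext t
  simp only [smoothFun, modify_add h]
  ring

/-- Error bounds for the representative of the Galerkin solution: the energy by the best
approximation property, the `L^2` norm by duality. -/
theorem exists_error_bound {u u' u'' u''' : ℝ → ℝ} (hu : H1Pair P.a P.b u u')
    (hu' : H1Pair P.a P.b u' u'') (hu'' : H1Pair P.a P.b u'' u''')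
    (heq : ∀ t ∈ Icc P.a P.b, u'' t = R.lam t * u t - R.κ t * u' t - R.φ t)
    (hul : P.left.Trial (u P.a)) (hur : P.right.Trial (u P.b))
    (hweak : ∀ v r : ℝ → ℝ, H1Pair P.a P.b v r → P.left.Test (v P.a) → P.right.Test (v P.b) →
      P.form u v = P.load v) :
    ∃ C : ℝ, 0 ≤ C ∧ ∀ (n : ℕ) (x : ℕ → ℝ), IsMesh P.a P.b n x → ∀ c, P.IsGalerkin n x c →
      ∃ w p : ℝ → ℝ, H1Pair P.a P.b w p ∧ H1Rep P.a P.b (fun t => u t - P.newFun n x c t) p ∧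
        (fun t => u t - P.newFun n x c t) =ᵐ[volume.restrict (Ioo P.a P.b)] w ∧
        P.form (fun t => u t - P.newFun n x c t) (fun t => u t - P.newFun n x c t)
          ≤ C * meshSize n x ^ 4 ∧
        ∫ t in P.a..P.b, w t ^ 2 ≤ C * meshSize n x ^ 6 ∧
        ∫ t in P.a..P.b, p t ^ 2 ≤ C * meshSize n x ^ 4 := by
  obtain ⟨C₁, hC₁, hint⟩ := R.exists_energy_interpolation hu hu' hu'' heq
  obtain ⟨C₂, hC₂, hdual⟩ := R.exists_dual_interpolation
  have hβ := R.β₀_pos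
  refine ⟨C₁ + C₂ * C₁ + C₁ / R.β₀, by positivity, fun n x h c hc => ?_⟩
  set H := meshSize n x
  have hH : 0 < H := h.meshSize_pos R.lt
  obtain ⟨pc, hpc⟩ := R.exists_smoothFun_pair h c
  set w : ℝ → ℝ := fun t => u t - R.smoothFun n x c t with hw
  have hwp : H1Pair P.a P.b w fun t => u' t - pc t := hu.sub hpc
  have hnew := R.newFun_rep h c hpc
  have hrep := hu.rep.sub hnew
  have hae : (fun t => u t - P.newFun n x c t) =ᵐ[volume.restrict (Ioo P.a P.b)] w := by
    filter_upwards [R.newFun_ae_eq n x c] with t ht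
    rw [hw, ht]
  have hwa' : w P.a = u P.a - c 0 := by
    change u P.a - R.smoothFun n x c P.a = _
    rw [(R.left_values h c).2.1]
  have hwb' : w P.b = u P.b - c (Fin.last n) := by
    change u P.b - R.smoothFun n x c P.b = _
    rw [(R.right_values h c).2.1]
  have hwa : u P.a - P.newFun n x c P.a = w P.a := by rw [hwa', (R.left_values h c).1]
  have hwb : u P.b - P.newFun n x c P.b = w P.b := by rw [hwb', (R.right_values h c).1]
  have hwl : P.left.Test (w P.a) := hwa'.symm ▸ BC.test_sub_of_trial hul hc.1
  have hwr : P.right.Test (w P.b) := hwb'.symm ▸ BC.test_sub_of_trial hur hc.2.1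
  have hformw : ∀ v r : ℝ → ℝ, H1Rep P.a P.b v r →
      P.form (fun t => u t - P.newFun n x c t) v = P.form w v := fun v r hv =>
    R.form_congr_left hrep hwp.rep hae hwa hwb hv
  have hww : P.form (fun t => u t - P.newFun n x c t) (fun t => u t - P.newFun n x c t)
      = P.form w w := by
    rw [hformw _ _ hrep, P.form_comm, hformw _ _ hwp.rep]
  have horth : ∀ d : Fin (n + 1) → ℝ, P.left.Test (d 0) → P.right.Test (d (Fin.last n)) →
      P.form w (P.modify n x (pl n x d)) = 0 := fun d hl hr => by
    have hd := R.modify_pair h d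
    rw [← hformw _ _ hd.rep, R.form_sub_left hu.rep hnew hd.rep, hc.2.2 d hl hr,
      hweak _ _ hd (by rw [(R.left_values h d).2.2]; exact hl)
        (by rw [(R.right_values h d).2.2]; exact hr), sub_self]
  have henergy : P.form w w ≤ C₁ * H ^ 4 := by
    set cI : Fin (n + 1) → ℝ := fun j => u (x j) with hcI
    have hl : P.left.Test ((cI - c) 0) := BC.test_sub_of_trial
      (by simpa only [hcI, Fin.val_zero, h.1] using hul) hc.1
    have hr : P.right.Test ((cI - c) (Fin.last n)) := BC.test_sub_of_trial
      (by simpa only [hcI, Fin.val_last, h.2.1] using hur) hc.2.1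
    have hd := (R.modify_pair h (cI - c)).rep
    -- The interpolant and the Galerkin solution differ by a test direction. By orthogonality the
    -- energy of the interpolation error is that of `w` plus that of this direction.
    have e : (fun t => w t - P.modify n x (pl n x (cI - c)) t)
        = fun t => u t - R.smoothFun n x cI t := by
      have := R.smoothFun_add h c (cI - c)
      rw [add_sub_cancel] at this
      rw [this, hw]
      ext t
      ring
    have h1 := R.form_sub_self hwp.rep hd
    rw [horth _ hl hr] at h1
    have h2 := hint n x h _ e
    have h3 := R.form_self_nonneg hd
    linarith
  have hL2 : ∫ t in P.a..P.b, w t ^ 2 ≤ C₂ * C₁ * H ^ 6 := by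
    obtain ⟨z, z', hz, hzl, hzr, hform, happ⟩ := hdual w (hwp.continuousOn R.le)
    set N := ∫ t in P.a..P.b, w t ^ 2 with hN
    have hNform : P.form w z = N := by
      rw [hform w _ hwp hwl hwr, hN]
      simp only [pow_two]
    set zI : Fin (n + 1) → ℝ := fun j => z (x j) with hzI
    have hT := R.modify_pair h zI
    have hez := (hz.sub hT).rep
    have h0 := horth zI (by simpa only [hzI, Fin.val_zero, h.1] using hzl)
      (by simpa only [hzI, Fin.val_last, h.2.1] using hzr)
    have hwe : P.form w (fun t => z t - P.modify n x (pl n x zI) t) = N := by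
      rw [P.form_comm, R.form_sub_left hz.rep hT.rep hwp.rep, P.form_comm, hNform, P.form_comm, h0,
        sub_zero]
    have hee := happ n x h _ rfl
    set e : ℝ → ℝ := fun t => z t - P.modify n x (pl n x zI) t
    -- Cauchy–Schwarz written as nonnegativity of the energy of `τ w - e`. As `e` has energy at most
    -- `τ * N` and its product with `w` is `N`, this choice gives `N ≤ τ * P.form w w` without
    -- dividing by `N`, which may be zero.
    set τ := C₂ * H ^ 2 with hτ
    have hτ0 : 0 < τ := by positivity
    have h1 := R.form_self_nonneg ((hwp.rep.const_mul τ).sub hez)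
    rw [R.form_sub_self (hwp.rep.const_mul τ) hez, R.form_mul_left τ hwp.rep hez,
      R.form_mul_left τ hwp.rep (hwp.rep.const_mul τ), P.form_comm w,
      R.form_mul_left τ hwp.rep hwp.rep, hwe] at h1
    have h2 : τ * N ≤ τ * (τ * P.form w w) := by linarith
    have h3 := le_of_mul_le_mul_left h2 hτ0
    calc N ≤ τ * P.form w w := h3
      _ ≤ τ * (C₁ * H ^ 4) := mul_le_mul_of_nonneg_left henergy hτ0.le
      _ = _ := by rw [hτ]; ring
  have hder : ∫ t in P.a..P.b, (u' t - pc t) ^ 2 ≤ C₁ / R.β₀ * H ^ 4 := by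
    have := (R.integral_deriv_sq_le hwp.rep).trans henergy
    rw [div_mul_eq_mul_div, le_div_iff₀ hβ]
    linarith
  have q1 : 0 ≤ C₁ * H ^ 4 := by positivity
  have q2 : 0 ≤ C₂ * C₁ * H ^ 4 := by positivity
  have q3 : 0 ≤ C₁ / R.β₀ * H ^ 4 := by positivity
  have q4 : 0 ≤ C₁ * H ^ 6 := by positivity
  have q5 : 0 ≤ C₁ / R.β₀ * H ^ 6 := by positivity
  exact ⟨w, _, hwp, hrep, hae, by rw [hww]; linarith, by linarith, by linarith⟩

end RegularData

/-! ### Regular representatives of the data and the strong form of the equation -/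

theorem le_on_Icc_of_le_on_Ioo {a b c : ℝ} (hab : a < b) {g : ℝ → ℝ}
    (hg : ContinuousOn g (Icc a b)) (h : ∀ x ∈ Ioo a b, c ≤ g x) : ∀ x ∈ Icc a b, c ≤ g x := by
  intro x hx
  rw [← closure_Ioo hab.ne] at hg hx
  exact le_on_closure (f := fun _ => c) h continuousOn_const hg hx

theorem H1Pair.div {a b : ℝ} (hab : a ≤ b) {g g' β ρ : ℝ → ℝ} (hg : H1Pair a b g g')
    (hβ : H1Pair a b β ρ) (hρ : ContinuousOn ρ (Icc a b)) (h0 : ∀ x ∈ Icc a b, β x ≠ 0) :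
    ∃ r, H1Pair a b (fun x => g x / β x) r :=
  ⟨_, (H1Pair.mul hab hg (hβ.inv hab h0 hρ
    fun _ hx => hβ.hasDerivAt_of_continuousOn hρ hx)).congr_left hab
      fun _ _ => (div_eq_mul_inv _ _).symm⟩

/-- Continuity turns the almost everywhere equality with the representatives of `β` and `q` into
equality at every interior point; for `f` it stays almost everywhere. Two weak derivatives make `β'`
continuous up to the endpoints, and a continuous `q ≥ 0` that is nonzero somewhere has positive
integral. -/
theorem Problem.nonempty_regularData (P : Problem) (hab : P.a < P.b)
    (β₀ : ℝ) (hβ₀ : 0 < β₀) (hβ_lower : ∀ x ∈ Ioo P.a P.b, β₀ ≤ P.β x)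
    (hβ_cont : ContinuousOn P.β (Ioo P.a P.b)) (hβ_H2 : MemH P.a P.b 2 P.β)
    (hq_nonneg : ∀ x ∈ Ioo P.a P.b, 0 ≤ P.q x)
    (hq_cont : ContinuousOn P.q (Ioo P.a P.b)) (hq_H1 : MemH P.a P.b 1 P.q)
    (hf_H1 : MemH P.a P.b 1 P.f)
    (hleft : P.left.Nonneg) (hright : P.right.Nonneg)
    (hdef : P.left.Definite ∨ P.right.Definite ∨ ∃ x ∈ Ioo P.a P.b, P.q x ≠ 0) :
    Nonempty (RegularData P) := by
  obtain ⟨β, w, hβ, eβ, hw⟩ := hβ_H2.exists_h1Pair hab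
  obtain ⟨ρ, ρ', hρ, eρ, -⟩ := hw.exists_h1Pair hab
  obtain ⟨q, q', hq, eq, -⟩ := hq_H1.exists_h1Pair hab
  obtain ⟨f, f', hf, ef, -⟩ := hf_H1.exists_h1Pair hab
  replace hβ := hβ.congr hab.le (fun _ _ => rfl) eρ
  have hβc := hβ.continuousOn hab.le
  have hqc := hq.continuousOn hab.le
  have hβe : EqOn P.β β (Ioo P.a P.b) :=
    Measure.eqOn_Ioo_of_ae_eq volume eβ hβ_cont (hβc.mono Ioo_subset_Icc_self)
  have hqe : EqOn P.q q (Ioo P.a P.b) :=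
    Measure.eqOn_Ioo_of_ae_eq volume eq hq_cont (hqc.mono Ioo_subset_Icc_self)
  have hβge := le_on_Icc_of_le_on_Ioo hab hβc fun x hx => hβe hx ▸ hβ_lower x hx
  have hqge := le_on_Icc_of_le_on_Ioo hab hqc fun x hx => hqe hx ▸ hq_nonneg x hx
  have hne : ∀ x ∈ Icc P.a P.b, β x ≠ 0 := fun x hx => (hβ₀.trans_le (hβge x hx)).ne'
  have hρc := hρ.continuousOn hab.le
  obtain ⟨κ', hκ⟩ := hρ.div hab.le hβ hρc hne
  obtain ⟨lam', hlam⟩ := hq.div hab.le hβ hρc hne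
  obtain ⟨φ', hφ⟩ := hf.div hab.le hβ hρc hne
  refine ⟨⟨β, ρ, q, f, _, κ', _, lam', _, φ', β₀, hab, hβ₀, hβge, hβ, hρc, hqc,
    hf.continuousOn hab.le, hqge, hβe, hqe, ef, fun _ => rfl, fun _ => rfl, fun _ => rfl, hκ, hlam,
    hφ, hleft, hright, hdef.imp_right (Or.imp_right ?_)⟩⟩
  rintro ⟨x, hx, hx0⟩
  refine intervalIntegral.integral_pos hab hqc (fun y hy => hqge y (Ioc_subset_Icc_self hy))
    ⟨x, Ioo_subset_Icc_self hx, ?_⟩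
  rw [hqe hx] at hx0
  exact lt_of_le_of_ne (hqge x (Ioo_subset_Icc_self hx)) hx0.symm

namespace RegularData

variable {P : Problem} (R : RegularData P)
include R

/-- A weak solution in `H^3` satisfies the differential equation. -/
theorem strong_equation {u u' u'' : ℝ → ℝ} (hu : H1Pair P.a P.b u u') (hu' : H1Pair P.a P.b u' u'')
    (hu'' : ContinuousOn u'' (Icc P.a P.b))
    (hweak : ∀ v r : ℝ → ℝ, H1Pair P.a P.b v r → P.left.Test (v P.a) → P.right.Test (v P.b) →
      P.form u v = P.load v) :
    ∀ t ∈ Icc P.a P.b, u'' t = R.lam t * u t - R.κ t * u' t - R.φ t := by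
  have huc := hu.continuousOn R.le
  have huc' := hu'.continuousOn R.le
  have hflux := H1Pair.mul R.le R.β_pair hu'
  have hqf : ContinuousOn (fun t => R.q t * u t - R.f t) (Icc P.a P.b) :=
    (R.q_cont.mul huc).sub R.f_cont
  have hW : IsWeakDeriv P.a P.b (fun t => R.β t * u' t) fun t => R.q t * u t - R.f t := by
    refine ⟨MemLp.locallyIntegrableOn_Ioo (hflux.continuousOn R.le).memLp_Ioo,
      MemLp.locallyIntegrableOn_Ioo hqf.memLp_Ioo, fun ψ hψ _ hs => ?_⟩
    have hp := h1Pair_of_contDiff R.le hψ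
    have ha := eqOn_compl_zero_of_tsupport_subset hs left_notMem_Ioo
    have hb := eqOn_compl_zero_of_tsupport_subset hs right_notMem_Ioo
    have h1 := hweak ψ _ hp (by rw [ha]; exact BC.test_zero _) (by rw [hb]; exact BC.test_zero _)
    have z1 : ∀ (B : BC) s, B.bilin s 0 = 0 := fun B s => by cases B <;> simp [BC.bilin]
    have z2 : ∀ B : BC, B.lin 0 = 0 := fun B => by cases B <;> simp [BC.lin]
    have h2 : P.load ψ = ∫ t in P.a..P.b, R.f t * ψ t := by
      rw [Problem.load, ha, hb, z2, z2, add_zero, add_zero, ← setIntegral_Ioo_eq R.le]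
      refine integral_congr_ae ?_
      filter_upwards [R.f_eq] with t ht
      rw [ht]
    have hψc := hp.continuousOn R.le
    have i1 : IntervalIntegrable (fun t => R.β t * u' t * deriv ψ t) volume P.a P.b :=
      memLp_mul_intervalIntegrable R.le (R.β_cont.mul huc').memLp_Ioo hp.memLp
    have i2 : IntervalIntegrable (fun t => R.q t * u t * ψ t) volume P.a P.b :=
      ((R.q_cont.mul huc).mul hψc).intervalIntegrable_of_Icc R.le
    have i3 : IntervalIntegrable (fun t => R.f t * ψ t) volume P.a P.b :=
      (R.f_cont.mul hψc).intervalIntegrable_of_Icc R.le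
    rw [R.form_eq hu.rep hp.rep, ha, hb, z1, z1, add_zero, add_zero, h2,
      intervalIntegral.integral_add i1 i2] at h1
    rw [setIntegral_Ioo_eq R.le, setIntegral_Ioo_eq R.le]
    simp_rw [sub_mul]
    rw [intervalIntegral.integral_sub i2 i3]
    linarith
  -- The product rule and the weak equation give two weak derivatives of `β u'`. They agree almost
  -- everywhere, and by continuity everywhere.
  have hae := (hflux.isWeakDeriv R.le).ae_unique hW
  have heq : EqOn (fun t => R.ρ t * u' t + R.β t * u'' t) (fun t => R.q t * u t - R.f t)
      (Icc P.a P.b) := by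
    refine Measure.eqOn_Icc_of_ae_eq volume R.lt.ne ?_
      ((R.ρ_cont.mul huc').add (R.β_cont.mul hu'')) hqf
    rwa [← Measure.restrict_congr_set (Ioo_ae_eq_Icc (μ := volume))]
  intro t ht
  have h1 := heq ht
  simp only at h1
  have h2 := (R.β_pos ht).ne'
  rw [R.lam_eq, R.κ_eq, R.φ_eq]
  field_simp
  linarith

end RegularData

end CompactFEM

/-! ### Existence, uniqueness and the three error bounds -/

theorem theorem2 (P : Problem) (hab : P.a < P.b)
    (β₀ : ℝ) (hβ₀ : 0 < β₀) (hβ_lower : ∀ x ∈ Ioo P.a P.b, β₀ ≤ P.β x)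
    (hβ_C1 : ContDiffOn ℝ 1 P.β (Ioo P.a P.b)) (hβ_H2 : MemH P.a P.b 2 P.β)
    (hq_nonneg : ∀ x ∈ Ioo P.a P.b, 0 ≤ P.q x)
    (hq_cont : ContinuousOn P.q (Ioo P.a P.b)) (hq_H1 : MemH P.a P.b 1 P.q)
    (hf_H1 : MemH P.a P.b 1 P.f)
    (hleft : P.left.Nonneg) (hright : P.right.Nonneg)
    (hdef : P.left.Definite ∨ P.right.Definite ∨ ∃ x ∈ Ioo P.a P.b, P.q x ≠ 0)
    (u : ℝ → ℝ) (hu : P.IsWeakSolution u) (hu_H3 : MemH P.a P.b 3 u) :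
    ∃ C : ℝ, ∀ (n : ℕ) (x : ℕ → ℝ), IsMesh P.a P.b n x →
      (∃! c : Fin (n + 1) → ℝ, P.IsGalerkin n x c) ∧
      ∀ c : Fin (n + 1) → ℝ, P.IsGalerkin n x c →
        MemH P.a P.b 1 (P.newFun n x c) ∧
        normL2 P.a P.b (fun t => u t - P.newFun n x c t) ≤ C * meshSize n x ^ 3 ∧
        normH1 P.a P.b (fun t => u t - P.newFun n x c t) ≤ C * meshSize n x ^ 2 ∧
        P.normE (fun t => u t - P.newFun n x c t) ≤ C * meshSize n x ^ 2 := by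
  obtain ⟨R⟩ := P.nonempty_regularData hab β₀ hβ₀ hβ_lower hβ_C1.continuousOn hβ_H2 hq_nonneg
    hq_cont hq_H1 hf_H1 hleft hright hdef
  obtain ⟨-, huc, hul, hur, hweak⟩ := hu
  obtain ⟨w₁, hu₁, hw₁⟩ := hu_H3.h1Pair_of_continuousOn hab huc
  obtain ⟨u', w₂, hu', e₁, hw₂⟩ := hw₁.exists_h1Pair hab
  obtain ⟨u'', u''', hu'', e₂, -⟩ := hw₂.exists_h1Pair hab
  replace hu₁ := hu₁.congr hab.le (fun _ _ => rfl) e₁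
  replace hu' := hu'.congr hab.le (fun _ _ => rfl) e₂
  have hweak' : ∀ v r : ℝ → ℝ, H1Pair P.a P.b v r → P.left.Test (v P.a) → P.right.Test (v P.b) →
      P.form u v = P.load v := fun v r hv hl hr =>
    hweak v (hv.rep.memH hab.le) (hv.continuousOn hab.le) hl hr
  have heq := R.strong_equation hu₁ hu' (hu''.continuousOn hab.le) hweak'
  obtain ⟨C, hC, hbound⟩ := R.exists_error_bound hu₁ hu' hu'' heq hul hur hweak'
  set L := P.b - P.a with hL
  have hLpos : 0 < L := sub_pos.2 hab
  -- The `H^1` norm contains the `L^2` part, of size `C * H ^ 6`; since `H ≤ L` this is at most `C *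
  -- L ^ 2 * H ^ 4`, which explains the second summand.
  refine ⟨Real.sqrt (C + C * L ^ 2), fun n x h => ⟨R.existsUnique_isGalerkin h, fun c hc => ?_⟩⟩
  obtain ⟨w, p, hwp, hrep, hae, hE, hL2, hH1⟩ := hbound n x h c hc
  set H := meshSize n x
  have hH : 0 < H := h.meshSize_pos hab
  have hHL : H ≤ L := by
    have : Nonempty (Fin n) := ⟨⟨0, h.pos hab⟩⟩
    refine ciSup_le fun k => ?_
    have := h.left_le k.2.le
    have := h.le_right (k := k + 1) k.2
    linarith
  have hsqrt : ∀ {X : ℝ} (m : ℕ), X ≤ (C + C * L ^ 2) * (H ^ m) ^ 2 →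
      Real.sqrt X ≤ Real.sqrt (C + C * L ^ 2) * H ^ m := fun m hX => by
    rw [Real.sqrt_le_iff]
    refine ⟨by positivity, ?_⟩
    rwa [mul_pow, Real.sq_sqrt (by positivity)]
  have hL2' : ∫ t in Ioo P.a P.b, (u t - P.newFun n x c t) ^ 2 ≤ C * H ^ 6 := by
    refine le_trans (le_of_eq ?_) hL2
    rw [← setIntegral_Ioo_eq hab.le]
    refine integral_congr_ae ?_
    filter_upwards [hae] with t ht
    rw [ht]
  have hH1' : ∫ t in Ioo P.a P.b, weakDeriv P.a P.b (fun t => u t - P.newFun n x c t) t ^ 2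
      ≤ C * H ^ 4 := by
    refine le_trans (le_of_eq ?_) hH1
    rw [← setIntegral_Ioo_eq hab.le]
    refine integral_congr_ae ?_
    filter_upwards [hrep.weakDeriv_ae_eq hab.le] with t ht
    rw [ht]
  have hCL : 0 ≤ C * L ^ 2 := by positivity
  have hH6 : C * H ^ 6 ≤ C * L ^ 2 * H ^ 4 := by
    have := mul_le_mul_of_nonneg_left (pow_le_pow_left₀ hH.le hHL 2)
      (show 0 ≤ C * H ^ 4 by positivity)
    linarith
  have q1 : 0 ≤ C * L ^ 2 * H ^ 4 := by positivity
  have q2 : 0 ≤ C * L ^ 2 * H ^ 6 := by positivity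
  obtain ⟨pc, hpc⟩ := R.newFun_rep' h c
  exact ⟨hpc.memH hab.le, hsqrt 3 (by linarith), hsqrt 2 (by linarith), hsqrt 2 (by linarith)⟩
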